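/- Let $0\le\alpha,\beta<1$, let $n\ge 1$ be an integer, and let $\mathcal H=L^2[(-1,1),(1-x)^\alpha(1+x)^\beta\,dx]$ (complex-valued functions). Let $$\ell[f](x)=-\frac{1}{(1-x)^\alpha(1+x)^\beta}\left[(1-x)^{\alpha+1}(1+x)^{\beta+1}f'(x)\right]'$$ be the Jacobi differential expression and let $\ell^n$ be its $n$-fold composition. Let $$\mathcal D_{\max}=\{f\in\mathcal H : f,f',\dots,f^{(2n-1)}\in AC_{\rm loc}(-1,1),\ \ell^n[f]\in\mathcal H\},$$ $$\mathcal D_{\min}=\{f\in\mathcal D_{\max} : [f,g]=0\ \text{ for all } g\in\mathcal D_{\max}\},\qquad [f,g]=\langle \ell^n f,g\rangle-\langle f,\ell^n g\rangle ,$$ $\mathbf L_{\min}=\{\ell^n,\mathcal D_{\min}\}$, $\mathbf L_{\max}=\{\ell^n,\mathcal D_{\max}\}$, and let $\mathcal D_\pm=\{f\in\mathcal D(\mathbf L_{\min}^*):\mathbf L_{\min}^*f=\pm i f\}$ be the defect spaces. For $j=0,\dots,n-1$ let $\varphi_j^{\pm},\psi_j^{\pm}$ be any functions in $C^\infty(-1,1)$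 such that $\varphi_j^+,\psi_j^+$ vanish near $-1$, $\varphi_j^-,\psi_j^-$ vanish near $1$, and $$\varphi_j^+=(1-x)^j,\quad \psi_j^+=(1-x)^{-\alpha+j}\ \text{ near } 1,\qquad \varphi_j^-=(1+x)^j,\quad \psi_j^-=(1+x)^{-\beta+j}\ \text{ near } -1,$$ where in the case $\alpha=0$ (resp. $\beta=0$) the condition on $\psi_j^+$ (resp. $\psi_j^-$) is replaced by $\psi_j^+=(1-x)^j\log(1-x)$ near $1$ (resp. $\psi_j^-=(1+x)^j\log(1+x)$ near $-1$). Let $\mathbf D^n_\pm=\operatorname{span}\{\varphi_0^\pm,\dots,\varphi_{n-1}^\pm,\psi_0^\pm,\dots,\psi_{n-1}^\pm\}$. Then: 1. The $4n$ functions $\varphi_j^\pm,\psi_j^\pm$ lie in $\mathcal D_{\max}$ and are linearly independent modulo $\mathcal D_{\min}$, and $\mathcal D_{\max}=\mathcal D_{\min}\dotplus\mathbf D^n_-\dotplus\mathbf D^n_+$; moreover $\dim\mathcal D_+=\dim\mathcal D_-=\dim\mathbf D^n_+=\dim\mathbf D^n_-=2n$. 2. Let $e_1^\pm,\dots,e_{2n}^\pm$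 be any orthonormal bases of $\mathcal D_\pm$, let $b_1^\pm,\dots,b_{2n}^\pm$ be the bases $(\varphi_j^\pm,\psi_j^\pm)_{0\le j<n}$ of $\mathbf D_\pm^n$, and let $U_\pm:\mathcal D_\pm\to\mathbf D_\pm^n$ be the change-of-basis maps $e_k^\pm\mapsto b_k^\pm$. For a $2n\times 2n$ unitary matrix $u$ let $U_n:\mathbf D_+^n\to\mathbf D_-^n$ be the linear map with matrix $u$ in the bases $b^+,b^-$, and let $\mathbf L_u$ be the restriction of $\mathbf L_{\max}$ to $$\{\,y+g+U_-^{-1}U_nU_+\,g : y\in\mathcal D_{\min},\ g\in\mathcal D_+\,\}.$$ Then $u\mapsto\mathbf L_u$ is a bijection from the $2n\times 2n$ unitary matrices onto the self-adjoint extensions of $\mathbf L_{\min}$ in $\mathcal H$. 3. Write $(b_i)_{i=1}^{4n}$ for $(b^+_1,\dots,b^+_{2n},b^-_1,\dots,b^-_{2n})$. There are $4n\times 2n$ complex matrices $C_+,C_-$, independent of $u$, such that the $4n\times 4n$ matrix $(C_+\,|\,C_-)$ is invertible and, for every unitary $u$, $$\mathcal D(\mathbf L_u)=\mathcal D_{\min}+\operatorname{span}\Big\{\sum_{i=1}^{4n}(C_++C_-u)_{ij}\,b_i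 : j=1,\dots,2n\Big\}.$$ -/

import Mathlib

open MeasureTheory Set Filter Topology
open scoped ContDiff InnerProductSpace

noncomputable section

/-- The function `(1 - x)^a (1 + x)^b` (only used for `x ∈ (-1, 1)`). -/
def jacobiWeight (a b : ℝ) (x : ℝ) : ℝ := (1 - x) ^ a * (1 + x) ^ b

/-- The measure `(1 - x)^α (1 + x)^β dx` on `(-1, 1)`. -/
def jacobiMeasure (α β : ℝ) : Measure ℝ :=
  (volume.restrict (Ioo (-1) 1)).withDensity fun x => ENNReal.ofReal (jacobiWeight α β x)

/-- The Hilbert space `L²[(-1, 1), (1 - x)^α (1 + x)^β]` of complex valued functions. -/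
abbrev JacobiL2 (α β : ℝ) : Type := Lp ℂ 2 (jacobiMeasure α β)

/-- The Jacobi differential expression
`ℓ[f] = -((1 - x)^α (1 + x)^β)⁻¹ ((1 - x)^(α+1) (1 + x)^(β+1) f')'`. -/
def jacobiExpr (α β : ℝ) (f : ℝ → ℂ) : ℝ → ℂ := fun x =>
  -((jacobiWeight α β x)⁻¹ •
    deriv (fun y => jacobiWeight (α + 1) (β + 1) y • deriv f y) x)

/-- The `n`-th composition `ℓⁿ` of the Jacobi expression. -/
def jacobiPow (α β : ℝ) (n : ℕ) (f : ℝ → ℂ) : ℝ → ℂ := (jacobiExpr α β)^[n] f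

/-- `f, f', …, f^(2n-1)` exist and are locally absolutely continuous on `(-1, 1)`. Equivalently:
`f` is `2n - 1` times continuously differentiable on `(-1, 1)` and `f^(2n-1)` is absolutely
continuous on every compact subinterval (the lower derivatives then are so too, being `C¹`). -/
def JacobiRegular (n : ℕ) (f : ℝ → ℂ) : Prop :=
  ContDiffOn ℝ ((2 * n - 1 : ℕ) : ℕ∞) f (Ioo (-1) 1) ∧
    ∀ a ∈ Ioo (-1 : ℝ) 1, ∀ b ∈ Ioo (-1 : ℝ) 1,
      AbsolutelyContinuousOnInterval (iteratedDeriv (2 * n - 1) f) a b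

/-- The functions in the maximal domain of `ℓⁿ`. -/
structure IsJacobiMaxFun (α β : ℝ) (n : ℕ) (f : ℝ → ℂ) : Prop where
  regular : JacobiRegular n f
  memLp : MemLp f 2 (jacobiMeasure α β)
  memLp_pow : MemLp (jacobiPow α β n f) 2 (jacobiMeasure α β)

/-! ### The expression `ℓⁿ` is linear, almost everywhere, on regular functions -/

lemma jacobiMeasure_ac (α β : ℝ) :
    jacobiMeasure α β ≪ volume.restrict (Ioo (-1) 1) :=
  withDensity_absolutelyContinuous _ _

lemma jacobiWeight_pos (a b : ℝ) {x : ℝ} (hx : x ∈ Ioo (-1 : ℝ) 1) : 0 < jacobiWeight a b x :=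
  mul_pos (Real.rpow_pos_of_pos (by linarith [hx.2]) _)
    (Real.rpow_pos_of_pos (by linarith [hx.1]) _)

lemma jacobiWeight_contDiffAt (a b : ℝ) {x : ℝ} (hx : x ∈ Ioo (-1 : ℝ) 1) :
    ContDiffAt ℝ ∞ (jacobiWeight a b) x := by
  have h1 : (1 - x) ≠ 0 := by linarith [hx.2]
  have h2 : (1 + x) ≠ 0 := by linarith [hx.1]
  exact ((contDiffAt_const.sub contDiffAt_id).rpow_const_of_ne h1).mul
    ((contDiffAt_const.add contDiffAt_id).rpow_const_of_ne h2)

lemma jacobiMeasure_ac' (α β : ℝ) :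
    volume.restrict (Ioo (-1) 1) ≪ jacobiMeasure α β := by
  refine withDensity_absolutelyContinuous' ?_ ?_
  · refine (ContinuousOn.aemeasurable (fun x hx => ?_) measurableSet_Ioo).ennreal_ofReal
    exact (jacobiWeight_contDiffAt α β hx).continuousAt.continuousWithinAt
  · filter_upwards [ae_restrict_mem measurableSet_Ioo] with x hx
    simpa using jacobiWeight_pos α β hx

/-- `f` is `k` times differentiable near `x` and `f^(k)` is differentiable at `x`. -/
def DiffOrd (x : ℝ) : ℕ → (ℝ → ℂ) → Prop
  | 0, f => DifferentiableAt ℝ f x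
  | k + 1, f => (∀ᶠ y in 𝓝 x, DifferentiableAt ℝ f y) ∧ DiffOrd x k (deriv f)

lemma DiffOrd.congr {x : ℝ} : ∀ {k : ℕ} {f g : ℝ → ℂ}, DiffOrd x k f → f =ᶠ[𝓝 x] g →
    DiffOrd x k g
  | 0, _, _, hf, h => (h.differentiableAt_iff).1 hf
  | _ + 1, _, _, hf, h =>
    ⟨by
      filter_upwards [hf.1, h.eventuallyEq_nhds] with y hy hy'
      exact hy'.differentiableAt_iff.1 hy, DiffOrd.congr hf.2 h.deriv⟩

lemma DiffOrd.pred {x : ℝ} : ∀ {k : ℕ} {f : ℝ → ℂ}, DiffOrd x (k + 1) f → DiffOrd x k f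
  | 0, _, hf => hf.1.self_of_nhds
  | _ + 1, _, hf => ⟨hf.1, DiffOrd.pred hf.2⟩

lemma DiffOrd.differentiableAt {x : ℝ} : ∀ {k : ℕ} {f : ℝ → ℂ}, DiffOrd x k f →
    DifferentiableAt ℝ f x
  | 0, _, hf => hf
  | _ + 1, _, hf => hf.1.self_of_nhds

lemma DiffOrd.add {x : ℝ} : ∀ {k : ℕ} {f g : ℝ → ℂ}, DiffOrd x k f → DiffOrd x k g →
    DiffOrd x k (f + g)
  | 0, _, _, hf, hg => DifferentiableAt.add hf hg
  | _ + 1, f, g, hf, hg => by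
    refine ⟨by filter_upwards [hf.1, hg.1] with y h1 h2 using h1.add h2, ?_⟩
    refine (DiffOrd.add hf.2 hg.2).congr ?_
    filter_upwards [hf.1, hg.1] with y h1 h2
    exact (deriv_add h1 h2).symm

lemma DiffOrd.smul {x : ℝ} : ∀ {k : ℕ} {a : ℝ → ℝ} {f : ℝ → ℂ}, ContDiffAt ℝ ∞ a x →
    DiffOrd x k f → DiffOrd x k (fun y => a y • f y)
  | 0, _, _, ha, hf => (ha.differentiableAt (by simp)).smul hf
  | k + 1, a, f, ha, hf => by
    have had : ∀ᶠ y in 𝓝 x, DifferentiableAt ℝ a y := by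
      have := (ha.of_le (m := 1) (by simp)).eventually (by simp)
      filter_upwards [this] with y hy using hy.differentiableAt (by simp)
    refine ⟨by filter_upwards [hf.1, had] with y h1 h2 using h2.smul h1, ?_⟩
    have hd : ContDiffAt ℝ ∞ (deriv a) x := ha.derivWithin (by simp)
    refine ((DiffOrd.smul ha hf.2).add (DiffOrd.smul hd hf.pred)).congr ?_
    filter_upwards [hf.1, had] with y h1 h2
    exact (deriv_fun_smul h2 h1).symm

lemma DiffOrd.eventually {x : ℝ} : ∀ {k : ℕ} {f : ℝ → ℂ}, DiffOrd x (k + 1) f →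
    ∀ᶠ y in 𝓝 x, DiffOrd y k f
  | 0, _, hf => hf.1
  | _ + 1, _, hf => by
    filter_upwards [hf.1.eventually_nhds, hf.2.eventually] with y h1 h2 using ⟨h1, h2⟩

lemma diffOrd_of_contDiffOn {x : ℝ} (hx : x ∈ Ioo (-1 : ℝ) 1) : ∀ (m : ℕ) (f : ℝ → ℂ),
    ContDiffOn ℝ (m : ℕ∞) f (Ioo (-1) 1) → DifferentiableAt ℝ (iteratedDeriv m f) x →
    DiffOrd x m f
  | 0, f, _, h => by simpa [DiffOrd] using h
  | m + 1, f, hf, h => by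
    have hf' : ContDiffOn ℝ ((m : WithTop ℕ∞) + 1) f (Ioo (-1) 1) := by exact_mod_cast hf
    rw [contDiffOn_succ_iff_deriv_of_isOpen isOpen_Ioo] at hf'
    refine ⟨?_, diffOrd_of_contDiffOn hx m _ (by exact_mod_cast hf'.2.2)
      (by rwa [← iteratedDeriv_succ'])⟩
    filter_upwards [isOpen_Ioo.mem_nhds hx] with y hy
    exact hf'.1.differentiableAt (isOpen_Ioo.mem_nhds hy)

lemma JacobiRegular.ae_diffOrd {n : ℕ} {f : ℝ → ℂ} (hf : JacobiRegular n f) :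
    ∀ᵐ x ∂(volume.restrict (Ioo (-1 : ℝ) 1)), DiffOrd x (2 * n - 1) f := by
  have key : ∀ k : ℕ, ∀ᵐ x : ℝ, x ∈ uIcc (-1 + 1 / ((k : ℝ) + 2)) (1 - 1 / ((k : ℝ) + 2)) →
      DifferentiableAt ℝ (iteratedDeriv (2 * n - 1) f) x := by
    intro k
    have h1 : (0 : ℝ) < 1 / ((k : ℝ) + 2) := by positivity
    have h2 : 1 / ((k : ℝ) + 2) < 1 := by
      rw [div_lt_one (by positivity)]
      have : (0 : ℝ) ≤ k := by positivity
      linarith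
    exact (hf.2 _ ⟨by linarith, by linarith⟩ _ ⟨by linarith, by linarith⟩).boundedVariationOn
      |>.ae_differentiableAt_of_mem_uIcc
  rw [← ae_all_iff] at key
  filter_upwards [ae_restrict_of_ae key, ae_restrict_mem measurableSet_Ioo] with x hx hxI
  refine diffOrd_of_contDiffOn hxI _ _ hf.1 ?_
  obtain ⟨k, hk⟩ := exists_nat_one_div_lt
    (show (0 : ℝ) < min (1 - x) (1 + x) from lt_min (by linarith [hxI.2]) (by linarith [hxI.1]))
  have hk' : 1 / ((k : ℝ) + 2) ≤ 1 / ((k : ℝ) + 1) := by gcongr; norm_num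
  have h3 := hk.trans_le (min_le_left _ _)
  have h4 := hk.trans_le (min_le_right _ _)
  exact hx k (mem_uIcc.2 (Or.inl ⟨by linarith, by linarith⟩))

lemma jacobiExpr_congr {α β x : ℝ} {f g : ℝ → ℂ} (h : f =ᶠ[𝓝 x] g) :
    jacobiExpr α β f =ᶠ[𝓝 x] jacobiExpr α β g := by
  have h2 : (fun y => jacobiWeight (α + 1) (β + 1) y • deriv f y) =ᶠ[𝓝 x]
      fun y => jacobiWeight (α + 1) (β + 1) y • deriv g y := by
    filter_upwards [h.deriv] with y hy
    rw [hy]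
  filter_upwards [h2.deriv] with y hy
  simp only [jacobiExpr, hy]

lemma jacobiPow_congr {α β x : ℝ} : ∀ {n : ℕ} {f g : ℝ → ℂ}, f =ᶠ[𝓝 x] g →
    jacobiPow α β n f =ᶠ[𝓝 x] jacobiPow α β n g
  | 0, _, _, h => h
  | n + 1, _, _, h => jacobiPow_congr (n := n) (jacobiExpr_congr h)

lemma jacobiExpr_add {α β x : ℝ} (hx : x ∈ Ioo (-1 : ℝ) 1) {f g : ℝ → ℂ}
    (hf : DiffOrd x 1 f) (hg : DiffOrd x 1 g) :
    jacobiExpr α β (f + g) x = jacobiExpr α β f x + jacobiExpr α β g x := by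
  have h1 : (fun y => jacobiWeight (α + 1) (β + 1) y • deriv (f + g) y) =ᶠ[𝓝 x]
      (fun y => jacobiWeight (α + 1) (β + 1) y • deriv f y) +
        fun y => jacobiWeight (α + 1) (β + 1) y • deriv g y := by
    filter_upwards [hf.1, hg.1] with y h1 h2
    simp [deriv_add h1 h2]
  have hw := jacobiWeight_contDiffAt (α + 1) (β + 1) hx
  have h2 := DiffOrd.smul hw hf.2
  have h3 := DiffOrd.smul hw hg.2
  simp only [jacobiExpr]
  rw [h1.deriv_eq, deriv_add h2 h3]
  module

lemma DiffOrd.jacobiExpr {α β x : ℝ} (hx : x ∈ Ioo (-1 : ℝ) 1) {k : ℕ} {f : ℝ → ℂ}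
    (hf : DiffOrd x (k + 2) f) : DiffOrd x k (jacobiExpr α β f) := by
  have h1 := (DiffOrd.smul (jacobiWeight_contDiffAt (α + 1) (β + 1) hx) hf.2).2
  have hw : ContDiffAt ℝ ∞ (fun y => -(jacobiWeight α β y)⁻¹) x :=
    ((jacobiWeight_contDiffAt α β hx).inv (jacobiWeight_pos α β hx).ne').neg
  refine (DiffOrd.smul hw h1).congr (Eventually.of_forall fun y => ?_)
  simp [_root_.jacobiExpr]

lemma jacobiPow_add {α β x : ℝ} (hx : x ∈ Ioo (-1 : ℝ) 1) : ∀ {n : ℕ} {f g : ℝ → ℂ},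
    DiffOrd x (2 * n - 1) f → DiffOrd x (2 * n - 1) g →
    jacobiPow α β n (f + g) x = jacobiPow α β n f x + jacobiPow α β n g x
  | 0, _, _, _, _ => rfl
  | 1, _, _, hf, hg => jacobiExpr_add hx hf hg
  | n + 2, f, g, hf, hg => by
    have e : 2 * (n + 2) - 1 = (2 * (n + 1) - 1) + 2 := by omega
    rw [e] at hf hg
    have h1 : jacobiExpr α β (f + g) =ᶠ[𝓝 x] jacobiExpr α β f + jacobiExpr α β g := by
      have h2 : ∀ {h : ℝ → ℂ} {k : ℕ}, DiffOrd x (k + 2) h → ∀ᶠ y in 𝓝 x, DiffOrd y 1 h := by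
        intro h k
        induction k with
        | zero => exact fun h => h.eventually
        | succ k ih => exact fun h => ih h.pred
      filter_upwards [h2 hf, h2 hg, isOpen_Ioo.mem_nhds hx] with y h3 h4 hy
      exact jacobiExpr_add hy h3 h4
    have h5 := (jacobiPow_congr (α := α) (β := β) (n := n + 1) h1).self_of_nhds
    have h6 := jacobiPow_add (α := α) (β := β) (n := n + 1) hx (hf.jacobiExpr (α := α) (β := β) hx)
      (hg.jacobiExpr (α := α) (β := β) hx)
    exact h5.trans h6

lemma jacobiExpr_smul (α β : ℝ) (c : ℂ) (f : ℝ → ℂ) :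
    jacobiExpr α β (c • f) = c • jacobiExpr α β f := by
  have h1 : (fun y => jacobiWeight (α + 1) (β + 1) y • deriv (c • f) y) =
      c • fun y => jacobiWeight (α + 1) (β + 1) y • deriv f y := by
    ext y
    simp only [Pi.smul_apply]
    rw [deriv_const_smul_field, smul_comm c]
  ext x
  simp only [jacobiExpr, Pi.smul_apply]
  rw [h1, deriv_const_smul_field, smul_neg, smul_comm c]

lemma jacobiPow_smul (α β : ℝ) (c : ℂ) : ∀ (n : ℕ) (f : ℝ → ℂ),
    jacobiPow α β n (c • f) = c • jacobiPow α β n f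
  | 0, _ => rfl
  | n + 1, f => by
    have h := jacobiPow_smul α β c n (jacobiExpr α β f)
    rw [← jacobiExpr_smul] at h
    exact h

lemma absolutelyContinuousOnInterval_congr {f g : ℝ → ℂ} {a b : ℝ} (h : EqOn f g (uIcc a b))
    (hf : AbsolutelyContinuousOnInterval f a b) : AbsolutelyContinuousOnInterval g a b := by
  rw [absolutelyContinuousOnInterval_iff] at hf ⊢
  intro ε hε
  obtain ⟨δ, hδ, H⟩ := hf ε hε
  refine ⟨δ, hδ, fun E hE hs => ?_⟩
  convert H E hE hs using 2 with i hi
  rw [h (hE.1 i hi).1, h (hE.1 i hi).2]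

lemma uIcc_subset_Ioo_jacobi {a b : ℝ} (ha : a ∈ Ioo (-1 : ℝ) 1) (hb : b ∈ Ioo (-1 : ℝ) 1) :
    uIcc a b ⊆ Ioo (-1 : ℝ) 1 := ordConnected_Ioo.uIcc_subset ha hb

lemma JacobiRegular.add {n : ℕ} {f g : ℝ → ℂ} (hf : JacobiRegular n f) (hg : JacobiRegular n g) :
    JacobiRegular n (f + g) := by
  refine ⟨hf.1.add hg.1, fun a ha b hb => ?_⟩
  refine absolutelyContinuousOnInterval_congr ?_ ((hf.2 a ha b hb).add (hg.2 a ha b hb))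
  intro x hx
  have hx' := isOpen_Ioo.mem_nhds (uIcc_subset_Ioo_jacobi ha hb hx)
  exact (iteratedDeriv_add (by exact_mod_cast hf.1.contDiffAt hx')
    (by exact_mod_cast hg.1.contDiffAt hx')).symm

lemma JacobiRegular.smul {n : ℕ} {f : ℝ → ℂ} (c : ℂ) (hf : JacobiRegular n f) :
    JacobiRegular n (c • f) := by
  refine ⟨contDiffOn_const.smul hf.1, fun a ha b hb => ?_⟩
  refine absolutelyContinuousOnInterval_congr ?_ ((hf.2 a ha b hb).const_smul c)
  intro x _
  exact (iteratedDeriv_const_smul_field c f).symm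

lemma jacobiPow_add_ae {α β : ℝ} {n : ℕ} {f g : ℝ → ℂ} (hf : JacobiRegular n f)
    (hg : JacobiRegular n g) :
    jacobiPow α β n (f + g) =ᵐ[jacobiMeasure α β] jacobiPow α β n f + jacobiPow α β n g := by
  refine (jacobiMeasure_ac α β).ae_le ?_
  filter_upwards [hf.ae_diffOrd, hg.ae_diffOrd, ae_restrict_mem measurableSet_Ioo] with x h1 h2 hx
  exact jacobiPow_add hx h1 h2

lemma jacobiPow_ae_congr {α β : ℝ} {n : ℕ} {f g : ℝ → ℂ} (hf : JacobiRegular n f)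
    (hg : JacobiRegular n g) (h : f =ᵐ[jacobiMeasure α β] g) :
    jacobiPow α β n f =ᵐ[jacobiMeasure α β] jacobiPow α β n g := by
  have h1 : EqOn f g (Ioo (-1) 1) :=
    Measure.eqOn_open_of_ae_eq ((jacobiMeasure_ac' α β).ae_le h) isOpen_Ioo
      hf.1.continuousOn hg.1.continuousOn
  refine (jacobiMeasure_ac α β).ae_le ?_
  filter_upwards [ae_restrict_mem measurableSet_Ioo] with x hx
  exact (jacobiPow_congr (h1.eventuallyEq_of_mem (isOpen_Ioo.mem_nhds hx))).self_of_nhds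

/-! ### Maximal and minimal operators -/

/-- The graph of the maximal operator: all pairs `(f, ℓⁿ[f])` with `f` in the maximal domain. -/
def jacobiMaxGraph (α β : ℝ) (n : ℕ) : Submodule ℂ (JacobiL2 α β × JacobiL2 α β) where
  carrier := {P | ∃ f : ℝ → ℂ, JacobiRegular n f ∧ P.1 =ᵐ[jacobiMeasure α β] f ∧
    P.2 =ᵐ[jacobiMeasure α β] jacobiPow α β n f}
  add_mem' := by
    rintro P Q ⟨f, hf, hf1, hf2⟩ ⟨g, hg, hg1, hg2⟩
    refine ⟨f + g, hf.add hg, (Lp.coeFn_add _ _).trans (hf1.add hg1), ?_⟩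
    exact ((Lp.coeFn_add _ _).trans (hf2.add hg2)).trans (jacobiPow_add_ae hf hg).symm
  zero_mem' := by
    have h0 : JacobiRegular n (0 : ℝ → ℂ) := by
      refine ⟨contDiffOn_const, fun a _ b _ => ?_⟩
      have : iteratedDeriv (2 * n - 1) (0 : ℝ → ℂ) = fun _ => 0 := by
        ext x
        simp
      rw [this]
      exact (contDiff_const (n := 1)).contDiffOn.absolutelyContinuousOnInterval
    refine ⟨0, h0, Lp.coeFn_zero _ _ _, ?_⟩
    have := jacobiPow_smul α β 0 n 0
    rw [zero_smul, zero_smul] at this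
    rw [this]
    exact Lp.coeFn_zero _ _ _
  smul_mem' := by
    rintro c P ⟨f, hf, hf1, hf2⟩
    refine ⟨c • f, hf.smul c, (Lp.coeFn_smul _ _).trans (hf1.const_smul c), ?_⟩
    rw [jacobiPow_smul]
    exact (Lp.coeFn_smul _ _).trans (hf2.const_smul c)

/-- The maximal operator `L_max = {ℓⁿ, D_max}` in `L²[(-1, 1), (1 - x)^α (1 + x)^β]`. -/
def jacobiMax (α β : ℝ) (n : ℕ) : JacobiL2 α β →ₗ.[ℂ] JacobiL2 α β :=
  (jacobiMaxGraph α β n).toLinearPMap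

lemma jacobiMax_graph (α β : ℝ) (n : ℕ) : (jacobiMax α β n).graph = jacobiMaxGraph α β n := by
  refine Submodule.toLinearPMap_graph_eq _ ?_
  rintro P ⟨f, hf, hf1, hf2⟩ hP
  obtain ⟨z, hz, hz1, hz2⟩ := (jacobiMaxGraph α β n).zero_mem
  have h1 : f =ᵐ[jacobiMeasure α β] z := by
    rw [hP] at hf1
    exact hf1.symm.trans hz1
  exact Lp.ext ((hf2.trans (jacobiPow_ae_congr hf hz h1)).trans hz2.symm)

/-- The element of `L²` given by a function in the maximal domain. -/
def IsJacobiMaxFun.toL2 {α β : ℝ} {n : ℕ} {f : ℝ → ℂ} (h : IsJacobiMaxFun α β n f) :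
    JacobiL2 α β := h.memLp.toLp f

lemma IsJacobiMaxFun.mem_graph {α β : ℝ} {n : ℕ} {f : ℝ → ℂ} (h : IsJacobiMaxFun α β n f) :
    (h.toL2, h.memLp_pow.toLp _) ∈ (jacobiMax α β n).graph := by
  rw [jacobiMax_graph]
  exact ⟨f, h.regular, h.memLp.coeFn_toLp, h.memLp_pow.coeFn_toLp⟩

lemma mem_jacobiMax_domain {α β : ℝ} {n : ℕ} {F : JacobiL2 α β} :
    F ∈ (jacobiMax α β n).domain ↔ ∃ (f : ℝ → ℂ) (h : IsJacobiMaxFun α β n f), h.toL2 = F := by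
  constructor
  · intro hF
    have hg := (jacobiMax α β n).mem_graph ⟨F, hF⟩
    rw [jacobiMax_graph] at hg
    obtain ⟨f, hf, hf1, hf2⟩ := hg
    have h : IsJacobiMaxFun α β n f := ⟨hf, (memLp_congr_ae hf1).1 (Lp.memLp _),
      (memLp_congr_ae hf2).1 (Lp.memLp _)⟩
    exact ⟨f, h, Lp.ext (h.memLp.coeFn_toLp.trans hf1.symm)⟩
  · rintro ⟨f, h, rfl⟩
    exact LinearPMap.mem_domain_of_mem_graph h.mem_graph

/-- The sesquilinear form `[F, G]` between the two endpoints given by Green's formula,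
`[F, G] = ∫ (ℓⁿ[F] * conj G - F * conj (ℓⁿ[G])) (1 - x)^α (1 + x)^β dx`
(Mathlib's inner product is conjugate linear in the first variable). -/
def jacobiGreen (α β : ℝ) (n : ℕ) (F G : (jacobiMax α β n).domain) : ℂ :=
  inner ℂ (G : JacobiL2 α β) (jacobiMax α β n F) - inner ℂ (jacobiMax α β n G) (F : JacobiL2 α β)

lemma jacobiGreen_eq_integral (α β : ℝ) (n : ℕ) (F G : (jacobiMax α β n).domain) :
    jacobiGreen α β n F G = ∫ x, (jacobiMax α β n F x * star ((G : JacobiL2 α β) x) -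
      (F : JacobiL2 α β) x * star (jacobiMax α β n G x)) ∂(jacobiMeasure α β) := by
  simp only [jacobiGreen, L2.inner_def]
  rw [← integral_sub (L2.integrable_inner _ _) (L2.integrable_inner _ _)]
  rfl

/-- The minimal domain: all `F` in the maximal domain with `[F, G] = 0` for every `G` in the
maximal domain. -/
def jacobiMinDomain (α β : ℝ) (n : ℕ) : Submodule ℂ (JacobiL2 α β) where
  carrier := {F | ∃ hF : F ∈ (jacobiMax α β n).domain,
    ∀ G : (jacobiMax α β n).domain, jacobiGreen α β n ⟨F, hF⟩ G = 0}
  add_mem' := by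
    rintro F F' ⟨hF, h⟩ ⟨hF', h'⟩
    refine ⟨add_mem hF hF', fun G => ?_⟩
    have e : (⟨F + F', add_mem hF hF'⟩ : (jacobiMax α β n).domain) = ⟨F, hF⟩ + ⟨F', hF'⟩ := rfl
    have h1 := h G
    have h2 := h' G
    simp only [jacobiGreen] at h1 h2 ⊢
    rw [e, LinearPMap.map_add, inner_add_right, inner_add_right]
    linear_combination h1 + h2
  zero_mem' := by
    refine ⟨zero_mem _, fun G => ?_⟩
    have e : (⟨0, zero_mem _⟩ : (jacobiMax α β n).domain) = 0 := rfl
    simp only [jacobiGreen]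
    rw [e, LinearPMap.map_zero]
    simp
  smul_mem' := by
    rintro c F ⟨hF, h⟩
    refine ⟨Submodule.smul_mem _ c hF, fun G => ?_⟩
    have e : (⟨c • F, Submodule.smul_mem _ c hF⟩ : (jacobiMax α β n).domain) = c • ⟨F, hF⟩ := rfl
    have h1 := h G
    simp only [jacobiGreen] at h1 ⊢
    rw [e, LinearPMap.map_smul, inner_smul_right, inner_smul_right]
    linear_combination c * h1

/-- The minimal operator `L_min = {ℓⁿ, D_min}`. -/
def jacobiMin (α β : ℝ) (n : ℕ) : JacobiL2 α β →ₗ.[ℂ] JacobiL2 α β :=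
  (jacobiMax α β n).domRestrict (jacobiMinDomain α β n)

lemma jacobiMin_domain (α β : ℝ) (n : ℕ) :
    (jacobiMin α β n).domain = jacobiMinDomain α β n :=
  inf_eq_left.2 fun _ hF => hF.1

/-! ### Defect spaces and the extension belonging to a map between them -/

section Abstract

variable {H : Type*} [NormedAddCommGroup H] [InnerProductSpace ℂ H] [CompleteSpace H]

/-- The defect space `{f ∈ D(A*) : A* f = z f}`; the positive and the negative defect space are
the cases `z = i` and `z = -i`. -/
def defectSpace (A : H →ₗ.[ℂ] H) (z : ℂ) : Submodule ℂ H :=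
  A.adjoint.graph.comap (LinearMap.prod LinearMap.id (z • LinearMap.id))

lemma mem_defectSpace (A : H →ₗ.[ℂ] H) (z : ℂ) (f : H) :
    f ∈ defectSpace A z ↔ ∃ hf : f ∈ A.adjoint.domain, A.adjoint ⟨f, hf⟩ = z • f := by
  simp only [defectSpace, Submodule.mem_comap, LinearPMap.mem_graph_iff]
  constructor
  · rintro ⟨y, h1, h2⟩
    have h1' : (y : H) = f := h1
    subst h1'
    exact ⟨y.2, h2⟩
  · rintro ⟨hf, h⟩
    exact ⟨⟨f, hf⟩, rfl, h⟩

/-- The domain `{y + g + V g : y ∈ D, g ∈ N₊}` belonging to a linear map `V : N₊ → N₋`. -/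
def naimarkDomain (D Np Nm : Submodule ℂ H) (V : Np →ₗ[ℂ] Nm) : Submodule ℂ H :=
  D ⊔ LinearMap.range (Np.subtype + Nm.subtype ∘ₗ V)

end Abstract

/-- The extension `{ℓⁿ, {y + g + V g : y ∈ D_min, g ∈ D₊}}` of the minimal operator belonging to a
linear map `V` from the positive to the negative defect space. -/
def jacobiExtension (α β : ℝ) (n : ℕ)
    (V : defectSpace (jacobiMin α β n) Complex.I →ₗ[ℂ]
      defectSpace (jacobiMin α β n) (-Complex.I)) : JacobiL2 α β →ₗ.[ℂ] JacobiL2 α β :=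
  (jacobiMax α β n).domRestrict (naimarkDomain (jacobiMin α β n).domain _ _ V)

/-! ### Functions with prescribed behavior at one endpoint -/

/-- `f` is smooth on `(-1, 1)`, equals `b (1 - x)` for `x` near `1` and vanishes near `-1`. -/
structure IsRightEndpointFun (b : ℝ → ℝ) (f : ℝ → ℂ) : Prop where
  smooth : ContDiffOn ℝ ∞ f (Ioo (-1) 1)
  near_right : ∀ᶠ x in 𝓝[<] (1 : ℝ), f x = b (1 - x)
  near_left : ∀ᶠ x in 𝓝[>] (-1 : ℝ), f x = 0

/-- `f` is smooth on `(-1, 1)`, equals `b (1 + x)` for `x` near `-1` and vanishes near `1`. -/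
structure IsLeftEndpointFun (b : ℝ → ℝ) (f : ℝ → ℂ) : Prop where
  smooth : ContDiffOn ℝ ∞ f (Ioo (-1) 1)
  near_right : ∀ᶠ x in 𝓝[<] (1 : ℝ), f x = 0
  near_left : ∀ᶠ x in 𝓝[>] (-1 : ℝ), f x = b (1 + x)

/-- The first kind of behavior, `t^j`, where `t` is the distance to the endpoint. -/
def firstKind (j : ℕ) (t : ℝ) : ℝ := t ^ j

/-- The second kind of behavior at an endpoint with parameter `a`: `t^(-a + j)`, and for `a = 0`,
where this would be the first kind again, `t^j log t`. -/
def secondKind (a : ℝ) (j : ℕ) (t : ℝ) : ℝ :=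
  if a = 0 then t ^ j * Real.log t else t ^ (-a + j)

end

noncomputable section

/-! ### Operators whose graph is that of a bounded self-adjoint inverse modulo finite dimensions -/

section Abstract

variable {H : Type*} [NormedAddCommGroup H] [InnerProductSpace ℂ H]

/-- `D` consists of the elements of the domain of `S` on which the Green form of `S` vanishes. -/
def IsGreenKernel (S : H →ₗ.[ℂ] H) (D : Submodule ℂ H) : Prop :=
  ∀ F : H, F ∈ D ↔ ∃ hF : F ∈ S.domain, ∀ G : S.domain,
    inner ℂ (G : H) (S ⟨F, hF⟩) - inner ℂ (S G) F = 0

/-- The graph of `S` is `{(T h + z, h) : h ∈ H, z ∈ Z}`. -/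
def HasResolventGraph (S : H →ₗ.[ℂ] H) (T : H →L[ℂ] H) (Z : Submodule ℂ H) : Prop :=
  ∀ f h : H, (f, h) ∈ S.graph ↔ f - T h ∈ Z

lemma LinearPMap.exists_apply_eq_of_mem_graph {S : H →ₗ.[ℂ] H} {f h : H} (hf : (f, h) ∈ S.graph) :
    ∃ hd : f ∈ S.domain, S ⟨f, hd⟩ = h := by
  obtain ⟨y, h1, h2⟩ := (LinearPMap.mem_graph_iff S).1 hf
  have h1' : (y : H) = f := h1
  subst h1'
  exact ⟨y.2, h2⟩

lemma LinearPMap.mk_mem_graph (S : H →ₗ.[ℂ] H) {f : H} (hf : f ∈ S.domain) :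
    (f, S ⟨f, hf⟩) ∈ S.graph := S.mem_graph ⟨f, hf⟩

variable {S : H →ₗ.[ℂ] H} {T : H →L[ℂ] H} {Z D : Submodule ℂ H}

namespace HasResolventGraph

lemma apply_mem (hS : HasResolventGraph S T Z) (h : H) : (T h, h) ∈ S.graph :=
  (hS _ _).2 (by simp)

lemma kernel_le_domain (hD : IsGreenKernel S D) : D ≤ S.domain :=
  fun _ hF => ((hD _).1 hF).1

lemma domRestrict_domain_eq (hD : IsGreenKernel S D) : (S.domRestrict D).domain = D :=
  inf_eq_left.2 (kernel_le_domain hD)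

lemma mem_kernel_iff (hS : HasResolventGraph S T Z) (hT : T.IsSymmetric)
    (hD : IsGreenKernel S D) (F : H) : F ∈ D ↔ ∃ g ∈ Zᗮ, T g = F := by
  rw [hD F]
  constructor
  · rintro ⟨hF, hG⟩
    have hgr := LinearPMap.mk_mem_graph S hF
    set h := S ⟨F, hF⟩ with hh
    have key : ∀ x y : H, (x, y) ∈ S.graph → inner ℂ x h = inner ℂ y F := by
      intro x y hxy
      obtain ⟨hx, rfl⟩ := LinearPMap.exists_apply_eq_of_mem_graph hxy
      exact sub_eq_zero.1 (hG ⟨x, hx⟩)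
    refine ⟨h, ?_, ?_⟩
    · rw [Submodule.mem_orthogonal]
      intro z hz
      have := key z 0 ((hS _ _).2 (by simpa using hz))
      simpa using this
    · refine ext_inner_left ℂ fun y => ?_
      rw [← key (T y) y (hS.apply_mem y)]
      exact (hT y h).symm
  · rintro ⟨g, hg, rfl⟩
    obtain ⟨hF, hFg⟩ := LinearPMap.exists_apply_eq_of_mem_graph (hS.apply_mem g)
    refine ⟨hF, fun G => ?_⟩
    rw [hFg]
    have h1 := (hS _ _).1 (S.mem_graph G)
    have h2 := (Submodule.mem_orthogonal _ _).1 hg _ h1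
    have h3 : inner ℂ (T (S G)) g = inner ℂ (S G) (T g) := hT _ _
    rw [inner_sub_left, h3] at h2
    exact h2

lemma mem_domRestrict_graph (hS : HasResolventGraph S T Z) (hT : T.IsSymmetric)
    (hD : IsGreenKernel S D) (g : H) (hg : g ∈ Zᗮ) : (T g, g) ∈ (S.domRestrict D).graph := by
  obtain ⟨h1, h2⟩ := LinearPMap.exists_apply_eq_of_mem_graph (hS.apply_mem g)
  have h3 : T g ∈ (S.domRestrict D).domain := ⟨(hS.mem_kernel_iff hT hD _).2 ⟨g, hg, rfl⟩, h1⟩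
  have h4 := LinearPMap.mk_mem_graph _ h3
  have h5 : S.domRestrict D ⟨T g, h3⟩ = S ⟨T g, h1⟩ := LinearPMap.domRestrict_apply rfl
  rwa [h5, h2] at h4

lemma domain_le (hS : HasResolventGraph S T Z) (hT : T.IsSymmetric) [FiniteDimensional ℂ Z]
    (hD : IsGreenKernel S D) : S.domain ≤ D ⊔ (Z ⊔ Z.map (T : H →ₗ[ℂ] H)) := by
  intro f hf
  have h1 := (hS _ _).1 (LinearPMap.mk_mem_graph S hf)
  set h := S ⟨f, hf⟩
  obtain ⟨z, hz, g, hg, hzg⟩ := Z.exists_add_mem_mem_orthogonal h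
  have h2 : f = T g + ((f - T h) + T z) := by
    rw [hzg, map_add]
    abel
  rw [h2]
  refine Submodule.add_mem_sup ((hS.mem_kernel_iff hT hD _).2 ⟨g, hg, rfl⟩) ?_
  exact Submodule.add_mem_sup h1 (Submodule.mem_map_of_mem hz)

variable [CompleteSpace H]

lemma dense_kernel (hS : HasResolventGraph S T Z) (hT : T.IsSymmetric) [FiniteDimensional ℂ Z]
    (hD : IsGreenKernel S D) : Dense (D : Set H) := by
  rw [Submodule.dense_iff_topologicalClosure_eq_top,
    Submodule.topologicalClosure_eq_top_iff, Submodule.eq_bot_iff]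
  intro y hy
  have h1 : T y ∈ Z := by
    rw [← Submodule.orthogonal_orthogonal Z, Submodule.mem_orthogonal]
    intro g hg
    have := (Submodule.mem_orthogonal _ _).1 hy (T g) ((hS.mem_kernel_iff hT hD _).2 ⟨g, hg, rfl⟩)
    rw [← this]
    exact (hT g y).symm
  have h2 : (T y, 0) ∈ S.graph := (hS _ _).2 (by simpa using h1)
  obtain ⟨h3, h4⟩ := LinearPMap.exists_apply_eq_of_mem_graph h2
  obtain ⟨h5, h6⟩ := LinearPMap.exists_apply_eq_of_mem_graph (hS.apply_mem y)
  rw [← h6, h4]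

lemma adjoint_eq (hS : HasResolventGraph S T Z) (hT : T.IsSymmetric) [FiniteDimensional ℂ Z]
    (hD : IsGreenKernel S D) : (S.domRestrict D).adjoint = S := by
  have hdense : Dense ((S.domRestrict D).domain : Set H) := by
    rw [domRestrict_domain_eq hD]
    exact hS.dense_kernel hT hD
  refine LinearPMap.eq_of_eq_graph ?_
  rw [LinearPMap.adjoint_graph_eq_graph_adjoint hdense]
  ext ⟨f, h⟩
  rw [Submodule.mem_adjoint_iff, hS, ← Submodule.orthogonal_orthogonal Z, Submodule.mem_orthogonal]
  constructor
  · intro H1 g hg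
    have := H1 _ _ (hS.mem_domRestrict_graph hT hD g hg)
    rw [inner_sub_right, ← this]
    congr 1
    exact (hT g h).symm
  · intro H1 a b hab
    obtain ⟨h1, h2⟩ := LinearPMap.exists_apply_eq_of_mem_graph hab
    obtain ⟨g, hg, rfl⟩ := (hS.mem_kernel_iff hT hD _).1 h1.1
    have h3 := LinearPMap.mem_graph_snd_inj _ hab (hS.mem_domRestrict_graph hT hD g hg) rfl
    change b = g at h3
    subst h3
    have h4 := H1 b hg
    rw [inner_sub_right] at h4
    rw [← h4]
    congr 1
    exact hT b h

lemma mem_defect_iff (hS : HasResolventGraph S T Z) (hT : T.IsSymmetric) [FiniteDimensional ℂ Z]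
    (hD : IsGreenKernel S D) (z : ℂ) (f : H) :
    f ∈ defectSpace (S.domRestrict D) z ↔ (f, z • f) ∈ S.graph := by
  rw [defectSpace, hS.adjoint_eq hT hD]
  rfl

lemma isUnit_one_sub_smul (hT : T.IsSymmetric) {z : ℂ} (hz : z.im ≠ 0) : IsUnit (1 - z • T) := by
  have hz0 : z ≠ 0 := by rintro rfl; simp at hz
  have hsa : IsSelfAdjoint T := ContinuousLinearMap.isSelfAdjoint_iff_isSymmetric.2 hT
  have h1 : z⁻¹ ∉ spectrum ℂ T := by
    intro h
    have h2 := hsa.im_eq_zero_of_mem_spectrum h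
    rw [Complex.inv_im, div_eq_zero_iff] at h2
    rcases h2 with h2 | h2
    · exact hz (by linarith)
    · exact hz0 (Complex.normSq_eq_zero.1 h2)
  rw [spectrum.notMem_iff] at h1
  have h3 : (1 : H →L[ℂ] H) - z • T = Units.mk0 z hz0 • (algebraMap ℂ (H →L[ℂ] H) z⁻¹ - T) := by
    rw [Units.smul_def, Units.val_mk0, smul_sub, Algebra.algebraMap_eq_smul_one, smul_smul,
      mul_inv_cancel₀ hz0, one_smul]
  rw [h3]
  exact h1.smul _

lemma finrank_defect (hS : HasResolventGraph S T Z) (hT : T.IsSymmetric) [FiniteDimensional ℂ Z]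
    (hD : IsGreenKernel S D) {z : ℂ} (hz : z.im ≠ 0) :
    FiniteDimensional ℂ (defectSpace (S.domRestrict D) z) ∧
      Module.finrank ℂ (defectSpace (S.domRestrict D) z) = Module.finrank ℂ Z := by
  obtain ⟨u, hu⟩ := isUnit_one_sub_smul hT hz
  let e : H ≃L[ℂ] H := ContinuousLinearEquiv.ofUnit u
  have he : ∀ x, e x = x - z • T x := by
    intro x
    have : e x = (u : H →L[ℂ] H) x := rfl
    rw [this, hu]
    simp
  have h1 : defectSpace (S.domRestrict D) z = Z.map e.symm.toLinearEquiv.toLinearMap := by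
    ext f
    rw [hS.mem_defect_iff hT hD, hS, Submodule.mem_map]
    constructor
    · intro h
      refine ⟨e f, ?_, by simp⟩
      rw [he]
      simpa using h
    · rintro ⟨y, hy, rfl⟩
      have : e (e.symm y) = y := by simp
      rw [he] at this
      simpa [this] using hy
  rw [h1]
  exact ⟨inferInstance, LinearEquiv.finrank_map_eq e.symm.toLinearEquiv Z⟩

end HasResolventGraph

end Abstract

/-! ### Extensions of the minimal operator and maps between the defect spaces -/

section Abstract

variable {H : Type*} [NormedAddCommGroup H] [InnerProductSpace ℂ H]

/-- The Green form on pairs `(f, S f)`. -/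
def pairForm (P Q : H × H) : ℂ := inner ℂ Q.1 P.2 - inner ℂ Q.2 P.1

lemma pairForm_add_left (P P' Q : H × H) :
    pairForm (P + P') Q = pairForm P Q + pairForm P' Q := by
  simp only [pairForm, Prod.fst_add, Prod.snd_add, inner_add_right]
  ring

lemma pairForm_add_right (P Q Q' : H × H) :
    pairForm P (Q + Q') = pairForm P Q + pairForm P Q' := by
  simp only [pairForm, Prod.fst_add, Prod.snd_add, inner_add_left]
  ring

lemma pairForm_swap (P Q : H × H) : pairForm Q P = -(starRingEnd ℂ) (pairForm P Q) := by
  simp only [pairForm, map_sub, inner_conj_symm]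
  ring

lemma pairForm_defect (g h g' h' : H) :
    pairForm ((g, Complex.I • g) + (h, -Complex.I • h))
      ((g', Complex.I • g') + (h', -Complex.I • h')) =
      2 * Complex.I * (inner ℂ g' g - inner ℂ h' h) := by
  simp only [pairForm, Prod.fst_add, Prod.snd_add, inner_add_left, inner_add_right,
    inner_smul_left, inner_smul_right, map_neg, Complex.conj_I]
  ring

variable {S : H →ₗ.[ℂ] H} {T : H →L[ℂ] H} {Z D N Np Nm : Submodule ℂ H}

namespace IsGreenKernel

lemma exists_mem_graph (hD : IsGreenKernel S D) {a : H} (ha : a ∈ D) : ∃ b, (a, b) ∈ S.graph ∧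
    ∀ P ∈ S.graph, pairForm (a, b) P = 0 ∧ pairForm P (a, b) = 0 := by
  obtain ⟨h1, h2⟩ := (hD a).1 ha
  refine ⟨_, LinearPMap.mk_mem_graph S h1, ?_⟩
  rintro ⟨x, y⟩ hxy
  obtain ⟨hx, rfl⟩ := LinearPMap.exists_apply_eq_of_mem_graph hxy
  have h3 : pairForm (a, S ⟨a, h1⟩) (x, S ⟨x, hx⟩) = 0 := h2 ⟨x, hx⟩
  exact ⟨h3, by rw [pairForm_swap, h3]; simp⟩

/-- The Green form of two elements of `D + N₊ + N₋`. -/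
lemma pairForm_eq (hD : IsGreenKernel S D) (hNp : ∀ f ∈ Np, (f, Complex.I • f) ∈ S.graph)
    (hNm : ∀ f ∈ Nm, (f, -Complex.I • f) ∈ S.graph) {a g h y a' g' h' y' : H}
    (ha : a ∈ D) (hg : g ∈ Np) (hh : h ∈ Nm) (hy : (a + (g + h), y) ∈ S.graph)
    (ha' : a' ∈ D) (hg' : g' ∈ Np) (hh' : h' ∈ Nm) (hy' : (a' + (g' + h'), y') ∈ S.graph) :
    pairForm (a + (g + h), y) (a' + (g' + h'), y') =
      2 * Complex.I * (inner ℂ g' g - inner ℂ h' h) := by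
  obtain ⟨b, hb, hb0⟩ := hD.exists_mem_graph ha
  obtain ⟨b', hb', hb0'⟩ := hD.exists_mem_graph ha'
  have m := S.graph.add_mem (hNp g hg) (hNm h hh)
  have m' := S.graph.add_mem (hNp g' hg') (hNm h' hh')
  have e : (a + (g + h), y) = (a, b) + ((g, Complex.I • g) + (h, -Complex.I • h)) :=
    Prod.ext rfl (LinearPMap.mem_graph_snd_inj _ hy (S.graph.add_mem hb m) rfl)
  have e' : (a' + (g' + h'), y') = (a', b') + ((g', Complex.I • g') + (h', -Complex.I • h')) :=
    Prod.ext rfl (LinearPMap.mem_graph_snd_inj _ hy' (S.graph.add_mem hb' m') rfl)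
  rw [e, e', pairForm_add_left, (hb0 _ (S.graph.add_mem hb' m')).1, pairForm_add_right _ (a', b'),
    (hb0' _ m).2, pairForm_defect]
  ring

lemma eq_zero_of_add_mem (hD : IsGreenKernel S D) (hNp : ∀ f ∈ Np, (f, Complex.I • f) ∈ S.graph)
    (hNm : ∀ f ∈ Nm, (f, -Complex.I • f) ∈ S.graph) {g h : H} (hg : g ∈ Np) (hh : h ∈ Nm)
    (hgh : g + h ∈ D) : g = 0 ∧ h = 0 := by
  obtain ⟨b, hb, hb0⟩ := hD.exists_mem_graph hgh
  have hb' : (0 + (g + h), b) ∈ S.graph := by rwa [zero_add]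
  have mg : (0 + (g + 0), Complex.I • g) ∈ S.graph := by simpa using hNp g hg
  have mh : (0 + (0 + h), -Complex.I • h) ∈ S.graph := by simpa using hNm h hh
  have h1 := hD.pairForm_eq hNp hNm D.zero_mem hg hh hb' D.zero_mem hg Nm.zero_mem mg
  have h2 := hD.pairForm_eq hNp hNm D.zero_mem hg hh hb' D.zero_mem Np.zero_mem hh mh
  rw [zero_add (g + h), (hb0 _ mg).1] at h1
  rw [zero_add (g + h), (hb0 _ mh).1] at h2
  simpa using And.intro h1.symm h2.symm

end IsGreenKernel

lemma mem_naimarkDomain {V : Np →ₗ[ℂ] Nm} {x : H} :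
    x ∈ naimarkDomain D Np Nm V ↔ ∃ a ∈ D, ∃ g : Np, a + (g + V g) = x := by
  simp only [naimarkDomain, Submodule.mem_sup, LinearMap.mem_range, LinearMap.add_apply,
    LinearMap.comp_apply, Submodule.subtype_apply]
  constructor
  · rintro ⟨a, ha, _, ⟨g, rfl⟩, rfl⟩
    exact ⟨a, ha, g, rfl⟩
  · rintro ⟨a, ha, g, rfl⟩
    exact ⟨a, ha, _, ⟨g, rfl⟩, rfl⟩

namespace IsGreenKernel

lemma naimarkDomain_injective (hD : IsGreenKernel S D)
    (hNp : ∀ f ∈ Np, (f, Complex.I • f) ∈ S.graph)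
    (hNm : ∀ f ∈ Nm, (f, -Complex.I • f) ∈ S.graph) :
    Function.Injective (naimarkDomain D Np Nm) := by
  intro V W hVW
  ext g
  have h1 : (0 : H) + (g + V g) ∈ naimarkDomain D Np Nm W := by
    rw [← hVW, mem_naimarkDomain]
    exact ⟨0, D.zero_mem, g, rfl⟩
  obtain ⟨a, ha, g', h2⟩ := mem_naimarkDomain.1 h1
  have h3 : ((g - g' : Np) : H) + ((V g - W g' : Nm) : H) ∈ D := by
    have : ((g - g' : Np) : H) + ((V g - W g' : Nm) : H) = a := by
      rw [← eq_sub_iff_add_eq, zero_add] at h2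
      rw [h2]
      push_cast
      abel
    rwa [this]
  obtain ⟨h4, h5⟩ := hD.eq_zero_of_add_mem hNp hNm (g - g').2 (V g - W g').2 h3
  have h6 : g = g' := sub_eq_zero.1 (Subtype.ext h4)
  rw [← h6] at h5
  exact sub_eq_zero.1 (by simpa using h5)

lemma naimarkDomain_le (hD : IsGreenKernel S D) (hNp : ∀ f ∈ Np, (f, Complex.I • f) ∈ S.graph)
    (hNm : ∀ f ∈ Nm, (f, -Complex.I • f) ∈ S.graph) (V : Np →ₗ[ℂ] Nm) :
    naimarkDomain D Np Nm V ≤ S.domain := by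
  intro x hx
  obtain ⟨a, ha, g, rfl⟩ := mem_naimarkDomain.1 hx
  exact add_mem (HasResolventGraph.kernel_le_domain hD ha)
    (add_mem (LinearPMap.mem_domain_of_mem_graph (hNp _ g.2))
      (LinearPMap.mem_domain_of_mem_graph (hNm _ (V g).2)))

end IsGreenKernel

/-- `N` is its own orthogonal complement with respect to the Green form. -/
def IsGreenLagrangian (S : H →ₗ.[ℂ] H) (N : Submodule ℂ H) : Prop :=
  ∀ f y, (f, y) ∈ S.graph → (f ∈ N ↔ ∀ P ∈ S.graph, P.1 ∈ N → pairForm P (f, y) = 0)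

lemma isGreenLagrangian_naimarkDomain (hD : IsGreenKernel S D)
    (hNp : ∀ f ∈ Np, (f, Complex.I • f) ∈ S.graph)
    (hNm : ∀ f ∈ Nm, (f, -Complex.I • f) ∈ S.graph)
    (hsup : D ⊔ (Np ⊔ Nm) = S.domain) (V : Np →ₗ[ℂ] Nm)
    (hV : ∀ g g', inner ℂ (V g) (V g') = inner ℂ g g') (hV' : Function.Surjective V) :
    IsGreenLagrangian S (naimarkDomain D Np Nm V) := by
  intro f y hfy
  constructor
  · intro hf
    obtain ⟨a, ha, g, rfl⟩ := mem_naimarkDomain.1 hf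
    rintro ⟨x, z⟩ hxz hx
    obtain ⟨a', ha', g', rfl⟩ := mem_naimarkDomain.1 hx
    rw [hD.pairForm_eq hNp hNm ha' g'.2 (V g').2 hxz ha g.2 (V g).2 hfy]
    have := hV g g'
    rw [Submodule.coe_inner, Submodule.coe_inner] at this
    rw [this]
    simp
  · intro hf
    have hfd := LinearPMap.mem_domain_of_mem_graph hfy
    rw [← hsup] at hfd
    obtain ⟨a, ha, x, hx, rfl⟩ := Submodule.mem_sup.1 hfd
    obtain ⟨g, hg, h, hh, rfl⟩ := Submodule.mem_sup.1 hx
    obtain ⟨k, hk⟩ := hV' ⟨h, hh⟩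
    refine mem_naimarkDomain.2 ⟨a, ha, k, ?_⟩
    have h1 : ∀ g' : Np, inner ℂ g (g' : H) - inner ℂ (k : H) (g' : H) = 0 := by
      intro g'
      have m : (0 + ((g' : H) + (V g' : H)), Complex.I • (g' : H) + -Complex.I • (V g' : H)) ∈
          S.graph := by
        rw [zero_add]
        exact S.graph.add_mem (hNp _ g'.2) (hNm _ (V g').2)
      have h2 := hf _ m (mem_naimarkDomain.2 ⟨0, D.zero_mem, g', rfl⟩)
      rw [hD.pairForm_eq hNp hNm D.zero_mem g'.2 (V g').2 m ha hg hh hfy] at h2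
      have h3 : inner ℂ h ((V g' : Nm) : H) = inner ℂ (k : H) (g' : H) := by
        have := hV k g'
        rw [hk] at this
        simpa [Submodule.coe_inner] using this
      rw [h3] at h2
      simpa using h2
    have h4 : (⟨g, hg⟩ : Np) = k := by
      refine ext_inner_right ℂ fun g' => ?_
      simpa [Submodule.coe_inner] using sub_eq_zero.1 (h1 g')
    rw [← h4] at hk ⊢
    rw [hk]

lemma IsGreenLagrangian.exists_eq_naimarkDomain (hN : IsGreenLagrangian S N)
    (hD : IsGreenKernel S D)
    (hNp : ∀ f ∈ Np, (f, Complex.I • f) ∈ S.graph)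
    (hNm : ∀ f ∈ Nm, (f, -Complex.I • f) ∈ S.graph)
    (hsup : D ⊔ (Np ⊔ Nm) = S.domain) [FiniteDimensional ℂ Np] (hDN : D ≤ N) (hNS : N ≤ S.domain) :
    ∃ V : Np →ₗ[ℂ] Nm, (∀ g g', inner ℂ (V g) (V g') = inner ℂ g g') ∧
      N = naimarkDomain D Np Nm V := by
  have iso : ∀ g g' h h', g ∈ Np → g' ∈ Np → h ∈ Nm → h' ∈ Nm → g + h ∈ N → g' + h' ∈ N →
      inner ℂ g g' = inner ℂ h h' := by
    intro g g' h h' hg hg' hh hh' m m'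
    have e : (0 + (g + h), Complex.I • g + -Complex.I • h) ∈ S.graph := by
      rw [zero_add]
      exact S.graph.add_mem (hNp _ hg) (hNm _ hh)
    have e' : (0 + (g' + h'), Complex.I • g' + -Complex.I • h') ∈ S.graph := by
      rw [zero_add]
      exact S.graph.add_mem (hNp _ hg') (hNm _ hh')
    have h1 := (hN _ _ e).1 (by rwa [zero_add]) _ e' (by simpa using m')
    rw [hD.pairForm_eq hNp hNm D.zero_mem hg' hh' e' D.zero_mem hg hh e] at h1
    exact sub_eq_zero.1 (by simpa using h1)
  have split : ∀ x ∈ N, ∃ a ∈ D, ∃ g ∈ Np, ∃ h ∈ Nm, g + h ∈ N ∧ a + (g + h) = x := by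
    intro x hx
    have h1 := hNS hx
    rw [← hsup] at h1
    obtain ⟨a, ha, y, hy, rfl⟩ := Submodule.mem_sup.1 h1
    obtain ⟨g, hg, h, hh, rfl⟩ := Submodule.mem_sup.1 hy
    exact ⟨a, ha, g, hg, h, hh, by simpa using N.sub_mem hx (hDN ha), rfl⟩
  have hle : Np ≤ N ⊔ Nm := by
    have : FiniteDimensional ℂ ((N ⊔ Nm) ⊓ Np : Submodule ℂ H) :=
      Submodule.finiteDimensional_of_le inf_le_right
    have h1 := Submodule.sup_orthogonal_inf_of_hasOrthogonalProjection
      (K₁ := (N ⊔ Nm) ⊓ Np) (K₂ := Np) inf_le_right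
    have h2 : ((N ⊔ Nm) ⊓ Np)ᗮ ⊓ Np = ⊥ := by
      rw [Submodule.eq_bot_iff]
      rintro g' ⟨h3, hg'⟩
      have m : (0 + (g' + 0), Complex.I • g') ∈ S.graph := by simpa using hNp g' hg'
      have h4 : g' + 0 ∈ N := by
        rw [← zero_add (g' + 0), hN _ _ m]
        rintro ⟨x, y⟩ hxy hx
        obtain ⟨a, ha, g, hg, h, hh, hgh, rfl⟩ := split x hx
        rw [hD.pairForm_eq hNp hNm ha hg hh hxy D.zero_mem hg' Nm.zero_mem m]
        have h5 : g ∈ (N ⊔ Nm) ⊓ Np := by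
          refine ⟨?_, hg⟩
          have : g = (g + h) + -h := by abel
          rw [this]
          exact Submodule.add_mem_sup hgh (Nm.neg_mem hh)
        have h6 := (Submodule.mem_orthogonal' _ _).1 h3 g h5
        rw [h6]
        simp
      have h7 := iso g' g' 0 0 hg' hg' Nm.zero_mem Nm.zero_mem h4 h4
      simpa using h7
    rw [h2, sup_bot_eq] at h1
    rw [← h1]
    exact inf_le_left
  have ex : ∀ g : Np, ∃ h : Nm, (g : H) + h ∈ N := by
    intro g
    obtain ⟨x, hx, h, hh, hxh⟩ := Submodule.mem_sup.1 (hle g.2)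
    refine ⟨-⟨h, hh⟩, ?_⟩
    rw [← hxh]
    simpa using hx
  have uniq : ∀ (g : Np) (h h' : Nm), (g : H) + h ∈ N → (g : H) + h' ∈ N → h = h' := by
    intro g h h' m m'
    have h1 : (0 : H) + ((h - h' : Nm) : H) ∈ N := by
      have := N.sub_mem m m'
      rw [add_sub_add_left_eq_sub] at this
      simpa using this
    have h2 := iso 0 0 _ _ Np.zero_mem Np.zero_mem (h - h').2 (h - h').2 h1 h1
    rw [inner_zero_left, eq_comm, inner_self_eq_zero] at h2
    exact sub_eq_zero.1 (Subtype.ext h2)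
  choose v hv using ex
  let V : Np →ₗ[ℂ] Nm :=
    { toFun := v
      map_add' := fun g g' => uniq (g + g') _ _ (hv _) (by
        have := N.add_mem (hv g) (hv g')
        rw [add_add_add_comm] at this
        simpa using this)
      map_smul' := fun c g => uniq (c • g) _ _ (hv _) (by
        have := N.smul_mem c (hv g)
        rw [smul_add] at this
        simpa using this) }
  refine ⟨V, fun g g' => (iso _ _ _ _ g.2 g'.2 (v g).2 (v g').2 (hv g) (hv g')).symm, ?_⟩
  ext x
  rw [mem_naimarkDomain]
  constructor
  · intro hx
    obtain ⟨a, ha, g, hg, h, hh, hgh, rfl⟩ := split x hx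
    refine ⟨a, ha, ⟨g, hg⟩, ?_⟩
    have := uniq ⟨g, hg⟩ ⟨h, hh⟩ (v ⟨g, hg⟩) hgh (hv _)
    change a + (g + ((v ⟨g, hg⟩ : Nm) : H)) = _
    rw [← this]
  · rintro ⟨a, ha, g, rfl⟩
    exact N.add_mem (hDN ha) (hv g)

namespace HasResolventGraph

variable [CompleteSpace H]

lemma isSelfAdjoint_domRestrict_iff (hS : HasResolventGraph S T Z) (hT : T.IsSymmetric)
    [FiniteDimensional ℂ Z] (hD : IsGreenKernel S D) (hDN : D ≤ N) (hNS : N ≤ S.domain) :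
    IsSelfAdjoint (S.domRestrict N) ↔ IsGreenLagrangian S N := by
  have hdom : (S.domRestrict N).domain = N := inf_eq_left.2 hNS
  have hgr : ∀ P : H × H, P ∈ (S.domRestrict N).graph ↔ P ∈ S.graph ∧ P.1 ∈ N := by
    intro P
    constructor
    · intro hP
      refine ⟨LinearPMap.le_graph_of_le LinearPMap.domRestrict_le hP, ?_⟩
      rw [← hdom]
      exact LinearPMap.mem_domain_of_mem_graph hP
    · rintro ⟨h1, h2⟩
      obtain ⟨h3, h4⟩ := LinearPMap.exists_apply_eq_of_mem_graph (f := P.1) (h := P.2) h1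
      have h5 : P.1 ∈ (S.domRestrict N).domain := ⟨h2, h3⟩
      have h6 := LinearPMap.mk_mem_graph _ h5
      have h7 : S.domRestrict N ⟨P.1, h5⟩ = S ⟨P.1, h3⟩ := LinearPMap.domRestrict_apply rfl
      rwa [h7, h4] at h6
  have hdense : Dense ((S.domRestrict N).domain : Set H) := by
    rw [hdom]
    exact (hS.dense_kernel hT hD).mono hDN
  have hadj : ∀ P : H × H, P ∈ (S.domRestrict N).adjoint.graph ↔
      P ∈ S.graph ∧ ∀ Q ∈ S.graph, Q.1 ∈ N → pairForm Q P = 0 := by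
    intro P
    rw [LinearPMap.adjoint_graph_eq_graph_adjoint hdense, Submodule.mem_adjoint_iff]
    have flip : ∀ a b : H, inner ℂ b P.1 - inner ℂ a P.2 = 0 ↔ pairForm (a, b) P = 0 := by
      intro a b
      rw [← map_eq_zero (starRingEnd ℂ), map_sub, inner_conj_symm, inner_conj_symm]
      rfl
    constructor
    · intro h1
      refine ⟨?_, fun Q hQ hQN => (flip _ _).1 (h1 Q.1 Q.2 ((hgr Q).2 ⟨hQ, hQN⟩))⟩
      rw [← hS.adjoint_eq hT hD, LinearPMap.adjoint_graph_eq_graph_adjoint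
        (by rw [domRestrict_domain_eq hD]; exact hS.dense_kernel hT hD), Submodule.mem_adjoint_iff]
      intro a b hab
      refine h1 a b ((hgr _).2 ⟨LinearPMap.le_graph_of_le LinearPMap.domRestrict_le hab, hDN ?_⟩)
      exact (LinearPMap.mem_domain_of_mem_graph hab).1
    · rintro ⟨-, h2⟩ a b hab
      obtain ⟨h3, h4⟩ := (hgr _).1 hab
      exact (flip a b).2 (h2 _ h3 h4)
  rw [LinearPMap.isSelfAdjoint_def]
  constructor
  · intro h f y hfy
    have h1 := hadj (f, y)
    rw [h, hgr] at h1
    simpa [hfy] using h1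
  · intro h
    refine LinearPMap.eq_of_eq_graph ?_
    ext ⟨f, y⟩
    rw [hadj, hgr]
    constructor
    · rintro ⟨h1, h2⟩
      exact ⟨h1, (h f y h1).2 h2⟩
    · rintro ⟨h1, h2⟩
      exact ⟨h1, (h f y h1).1 h2⟩

/-- Self-adjoint extensions of the minimal operator are restrictions of the maximal one. -/
lemma eq_domRestrict_of_isSelfAdjoint (hS : HasResolventGraph S T Z) (hT : T.IsSymmetric)
    [FiniteDimensional ℂ Z] (hD : IsGreenKernel S D) {B : H →ₗ.[ℂ] H} (hB : S.domRestrict D ≤ B)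
    (hsa : IsSelfAdjoint B) :
    D ≤ B.domain ∧ B.domain ≤ S.domain ∧ B = S.domRestrict B.domain := by
  have hle : B ≤ S := by
    have hdense : Dense ((S.domRestrict D).domain : Set H) := by
      rw [domRestrict_domain_eq hD]
      exact hS.dense_kernel hT hD
    refine LinearPMap.le_of_le_graph ?_
    rw [← hS.adjoint_eq hT hD, ← LinearPMap.isSelfAdjoint_def.1 hsa,
      LinearPMap.adjoint_graph_eq_graph_adjoint hdense,
      LinearPMap.adjoint_graph_eq_graph_adjoint hsa.dense_domain]
    intro x hx
    rw [Submodule.mem_adjoint_iff] at hx ⊢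
    exact fun a b hab => hx a b (LinearPMap.le_graph_of_le hB hab)
  refine ⟨?_, hle.1, ?_⟩
  · have := hB.1
    rwa [domRestrict_domain_eq hD] at this
  · refine LinearPMap.ext (inf_eq_left.2 hle.1).symm fun x hx hx' => ?_
    exact (hle.2 (y := ⟨x, hle.1 hx⟩) rfl).trans (LinearPMap.domRestrict_apply rfl).symm

end HasResolventGraph

/-- A subspace of `M` whose dimension modulo `D` is that of `M` spans `M` together with `D`. -/
lemma sup_eq_of_finrank_le {M Y : Submodule ℂ H} (hDM : D ≤ M) (hYM : Y ≤ M)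
    [FiniteDimensional ℂ (M.map D.mkQ)]
    (h : Module.finrank ℂ (M.map D.mkQ) ≤ Module.finrank ℂ (Y.map D.mkQ)) : D ⊔ Y = M := by
  have h1 := Submodule.eq_of_le_of_finrank_le (Submodule.map_mono hYM) h
  refine le_antisymm (sup_le hDM hYM) ?_
  have h2 := congrArg (Submodule.comap D.mkQ) h1
  rw [Submodule.comap_map_mkQ, Submodule.comap_map_mkQ] at h2
  rw [h2]
  exact le_sup_right

lemma finrank_map_mkQ_span {κ : Type*} [Fintype κ] {c : κ → H}
    (hc : LinearIndependent ℂ (D.mkQ ∘ c)) :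
    Module.finrank ℂ ((Submodule.span ℂ (Set.range c)).map D.mkQ) = Fintype.card κ := by
  rw [Submodule.map_span, ← Set.range_comp]
  exact finrank_span_eq_card hc

lemma linearIndependent_mkQ_sumElim (hD : IsGreenKernel S D)
    (hNp : ∀ f ∈ Np, (f, Complex.I • f) ∈ S.graph)
    (hNm : ∀ f ∈ Nm, (f, -Complex.I • f) ∈ S.graph) {ι κ : Type*} {e : ι → Np} {e' : κ → Nm}
    (he : LinearIndependent ℂ e) (he' : LinearIndependent ℂ e') :
    LinearIndependent ℂ (D.mkQ ∘ Sum.elim (fun i => (e i : H)) (fun i => (e' i : H))) := by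
  let φ : Np × Nm →ₗ[ℂ] H ⧸ D := D.mkQ ∘ₗ (Np.subtype.coprod Nm.subtype)
  have hφ : LinearMap.ker φ = ⊥ := by
    rw [LinearMap.ker_eq_bot']
    rintro ⟨g, h⟩ hgh
    have h1 : (g : H) + h ∈ D := by simpa [φ, ← Submodule.Quotient.mk_add] using hgh
    obtain ⟨h2, h3⟩ := hD.eq_zero_of_add_mem hNp hNm g.2 h.2 h1
    exact Prod.ext (Subtype.ext h2) (Subtype.ext h3)
  have h1 := (linearIndependent_inl_union_inr' he he').map' φ hφ
  have h2 : φ ∘ Sum.elim (LinearMap.inl ℂ Np Nm ∘ e) (LinearMap.inr ℂ Np Nm ∘ e') =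
      D.mkQ ∘ Sum.elim (fun i => (e i : H)) (fun i => (e' i : H)) := by
    ext i
    rcases i with i | i <;> simp [φ]
  rwa [h2] at h1

theorem HasResolventGraph.decomposition [CompleteSpace H]
    (hS : HasResolventGraph S T Z) (hT : T.IsSymmetric)
    [FiniteDimensional ℂ Z] (hD : IsGreenKernel S D) {m : ℕ} (hZ : Module.finrank ℂ Z ≤ m)
    {ι : Type*} [Fintype ι] (hι : Fintype.card ι = 2 * m) {b : ι → H} (hb : ∀ i, b i ∈ S.domain)
    (hli : LinearIndependent ℂ (D.mkQ ∘ b)) :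
    Module.finrank ℂ Z = m ∧ D ⊔ Submodule.span ℂ (Set.range b) = S.domain ∧
      D ⊔ (defectSpace (S.domRestrict D) Complex.I ⊔ defectSpace (S.domRestrict D) (-Complex.I)) =
        S.domain := by
  set Y : Submodule ℂ H := Z ⊔ Z.map (T : H →ₗ[ℂ] H) with hY
  have h1 : S.domain.map D.mkQ ≤ Y.map D.mkQ := by
    refine (Submodule.map_mono (hS.domain_le hT hD)).trans ?_
    rw [Submodule.map_sup, Submodule.mkQ_map_self, bot_sup_eq]
  have h2 : FiniteDimensional ℂ (S.domain.map D.mkQ) := Submodule.finiteDimensional_of_le h1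
  have h3 : Module.finrank ℂ (S.domain.map D.mkQ) ≤ 2 * Module.finrank ℂ Z := by
    have e1 := Submodule.finrank_mono h1
    have e2 := Submodule.finrank_map_le D.mkQ Y
    have e3 := Submodule.finrank_add_le_finrank_add_finrank Z (Z.map (T : H →ₗ[ℂ] H))
    rw [← hY] at e3
    have e4 := Submodule.finrank_map_le (T : H →ₗ[ℂ] H) Z
    omega
  have hbS : Submodule.span ℂ (Set.range b) ≤ S.domain :=
    Submodule.span_le.2 (Set.range_subset_iff.2 hb)
  have h4 := Submodule.finrank_mono (Submodule.map_mono (f := D.mkQ) hbS)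
  rw [finrank_map_mkQ_span hli, hι] at h4
  have h5 : Module.finrank ℂ Z = m := by omega
  refine ⟨h5, sup_eq_of_finrank_le (kernel_le_domain hD) hbS (by rw [finrank_map_mkQ_span hli]; omega), ?_⟩
  have hNp : ∀ f ∈ defectSpace (S.domRestrict D) Complex.I, (f, Complex.I • f) ∈ S.graph :=
    fun f hf => (hS.mem_defect_iff hT hD _ f).1 hf
  have hNm : ∀ f ∈ defectSpace (S.domRestrict D) (-Complex.I), (f, -Complex.I • f) ∈ S.graph :=
    fun f hf => (hS.mem_defect_iff hT hD _ f).1 hf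
  obtain ⟨h6, h7⟩ := hS.finrank_defect hT hD (z := Complex.I) (by simp)
  obtain ⟨h8, h9⟩ := hS.finrank_defect hT hD (z := -Complex.I) (by simp)
  have hNS : defectSpace (S.domRestrict D) Complex.I ⊔ defectSpace (S.domRestrict D) (-Complex.I) ≤
      S.domain := sup_le (fun f hf => LinearPMap.mem_domain_of_mem_graph (hNp f hf))
        (fun f hf => LinearPMap.mem_domain_of_mem_graph (hNm f hf))
  refine sup_eq_of_finrank_le (kernel_le_domain hD) hNS ?_
  have h10 := linearIndependent_mkQ_sumElim hD hNp hNm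
    (Module.finBasis ℂ (defectSpace (S.domRestrict D) Complex.I)).linearIndependent
    (Module.finBasis ℂ (defectSpace (S.domRestrict D) (-Complex.I))).linearIndependent
  have h11 := finrank_map_mkQ_span h10
  have h12 := Submodule.finrank_mono (R := ℂ) (Submodule.map_mono (f := D.mkQ)
    (Submodule.span_le.2 (Set.range_subset_iff.2 fun i => show Sum.elim
        (fun i => (Module.finBasis ℂ (defectSpace (S.domRestrict D) Complex.I) i : H))
        (fun i => (Module.finBasis ℂ (defectSpace (S.domRestrict D) (-Complex.I)) i : H)) i ∈
      defectSpace (S.domRestrict D) Complex.I ⊔ defectSpace (S.domRestrict D) (-Complex.I) by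
        rcases i with i | i
        · exact Submodule.mem_sup_left (Subtype.mem _)
        · exact Submodule.mem_sup_right (Subtype.mem _))))
  rw [h11] at h12
  simp only [Fintype.card_sum, Fintype.card_fin] at h12
  omega

end Abstract

/-! ### Self-adjoint extensions and unitary matrices -/

section Abstract

variable {H : Type*} [NormedAddCommGroup H] [InnerProductSpace ℂ H]
variable {ι : Type*} [Fintype ι] [DecidableEq ι]

lemma equiv_symm_comp_toLin_comp_equiv {N N' M M' : Type*} [AddCommGroup N] [Module ℂ N]
    [AddCommGroup N'] [Module ℂ N'] [AddCommGroup M] [Module ℂ M] [AddCommGroup M'] [Module ℂ M']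
    (e : Module.Basis ι ℂ N) (e' : Module.Basis ι ℂ N') (b : Module.Basis ι ℂ M)
    (b' : Module.Basis ι ℂ M') (u : Matrix ι ι ℂ) :
    (e'.equiv b' (Equiv.refl _)).symm.toLinearMap ∘ₗ Matrix.toLin b b' u ∘ₗ
      (e.equiv b (Equiv.refl _)).toLinearMap = Matrix.toLin e e' u := by
  refine e.ext fun j => ?_
  simp [Matrix.toLin_self]

lemma toLin_inner_eq_iff {N N' : Type*} [NormedAddCommGroup N] [InnerProductSpace ℂ N]
    [NormedAddCommGroup N'] [InnerProductSpace ℂ N'] (e : OrthonormalBasis ι ℂ N)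
    (e' : OrthonormalBasis ι ℂ N') (u : Matrix ι ι ℂ) :
    (∀ g g', inner ℂ (Matrix.toLin e.toBasis e'.toBasis u g)
      (Matrix.toLin e.toBasis e'.toBasis u g') = inner ℂ g g') ↔ u ∈ Matrix.unitaryGroup ι ℂ := by
  have : FiniteDimensional ℂ N := e.toBasis.finiteDimensional_of_finite
  have : FiniteDimensional ℂ N' := e'.toBasis.finiteDimensional_of_finite
  set V := Matrix.toLin e.toBasis e'.toBasis u with hV
  have h1 : LinearMap.toMatrix e.toBasis e.toBasis (LinearMap.adjoint V ∘ₗ V) = star u * u := by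
    rw [LinearMap.toMatrix_comp _ e'.toBasis, LinearMap.toMatrix_adjoint, hV,
      LinearMap.toMatrix_toLin]
    rfl
  rw [Matrix.mem_unitaryGroup_iff', ← h1, ← LinearMap.toMatrix_id e.toBasis,
    (LinearMap.toMatrix _ _).injective.eq_iff, LinearMap.ext_iff]
  constructor
  · intro h g
    refine ext_inner_right ℂ fun g' => ?_
    rw [LinearMap.comp_apply, LinearMap.adjoint_inner_left, h]
    rfl
  · intro h g g'
    rw [← LinearMap.adjoint_inner_left, ← LinearMap.comp_apply, h]
    rfl

variable {S : H →ₗ.[ℂ] H} {T : H →L[ℂ] H} {Z D : Submodule ℂ H}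

theorem HasResolventGraph.bijOn_unitaryGroup [CompleteSpace H]
    (hS : HasResolventGraph S T Z) (hT : T.IsSymmetric)
    [FiniteDimensional ℂ Z] (hD : IsGreenKernel S D)
    (hsup : D ⊔ (defectSpace (S.domRestrict D) Complex.I ⊔
      defectSpace (S.domRestrict D) (-Complex.I)) = S.domain)
    (ep : OrthonormalBasis ι ℂ (defectSpace (S.domRestrict D) Complex.I))
    (em : OrthonormalBasis ι ℂ (defectSpace (S.domRestrict D) (-Complex.I))) :
    Set.BijOn (fun u : Matrix ι ι ℂ => S.domRestrict (naimarkDomain D _ _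
      (Matrix.toLin ep.toBasis em.toBasis u))) (Matrix.unitaryGroup ι ℂ)
      {A | S.domRestrict D ≤ A ∧ IsSelfAdjoint A} := by
  have hNp : ∀ f ∈ defectSpace (S.domRestrict D) Complex.I, (f, Complex.I • f) ∈ S.graph :=
    fun f hf => (hS.mem_defect_iff hT hD _ f).1 hf
  have hNm : ∀ f ∈ defectSpace (S.domRestrict D) (-Complex.I), (f, -Complex.I • f) ∈ S.graph :=
    fun f hf => (hS.mem_defect_iff hT hD _ f).1 hf
  have fp : FiniteDimensional ℂ (defectSpace (S.domRestrict D) Complex.I) :=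
    ep.toBasis.finiteDimensional_of_finite
  have fm : FiniteDimensional ℂ (defectSpace (S.domRestrict D) (-Complex.I)) :=
    em.toBasis.finiteDimensional_of_finite
  have hrank : Module.finrank ℂ (defectSpace (S.domRestrict D) Complex.I) =
      Module.finrank ℂ (defectSpace (S.domRestrict D) (-Complex.I)) := by
    rw [Module.finrank_eq_card_basis ep.toBasis, Module.finrank_eq_card_basis em.toBasis]
  have hle := hD.naimarkDomain_le hNp hNm
  refine ⟨fun u hu => ?_, fun u _ v _ huv => ?_, ?_⟩
  · have hV := (toLin_inner_eq_iff ep em u).2 hu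
    have hinj : Function.Injective (Matrix.toLin ep.toBasis em.toBasis u) := by
      refine (injective_iff_map_eq_zero _).2 fun g hg => ?_
      have := hV g g
      rwa [hg, inner_zero_left, eq_comm, inner_self_eq_zero] at this
    have hsurj := (LinearMap.injective_iff_surjective_of_finrank_eq_finrank hrank).1 hinj
    refine ⟨⟨?_, ?_⟩, (hS.isSelfAdjoint_domRestrict_iff hT hD le_sup_left (hle _)).2
      (isGreenLagrangian_naimarkDomain hD hNp hNm hsup _ hV hsurj)⟩
    · exact inf_le_inf_right _ le_sup_left
    · intro x y hxy
      exact (LinearPMap.domRestrict_apply (y := ⟨(x : H), x.2.2⟩) rfl).trans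
        (LinearPMap.domRestrict_apply (x := y) (y := ⟨(x : H), x.2.2⟩) hxy.symm).symm
  · have h1 := congrArg LinearPMap.domain huv
    simp only [LinearPMap.domRestrict_domain] at h1
    rw [inf_eq_left.2 (hle _), inf_eq_left.2 (hle _)] at h1
    exact (Matrix.toLin ep.toBasis em.toBasis).injective (hD.naimarkDomain_injective hNp hNm h1)
  · rintro B ⟨hB, hsa⟩
    obtain ⟨h1, h2, h3⟩ := hS.eq_domRestrict_of_isSelfAdjoint hT hD hB hsa
    have h4 : IsGreenLagrangian S B.domain := by
      rw [h3] at hsa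
      exact (hS.isSelfAdjoint_domRestrict_iff hT hD h1 h2).1 hsa
    obtain ⟨V, hV, hBV⟩ := h4.exists_eq_naimarkDomain hD hNp hNm hsup h1 h2
    refine ⟨LinearMap.toMatrix ep.toBasis em.toBasis V, ?_, ?_⟩
    · rw [SetLike.mem_coe, ← toLin_inner_eq_iff ep em, Matrix.toLin_toMatrix]
      exact hV
    · simp only [Matrix.toLin_toMatrix]
      rw [← hBV, ← h3]

lemma sup_span_eq_sup_span {κ : Type*} {x y : κ → H} (h : ∀ j, x j - y j ∈ D) :
    D ⊔ Submodule.span ℂ (Set.range x) = D ⊔ Submodule.span ℂ (Set.range y) := by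
  have key : ∀ {x y : κ → H}, (∀ j, x j - y j ∈ D) →
      D ⊔ Submodule.span ℂ (Set.range x) ≤ D ⊔ Submodule.span ℂ (Set.range y) := by
    intro x y h
    refine sup_le le_sup_left (Submodule.span_le.2 ?_)
    rintro _ ⟨j, rfl⟩
    rw [← sub_add_cancel (x j) (y j)]
    exact Submodule.add_mem_sup (h j) (Submodule.subset_span ⟨j, rfl⟩)
  refine le_antisymm (key h) (key fun j => ?_)
  rw [← neg_sub]
  exact D.neg_mem (h j)

/-- Two families that are bases of the same space modulo `D` are related by an invertible matrix. -/
lemma exists_isUnit_det_of_span_eq {κ : Type*} [Fintype κ] [DecidableEq κ] {b e : κ → H}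
    (hb : LinearIndependent ℂ (D.mkQ ∘ b)) (he : LinearIndependent ℂ (D.mkQ ∘ e))
    (hbe : ∀ j, e j ∈ D ⊔ Submodule.span ℂ (Set.range b)) :
    ∃ C : Matrix κ κ ℂ, IsUnit C.det ∧ ∀ j, e j - ∑ i, C i j • b i ∈ D := by
  let B := Module.Basis.span hb
  have hmem : ∀ j, D.mkQ (e j) ∈ Submodule.span ℂ (Set.range (D.mkQ ∘ b)) := by
    intro j
    have := Submodule.mem_map_of_mem (f := D.mkQ) (hbe j)
    rwa [Submodule.map_sup, Submodule.mkQ_map_self, bot_sup_eq, Submodule.map_span,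
      ← Set.range_comp] at this
  let v : κ → Submodule.span ℂ (Set.range (D.mkQ ∘ b)) := fun j => ⟨_, hmem j⟩
  have hv : LinearIndependent ℂ v := LinearIndependent.of_comp (Submodule.subtype _) he
  have hv' : ⊤ ≤ Submodule.span ℂ (Set.range v) := by
    have : FiniteDimensional ℂ (Submodule.span ℂ (Set.range (D.mkQ ∘ b))) :=
      B.finiteDimensional_of_finite
    rw [hv.span_eq_top_of_card_eq_finrank' (Module.finrank_eq_card_basis B).symm]
  refine ⟨B.toMatrix v, ?_, fun j => ?_⟩
  · rw [← Module.Basis.det_apply]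
    exact (Module.Basis.is_basis_iff_det B).1 ⟨hv, top_le_iff.1 hv'⟩
  · rw [← Submodule.Quotient.mk_eq_zero, Submodule.Quotient.mk_sub, sub_eq_zero]
    have h1 := congrArg Subtype.val (B.sum_toMatrix_smul_self v j)
    have h2 : ((v j : _) : H ⧸ D) = D.mkQ (e j) := rfl
    rw [h2] at h1
    change D.mkQ (e j) = D.mkQ _
    rw [← h1, map_sum]
    simp [B, Module.Basis.span_apply]

theorem HasResolventGraph.exists_extension_domain [CompleteSpace H]
    (hS : HasResolventGraph S T Z) (hT : T.IsSymmetric)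
    [FiniteDimensional ℂ Z] (hD : IsGreenKernel S D)
    {bp bm : ι → H} (hli : LinearIndependent ℂ (D.mkQ ∘ Sum.elim bp bm))
    (hspan : D ⊔ Submodule.span ℂ (Set.range (Sum.elim bp bm)) = S.domain)
    (ep : OrthonormalBasis ι ℂ (defectSpace (S.domRestrict D) Complex.I))
    (em : OrthonormalBasis ι ℂ (defectSpace (S.domRestrict D) (-Complex.I))) :
    ∃ Cp Cm : Matrix (ι ⊕ ι) ι ℂ, IsUnit (Matrix.fromCols Cp Cm).det ∧
      ∀ u : Matrix ι ι ℂ, (S.domRestrict (naimarkDomain D _ _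
        (Matrix.toLin ep.toBasis em.toBasis u))).domain =
          D ⊔ Submodule.span ℂ (Set.range fun j => ∑ i, (Cp + Cm * u) i j • Sum.elim bp bm i) := by
  have hNp : ∀ f ∈ defectSpace (S.domRestrict D) Complex.I, (f, Complex.I • f) ∈ S.graph :=
    fun f hf => (hS.mem_defect_iff hT hD _ f).1 hf
  have hNm : ∀ f ∈ defectSpace (S.domRestrict D) (-Complex.I), (f, -Complex.I • f) ∈ S.graph :=
    fun f hf => (hS.mem_defect_iff hT hD _ f).1 hf
  have he := linearIndependent_mkQ_sumElim hD hNp hNm ep.toBasis.linearIndependent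
    em.toBasis.linearIndependent
  obtain ⟨C, hC, hCe⟩ := exists_isUnit_det_of_span_eq hli he (by
    rw [hspan]
    rintro (j | j)
    · exact LinearPMap.mem_domain_of_mem_graph (hNp _ (Subtype.mem _))
    · exact LinearPMap.mem_domain_of_mem_graph (hNm _ (Subtype.mem _)))
  refine ⟨C.toCols₁, C.toCols₂, by rwa [Matrix.fromCols_toCols], fun u => ?_⟩
  rw [LinearPMap.domRestrict_domain, inf_eq_left.2 (hD.naimarkDomain_le hNp hNm _), naimarkDomain,
    LinearMap.range_eq_map, ← ep.toBasis.span_eq, Submodule.map_span, ← Set.range_comp]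
  refine sup_span_eq_sup_span fun j => ?_
  have h1 := hCe (Sum.inl j)
  have h2 := D.sum_mem (t := Finset.univ) fun k (_ : k ∈ Finset.univ) =>
    D.smul_mem (u k j) (hCe (Sum.inr k))
  convert D.add_mem h1 h2 using 1
  simp only [Function.comp_apply, LinearMap.add_apply, LinearMap.comp_apply,
    Submodule.subtype_apply, Matrix.toLin_self, Sum.elim_inl, Sum.elim_inr, smul_sub,
    Finset.sum_sub_distrib, Matrix.add_apply, Matrix.mul_apply, add_smul, Finset.sum_add_distrib,
    Matrix.toCols₁_apply, Matrix.toCols₂_apply, Finset.smul_sum, Finset.sum_smul, smul_smul]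
  rw [Finset.sum_comm (f := fun x y => (u x j * C y (Sum.inr x)) • Sum.elim bp bm y)]
  simp only [mul_comm (u _ j), AddSubmonoidClass.coe_finsetSum, Submodule.coe_smul]
  abel

end Abstract

/-! ### Locally absolutely continuous derivatives -/

/-- `f, …, f^(k)` exist and are locally absolutely continuous on `(-1, 1)`. -/
def LocAC (k : ℕ) (f : ℝ → ℂ) : Prop :=
  ContDiffOn ℝ (k : ℕ∞) f (Ioo (-1) 1) ∧
    ∀ a ∈ Ioo (-1 : ℝ) 1, ∀ b ∈ Ioo (-1 : ℝ) 1,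
      AbsolutelyContinuousOnInterval (iteratedDeriv k f) a b

lemma locAC_zero_iff {f : ℝ → ℂ} : LocAC 0 f ↔ ∀ a ∈ Ioo (-1 : ℝ) 1, ∀ b ∈ Ioo (-1 : ℝ) 1,
    AbsolutelyContinuousOnInterval f a b := by
  rw [LocAC, iteratedDeriv_zero, and_iff_right_iff_imp]
  intro h
  refine contDiffOn_zero.2 fun x hx => ?_
  have h1 : (x - 1) / 2 ∈ Ioo (-1 : ℝ) 1 := ⟨by linarith [hx.1], by linarith [hx.2]⟩
  have h2 : (x + 1) / 2 ∈ Ioo (-1 : ℝ) 1 := ⟨by linarith [hx.1], by linarith [hx.2]⟩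
  refine ((h _ h1 _ h2).continuousOn.continuousAt ?_).continuousWithinAt
  rw [uIcc_of_le (by linarith)]
  exact Icc_mem_nhds (by linarith [hx.1]) (by linarith [hx.2])

lemma locAC_succ_iff {k : ℕ} {f : ℝ → ℂ} :
    LocAC (k + 1) f ↔ DifferentiableOn ℝ f (Ioo (-1) 1) ∧ LocAC k (deriv f) := by
  have e : (((k + 1 : ℕ) : ℕ∞) : WithTop ℕ∞) = ((k : ℕ∞) : WithTop ℕ∞) + 1 := by norm_cast
  rw [LocAC, LocAC, e, contDiffOn_succ_iff_deriv_of_isOpen isOpen_Ioo, iteratedDeriv_succ']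
  simp [and_assoc]

lemma LocAC.congr {k : ℕ} {f g : ℝ → ℂ} (hf : LocAC k f) (h : EqOn f g (Ioo (-1) 1)) :
    LocAC k g := by
  refine ⟨hf.1.congr h.symm, fun a ha b hb => absolutelyContinuousOnInterval_congr ?_
    (hf.2 a ha b hb)⟩
  exact (h.iteratedDeriv_of_isOpen isOpen_Ioo k).mono (uIcc_subset_Ioo_jacobi ha hb)

lemma locAC_zero_of_contDiffOn {f : ℝ → ℂ} (hf : ContDiffOn ℝ 1 f (Ioo (-1) 1)) : LocAC 0 f :=
  locAC_zero_iff.2 fun _ ha _ hb =>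
    (hf.mono (uIcc_subset_Ioo_jacobi ha hb)).absolutelyContinuousOnInterval

lemma LocAC.pred : ∀ {k : ℕ} {f : ℝ → ℂ}, LocAC (k + 1) f → LocAC k f
  | 0, _, hf => locAC_zero_of_contDiffOn (by exact_mod_cast hf.1)
  | _ + 1, _, hf => by
    rw [locAC_succ_iff] at hf ⊢
    exact ⟨hf.1, hf.2.pred⟩

lemma LocAC.of_le {k l : ℕ} (hkl : k ≤ l) {f : ℝ → ℂ} (hf : LocAC l f) : LocAC k f := by
  induction l, hkl using Nat.le_induction with
  | base => exact hf
  | succ l _ ih => exact ih hf.pred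

lemma locAC_of_contDiffOn : ∀ {k : ℕ} {f : ℝ → ℂ}, ContDiffOn ℝ ∞ f (Ioo (-1) 1) → LocAC k f
  | 0, _, hf => locAC_zero_of_contDiffOn (hf.of_le (by simp))
  | _ + 1, _, hf => by
    rw [contDiffOn_infty_iff_deriv_of_isOpen isOpen_Ioo] at hf
    exact locAC_succ_iff.2 ⟨hf.1, locAC_of_contDiffOn hf.2⟩

lemma LocAC.continuousOn {k : ℕ} {f : ℝ → ℂ} (hf : LocAC k f) : ContinuousOn f (Ioo (-1) 1) :=
  hf.1.continuousOn

lemma LocAC.add : ∀ {k : ℕ} {f g : ℝ → ℂ}, LocAC k f → LocAC k g → LocAC k (f + g)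
  | 0, _, _, hf, hg => by
    rw [locAC_zero_iff] at *
    exact fun a ha b hb => (hf a ha b hb).add (hg a ha b hb)
  | _ + 1, _, _, hf, hg => by
    rw [locAC_succ_iff] at *
    refine ⟨hf.1.add hg.1, (hf.2.add hg.2).congr fun x hx => ?_⟩
    exact (deriv_add (hf.1.differentiableAt (isOpen_Ioo.mem_nhds hx))
      (hg.1.differentiableAt (isOpen_Ioo.mem_nhds hx))).symm

lemma LocAC.smul : ∀ {k : ℕ} {a : ℝ → ℝ} {f : ℝ → ℂ}, ContDiffOn ℝ ∞ a (Ioo (-1) 1) →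
    LocAC k f → LocAC k (fun x => a x • f x)
  | 0, _, _, ha, hf => by
    rw [locAC_zero_iff] at *
    exact fun c hc b hb => ((ha.of_le (by simp)).mono
      (uIcc_subset_Ioo_jacobi hc hb)).absolutelyContinuousOnInterval.smul (hf c hc b hb)
  | k + 1, a, f, ha, hf => by
    have ha' := (contDiffOn_infty_iff_deriv_of_isOpen isOpen_Ioo).1 ha
    have hf' := locAC_succ_iff.1 hf
    refine locAC_succ_iff.2 ⟨ha'.1.smul hf'.1, ((LocAC.smul ha hf'.2).add
      (LocAC.smul ha'.2 hf.pred)).congr fun x hx => ?_⟩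
    exact (deriv_fun_smul (ha'.1.differentiableAt (isOpen_Ioo.mem_nhds hx))
      (hf'.1.differentiableAt (isOpen_Ioo.mem_nhds hx))).symm

lemma LocAC.const_smul {k : ℕ} {f : ℝ → ℂ} (c : ℂ) (hf : LocAC k f) : LocAC k (c • f) := by
  induction k generalizing f with
  | zero =>
    rw [locAC_zero_iff] at *
    exact fun a ha b hb => (hf a ha b hb).const_smul c
  | succ k ih =>
    rw [locAC_succ_iff] at *
    refine ⟨hf.1.const_smul c, (ih hf.2).congr fun x hx => ?_⟩
    exact (deriv_const_smul_field c f).symm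

lemma absolutelyContinuousOnInterval_integral {v : ℝ → ℂ} {a b c : ℝ}
    (hv : IntervalIntegrable v volume a b) (hc : c ∈ uIcc a b) :
    AbsolutelyContinuousOnInterval (fun x => ∫ t in c..x, v t) a b := by
  have hre : IntervalIntegrable (fun t => (v t).re) volume a b := ⟨hv.1.re, hv.2.re⟩
  have him : IntervalIntegrable (fun t => (v t).im) volume a b := ⟨hv.1.im, hv.2.im⟩
  have h1 := (hre.absolutelyContinuousOnInterval_intervalIntegral hc).smul
    (contDiff_const (c := (1 : ℂ)) (n := 1)).contDiffOn.absolutelyContinuousOnInterval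
  have h2 := (him.absolutelyContinuousOnInterval_intervalIntegral hc).smul
    (contDiff_const (c := Complex.I) (n := 1)).contDiffOn.absolutelyContinuousOnInterval
  refine absolutelyContinuousOnInterval_congr (fun x hx => ?_) (h1.add h2)
  have hi : IntervalIntegrable v volume c x := hv.mono_set (uIcc_subset_uIcc hc hx)
  have e1 : (∫ t in c..x, (v t).re) = (∫ t in c..x, v t).re :=
    Complex.reCLM.intervalIntegral_comp_comm hi
  have e2 : (∫ t in c..x, (v t).im) = (∫ t in c..x, v t).im :=
    Complex.imCLM.intervalIntegral_comp_comm hi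
  simp only [Pi.add_apply, Pi.smul_apply', e1, e2, Complex.real_smul, mul_one]
  exact Complex.re_add_im _

lemma locAC_zero_integral {v : ℝ → ℂ}
    (hv : ∀ a ∈ Ioo (-1 : ℝ) 1, ∀ b ∈ Ioo (-1 : ℝ) 1, IntervalIntegrable v volume a b)
    {c : ℝ} (hc : c ∈ Ioo (-1 : ℝ) 1) : LocAC 0 (fun x => ∫ t in c..x, v t) := by
  rw [locAC_zero_iff]
  intro a ha b hb
  have hm : min (min a b) c ∈ Ioo (-1 : ℝ) 1 := by
    simp only [mem_Ioo, lt_min_iff, min_lt_iff]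
    exact ⟨⟨⟨ha.1, hb.1⟩, hc.1⟩, Or.inr hc.2⟩
  have hM : max (max a b) c ∈ Ioo (-1 : ℝ) 1 := by
    simp only [mem_Ioo, max_lt_iff, lt_max_iff]
    exact ⟨Or.inr hc.1, ⟨ha.2, hb.2⟩, hc.2⟩
  have hle : min (min a b) c ≤ max (max a b) c := (min_le_right _ _).trans (le_max_right _ _)
  refine (absolutelyContinuousOnInterval_integral (hv _ hm _ hM) (c := c) ?_).mono ?_
  · rw [uIcc_of_le hle]
    exact ⟨min_le_right _ _, le_max_right _ _⟩
  · rw [uIcc_of_le hle]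
    exact Icc_subset_Icc (min_le_left _ _) (le_max_left _ _)

/-- A locally absolutely continuous function is determined by its derivative. -/
lemma LocAC.eqOn_const {f : ℝ → ℂ} (hf : LocAC 0 f)
    (h : ∀ᵐ x ∂volume.restrict (Ioo (-1 : ℝ) 1), HasDerivAt f 0 x) :
    ∀ x ∈ Ioo (-1 : ℝ) 1, f x = f 0 := by
  intro x hx
  have h0 : (0 : ℝ) ∈ Ioo (-1 : ℝ) 1 := by norm_num
  rw [ae_restrict_iff' measurableSet_Ioo] at h
  obtain ⟨C, hC⟩ := (locAC_zero_iff.1 hf 0 h0 x hx).const_of_ae_hasDerivAt_zero (by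
    filter_upwards [h] with y hy hy'
    exact hy (uIcc_subset_Ioo_jacobi h0 hx hy'))
  rw [hC x right_mem_uIcc, hC 0 left_mem_uIcc]

lemma jacobiWeight_contDiffOn (a b : ℝ) : ContDiffOn ℝ ∞ (jacobiWeight a b) (Ioo (-1) 1) :=
  fun _ hx => (jacobiWeight_contDiffAt a b hx).contDiffWithinAt

lemma jacobiWeight_inv_contDiffOn (a b : ℝ) :
    ContDiffOn ℝ ∞ (fun x => (jacobiWeight a b x)⁻¹) (Ioo (-1) 1) :=
  (jacobiWeight_contDiffOn a b).inv fun _ hx => (jacobiWeight_pos a b hx).ne'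

lemma LocAC.jacobiExpr {α β : ℝ} {k : ℕ} {f : ℝ → ℂ} (hf : LocAC (k + 2) f) :
    LocAC k (jacobiExpr α β f) := by
  have h1 := LocAC.smul (jacobiWeight_contDiffOn (α + 1) (β + 1)) (locAC_succ_iff.1 hf).2
  have h2 := LocAC.smul (jacobiWeight_inv_contDiffOn α β).neg (locAC_succ_iff.1 h1).2
  refine h2.congr fun x _ => ?_
  simp [_root_.jacobiExpr]

/-! ### The second solution of `ℓ[f] = 0` -/

section

variable {α β : ℝ}

/-- The solution `∫₀ˣ (1 - s)^(-α-1) (1 + s)^(-β-1) ds` of `ℓ[f] = 0`. -/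
def jacobiSol (α β : ℝ) (x : ℝ) : ℝ := ∫ s in (0 : ℝ)..x, (jacobiWeight (α + 1) (β + 1) s)⁻¹

lemma jacobiSol_hasDerivAt {x : ℝ} (hx : x ∈ Ioo (-1 : ℝ) 1) :
    HasDerivAt (jacobiSol α β) (jacobiWeight (α + 1) (β + 1) x)⁻¹ x := by
  have h0 : (0 : ℝ) ∈ Ioo (-1 : ℝ) 1 := by norm_num
  have hc := (jacobiWeight_inv_contDiffOn (α + 1) (β + 1)).continuousOn
  refine intervalIntegral.integral_hasDerivAt_right ?_ ?_ ?_
  · exact (hc.mono (uIcc_subset_Ioo_jacobi h0 hx)).intervalIntegrable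
  · exact hc.stronglyMeasurableAtFilter isOpen_Ioo x hx
  · exact hc.continuousAt (isOpen_Ioo.mem_nhds hx)

lemma jacobiSol_contDiffOn : ContDiffOn ℝ ∞ (jacobiSol α β) (Ioo (-1) 1) := by
  rw [contDiffOn_infty_iff_deriv_of_isOpen isOpen_Ioo]
  refine ⟨fun x hx => (jacobiSol_hasDerivAt hx).differentiableAt.differentiableWithinAt, ?_⟩
  exact (jacobiWeight_inv_contDiffOn (α + 1) (β + 1)).congr fun x hx =>
    (jacobiSol_hasDerivAt hx).deriv

lemma jacobiSol_strictMonoOn : StrictMonoOn (jacobiSol α β) (Ioo (-1) 1) := by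
  refine strictMonoOn_of_deriv_pos (convex_Ioo _ _) jacobiSol_contDiffOn.continuousOn ?_
  rw [interior_Ioo]
  intro x hx
  rw [(jacobiSol_hasDerivAt hx).deriv]
  exact inv_pos.2 (jacobiWeight_pos _ _ hx)

@[simp] lemma jacobiSol_zero : jacobiSol α β 0 = 0 := by simp [jacobiSol]

lemma jacobiSol_comp_neg (x : ℝ) : jacobiSol α β (-x) = -jacobiSol β α x := by
  have h := intervalIntegral.integral_comp_neg (a := 0) (b := x)
    (fun s => (jacobiWeight (α + 1) (β + 1) s)⁻¹)
  rw [neg_zero, intervalIntegral.integral_symm 0 (-x)] at h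
  rw [jacobiSol, ← neg_eq_iff_eq_neg, ← h, jacobiSol]
  simp [jacobiWeight, mul_comm, sub_eq_add_neg]

lemma jacobiSol_le (hβ : 0 ≤ β) {a : ℝ} (ha : 0 < a) (haα : α ≤ a) {x : ℝ} (h0 : 0 ≤ x)
    (h1 : x < 1) : jacobiSol α β x ≤ a⁻¹ * (1 - x) ^ (-a) := by
  have hder : ∀ y ∈ Ioo (-1 : ℝ) 1,
      HasDerivAt (fun y => a⁻¹ * (1 - y) ^ (-a)) ((1 - y) ^ (-a - 1)) y := by
    intro y hy
    have h2 := ((hasDerivAt_id y).const_sub 1).rpow_const (p := -a) (Or.inl (by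
      change 1 - y ≠ 0
      linarith [hy.2]))
    have h3 := h2.const_mul a⁻¹
    have h4 : a⁻¹ * (-1 * -a * (1 - id y) ^ (-a - 1)) = (1 - y) ^ (-a - 1) := by
      rw [neg_one_mul, neg_neg, ← mul_assoc, inv_mul_cancel₀ ha.ne', one_mul, id]
    rw [h4] at h3
    exact h3
  have hmono : MonotoneOn (fun y => a⁻¹ * (1 - y) ^ (-a) - jacobiSol α β y) (Ico 0 1) := by
    refine monotoneOn_of_hasDerivWithinAt_nonneg (convex_Ico 0 1)
      (f' := fun y => (1 - y) ^ (-a - 1) - (jacobiWeight (α + 1) (β + 1) y)⁻¹) ?_ ?_ ?_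
    · intro y hy
      have hy' : y ∈ Ioo (-1 : ℝ) 1 := ⟨by linarith [hy.1], hy.2⟩
      exact ((hder y hy').sub (jacobiSol_hasDerivAt hy')).continuousAt.continuousWithinAt
    · rw [interior_Ico]
      intro y hy
      have hy' : y ∈ Ioo (-1 : ℝ) 1 := ⟨by linarith [hy.1], hy.2⟩
      exact ((hder y hy').sub (jacobiSol_hasDerivAt hy')).hasDerivWithinAt
    · rw [interior_Ico]
      intro y hy
      have h4 : (0 : ℝ) < 1 - y := by linarith [hy.2]
      rw [sub_nonneg, jacobiWeight, mul_inv, ← Real.rpow_neg h4.le]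
      have h5 : (1 - y) ^ (-(α + 1)) ≤ (1 - y) ^ (-a - 1) :=
        Real.rpow_le_rpow_of_exponent_ge h4 (by linarith [hy.1]) (by linarith)
      have h6 : ((1 + y) ^ (β + 1))⁻¹ ≤ 1 :=
        inv_le_one_of_one_le₀ (Real.one_le_rpow (by linarith [hy.1]) (by linarith))
      calc _ ≤ (1 - y) ^ (-(α + 1)) * 1 := by
            gcongr
        _ ≤ _ := by rw [mul_one]; exact h5
  have h7 := hmono (a := 0) (b := x) ⟨le_rfl, by norm_num⟩ ⟨h0, h1⟩ h0
  simp only [sub_zero, Real.one_rpow, mul_one, jacobiSol_zero] at h7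
  have : 0 < a⁻¹ := inv_pos.2 ha
  linarith

/-- A function in `L²` that dominates all functions with the admissible endpoint behavior. -/
def endpointBound (a b : ℝ) (x : ℝ) : ℝ := (1 - x) ^ (-a) + (1 + x) ^ (-b)

lemma abs_jacobiSol_le (hα : 0 ≤ α) (hβ : 0 ≤ β) {a b : ℝ} (ha : 0 < a) (haα : α ≤ a)
    (hb : 0 < b) (hbβ : β ≤ b) {x : ℝ} (hx : x ∈ Ioo (-1 : ℝ) 1) :
    |jacobiSol α β x| ≤ (a⁻¹ + b⁻¹) * endpointBound a b x := by
  have p1 : 0 < (1 - x) ^ (-a) := Real.rpow_pos_of_pos (by linarith [hx.2]) _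
  have p2 : 0 < (1 + x) ^ (-b) := Real.rpow_pos_of_pos (by linarith [hx.1]) _
  have p3 : 0 < a⁻¹ := inv_pos.2 ha
  have p4 : 0 < b⁻¹ := inv_pos.2 hb
  have h0 : (0 : ℝ) ∈ Ioo (-1 : ℝ) 1 := by norm_num
  rw [endpointBound, add_mul, mul_add, mul_add]
  have q1 := mul_pos p3 p1
  have q2 := mul_pos p3 p2
  have q3 := mul_pos p4 p1
  have q4 := mul_pos p4 p2
  rcases le_total 0 x with h | h
  · have h1 := jacobiSol_strictMonoOn (α := α) (β := β) |>.monotoneOn h0 hx h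
    rw [jacobiSol_zero] at h1
    rw [abs_of_nonneg h1]
    linarith [jacobiSol_le hβ ha haα h hx.2]
  · have h1 := jacobiSol_strictMonoOn (α := α) (β := β) |>.monotoneOn hx h0 h
    rw [jacobiSol_zero] at h1
    rw [abs_of_nonpos h1]
    have h2 := jacobiSol_le hα hb hbβ (x := -x) (by linarith) (by linarith [hx.1])
    rw [jacobiSol_comp_neg, sub_neg_eq_add] at h2
    linarith

/-! ### Membership in the weighted `L²` space -/

lemma jacobiWeight_aemeasurable (α β : ℝ) :
    AEMeasurable (jacobiWeight α β) (volume.restrict (Ioo (-1) 1)) :=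
  (jacobiWeight_contDiffOn α β).continuousOn.aemeasurable measurableSet_Ioo

lemma integrable_jacobiMeasure_iff {E : Type*} [NormedAddCommGroup E] [NormedSpace ℝ E]
    {g : ℝ → E} : Integrable g (jacobiMeasure α β) ↔
      IntegrableOn (fun x => jacobiWeight α β x • g x) (Ioo (-1) 1) := by
  rw [jacobiMeasure, integrable_withDensity_iff_integrable_smul₀'
    (jacobiWeight_aemeasurable α β).ennreal_ofReal (by simp), IntegrableOn]
  refine integrable_congr ?_
  filter_upwards [ae_restrict_mem measurableSet_Ioo] with x hx
  rw [ENNReal.toReal_ofReal (jacobiWeight_pos α β hx).le]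

lemma setIntegral_jacobiMeasure {E : Type*} [NormedAddCommGroup E] [NormedSpace ℝ E]
    {g : ℝ → E} {s : Set ℝ} (hs : MeasurableSet s) (hsI : s ⊆ Ioo (-1) 1) :
    ∫ x in s, g x ∂(jacobiMeasure α β) = ∫ x in s, jacobiWeight α β x • g x := by
  rw [jacobiMeasure, restrict_withDensity hs, Measure.restrict_restrict hs, inter_eq_left.2 hsI,
    integral_withDensity_eq_integral_toReal_smul₀ _ (by simp)]
  · refine integral_congr_ae ?_
    filter_upwards [ae_restrict_mem hs] with x hx
    rw [ENNReal.toReal_ofReal (jacobiWeight_pos α β (hsI hx)).le]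
  · exact ((jacobiWeight_aemeasurable α β).mono_measure
      (Measure.restrict_mono hsI le_rfl)).ennreal_ofReal

lemma ae_mem_Ioo_jacobiMeasure : ∀ᵐ x ∂(jacobiMeasure α β), x ∈ Ioo (-1 : ℝ) 1 :=
  (jacobiMeasure_ac α β).ae_le (ae_restrict_mem measurableSet_Ioo)

lemma aestronglyMeasurable_of_continuousOn {E : Type*} [NormedAddCommGroup E]
    [SecondCountableTopology E] {g : ℝ → E}
    (hg : ContinuousOn g (Ioo (-1) 1)) : AEStronglyMeasurable g (jacobiMeasure α β) :=
  (hg.aestronglyMeasurable measurableSet_Ioo).mono_ac (jacobiMeasure_ac α β)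

lemma rpow_one_sub_continuousOn (s : ℝ) :
    ContinuousOn (fun x : ℝ => (1 - x) ^ s) (Ioo (-1) 1) := fun _ hx =>
  ((continuousAt_const.sub continuousAt_id).rpow_const
    (Or.inl (sub_pos.2 hx.2).ne')).continuousWithinAt

lemma rpow_one_add_continuousOn (s : ℝ) :
    ContinuousOn (fun x : ℝ => (1 + x) ^ s) (Ioo (-1) 1) := fun _ hx =>
  ((continuousAt_const.add continuousAt_id).rpow_const
    (Or.inl (neg_lt_iff_pos_add'.1 hx.1).ne')).continuousWithinAt

lemma memLp_rpow_one_sub (hβ : 0 ≤ β) {a : ℝ} (ha : 2 * a < 1 + α) :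
    MemLp (fun x : ℝ => (1 - x) ^ (-a)) 2 (jacobiMeasure α β) := by
  rw [memLp_two_iff_integrable_sq
    (aestronglyMeasurable_of_continuousOn (rpow_one_sub_continuousOn _)),
    integrable_jacobiMeasure_iff]
  have h1 : IntervalIntegrable (fun x : ℝ => (1 - x) ^ (α - 2 * a)) volume (-1) 1 := by
    have h2 := (intervalIntegral.intervalIntegrable_rpow' (r := α - 2 * a) (by linarith)
      (a := 2) (b := 0)).comp_sub_left 1
    norm_num at h2
    exact h2
  have h3 := h1.mul_continuousOn (g := fun x : ℝ => (1 + x) ^ β) (fun x _ =>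
    ((continuousAt_const.add continuousAt_id).rpow_const (Or.inr hβ)).continuousWithinAt)
  rw [intervalIntegrable_iff_integrableOn_Ioo_of_le (by norm_num)] at h3
  refine h3.congr_fun (fun x hx => ?_) measurableSet_Ioo
  have h4 : (0 : ℝ) < 1 - x := by linarith [hx.2]
  simp only [jacobiWeight, smul_eq_mul]
  rw [sub_eq_add_neg α, Real.rpow_add h4, ← Real.rpow_natCast, ← Real.rpow_mul h4.le]
  ring_nf

lemma memLp_rpow_one_add (hα : 0 ≤ α) {b : ℝ} (hb : 2 * b < 1 + β) :
    MemLp (fun x : ℝ => (1 + x) ^ (-b)) 2 (jacobiMeasure α β) := by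
  rw [memLp_two_iff_integrable_sq
    (aestronglyMeasurable_of_continuousOn (rpow_one_add_continuousOn _)),
    integrable_jacobiMeasure_iff]
  have h1 : IntervalIntegrable (fun x : ℝ => (1 + x) ^ (β - 2 * b)) volume (-1) 1 := by
    have h2 := (intervalIntegral.intervalIntegrable_rpow' (r := β - 2 * b) (by linarith)
      (a := 0) (b := 2)).comp_add_left 1
    norm_num at h2
    exact h2
  have h3 := h1.continuousOn_mul (g := fun x : ℝ => (1 - x) ^ α) (fun x _ =>
    ((continuousAt_const.sub continuousAt_id).rpow_const (Or.inr hα)).continuousWithinAt)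
  rw [intervalIntegrable_iff_integrableOn_Ioo_of_le (by norm_num)] at h3
  refine h3.congr_fun (fun x hx => ?_) measurableSet_Ioo
  have h4 : (0 : ℝ) < 1 + x := by linarith [hx.1]
  simp only [jacobiWeight, smul_eq_mul]
  rw [sub_eq_add_neg β, Real.rpow_add h4, ← Real.rpow_natCast, ← Real.rpow_mul h4.le]
  ring_nf

/-- The exponent half way between what the endpoint functions need and what `L²` allows. -/
def midExp (a : ℝ) : ℝ := (3 * a + 1) / 4

lemma memLp_endpointBound (hα : 0 ≤ α) (hα1 : α < 1) (hβ : 0 ≤ β) (hβ1 : β < 1) :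
    MemLp (endpointBound (midExp α) (midExp β)) 2 (jacobiMeasure α β) :=
  (memLp_rpow_one_sub hβ (by rw [midExp]; linarith)).add
    (memLp_rpow_one_add hα (by rw [midExp]; linarith))

lemma isFiniteMeasure_jacobiMeasure (hα : 0 ≤ α) (hβ : 0 ≤ β) :
    IsFiniteMeasure (jacobiMeasure α β) := by
  have h := memLp_rpow_one_sub hβ (α := α) (a := 0) (by linarith)
  simp only [neg_zero, Real.rpow_zero] at h
  rw [memLp_const_iff (by norm_num) (by norm_num)] at h
  exact ⟨by simpa using h⟩

lemma memLp_jacobiSol (hα : 0 ≤ α) (hα1 : α < 1) (hβ : 0 ≤ β) (hβ1 : β < 1) :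
    MemLp (jacobiSol α β) 2 (jacobiMeasure α β) := by
  refine (memLp_endpointBound hα hα1 hβ hβ1).of_le_mul (c := (midExp α)⁻¹ + (midExp β)⁻¹)
    (aestronglyMeasurable_of_continuousOn jacobiSol_contDiffOn.continuousOn) ?_
  filter_upwards [ae_mem_Ioo_jacobiMeasure] with x hx
  have p1 : 0 < (1 - x) ^ (-(midExp α)) := Real.rpow_pos_of_pos (by linarith [hx.2]) _
  have p2 : 0 < (1 + x) ^ (-(midExp β)) := Real.rpow_pos_of_pos (by linarith [hx.1]) _
  rw [Real.norm_eq_abs, Real.norm_eq_abs, abs_of_pos (a := endpointBound _ _ x) (add_pos p1 p2)]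
  exact abs_jacobiSol_le hα hβ (by rw [midExp]; linarith) (by rw [midExp]; linarith)
    (by rw [midExp]; linarith) (by rw [midExp]; linarith) hx

end

/-! ### The Green function of a self-adjoint realization of `ℓ` -/

/-- Both endpoints are in the limit circle case. -/
structure AdmissibleParams (α β : ℝ) : Prop where
  left_nonneg : 0 ≤ α
  left_lt : α < 1
  right_nonneg : 0 ≤ β
  right_lt : β < 1

/-- The integral operator whose kernel is the Green function `min (q x) (q t)`. -/
def jacobiInv (α β : ℝ) (v : ℝ → ℂ) (x : ℝ) : ℂ :=
  ∫ t, min (jacobiSol α β x) (jacobiSol α β t) • v t ∂(jacobiMeasure α β)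

lemma abs_min_sub_min_le (a b c : ℝ) : |min a c - min b c| ≤ |a - b| := by
  refine (abs_min_sub_min_le_max a c b c).trans ?_
  simp

lemma abs_min_le_add (a b : ℝ) : |min a b| ≤ |a| + |b| := by
  rcases min_choice a b with h | h <;> rw [h]
  · linarith [abs_nonneg b]
  · linarith [abs_nonneg a]

section

variable {α β : ℝ} {v : ℝ → ℂ}

lemma jacobiSol_aestronglyMeasurable :
    AEStronglyMeasurable (jacobiSol α β) (jacobiMeasure α β) :=
  aestronglyMeasurable_of_continuousOn jacobiSol_contDiffOn.continuousOn

lemma aestronglyMeasurable_min_jacobiSol (c : ℝ) :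
    AEStronglyMeasurable (fun t => min c (jacobiSol α β t)) (jacobiMeasure α β) :=
  aestronglyMeasurable_const.inf jacobiSol_aestronglyMeasurable

namespace AdmissibleParams

lemma memLp_sol (hp : AdmissibleParams α β) : MemLp (jacobiSol α β) 2 (jacobiMeasure α β) :=
  memLp_jacobiSol hp.1 hp.2 hp.3 hp.4

lemma memLp_const (hp : AdmissibleParams α β) (c : ℂ) :
    MemLp (fun _ => c) 2 (jacobiMeasure α β) := by
  have := isFiniteMeasure_jacobiMeasure hp.1 hp.3
  exact MeasureTheory.memLp_const c

lemma memLp_sol_ofReal (hp : AdmissibleParams α β) :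
    MemLp (fun x => (jacobiSol α β x : ℂ)) 2 (jacobiMeasure α β) := hp.memLp_sol.ofReal

lemma integrable (hp : AdmissibleParams α β) (hv : MemLp v 2 (jacobiMeasure α β)) :
    Integrable v (jacobiMeasure α β) := by
  have := isFiniteMeasure_jacobiMeasure hp.1 hp.3
  exact hv.integrable (by norm_num)

lemma integrable_sol_smul (hp : AdmissibleParams α β) (hv : MemLp v 2 (jacobiMeasure α β)) :
    Integrable (fun t => jacobiSol α β t • v t) (jacobiMeasure α β) := by
  have := MemLp.smul (p := 2) (q := 2) (r := 1) hv hp.memLp_sol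
  exact memLp_one_iff_integrable.1 this

lemma integrable_kernel_smul (hp : AdmissibleParams α β) (hv : MemLp v 2 (jacobiMeasure α β))
    (c : ℝ) : Integrable (fun t => min c (jacobiSol α β t) • v t) (jacobiMeasure α β) := by
  refine (((hp.integrable hv).norm.const_mul |c|).add (hp.integrable_sol_smul hv).norm).mono'
    ((aestronglyMeasurable_min_jacobiSol c).smul hv.1) (Eventually.of_forall fun t => ?_)
  simp only [Pi.add_apply, norm_smul, Real.norm_eq_abs]
  rw [← add_mul]
  gcongr
  exact abs_min_le_add _ _

lemma norm_jacobiInv_le (hp : AdmissibleParams α β) (hv : MemLp v 2 (jacobiMeasure α β)) (x : ℝ) :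
    ‖jacobiInv α β v x‖ ≤ |jacobiSol α β x| * (∫ t, ‖v t‖ ∂(jacobiMeasure α β)) +
      ∫ t, ‖jacobiSol α β t • v t‖ ∂(jacobiMeasure α β) := by
  refine (norm_integral_le_integral_norm _).trans ?_
  rw [← integral_const_mul, ← integral_add ((hp.integrable hv).norm.const_mul _)
    (hp.integrable_sol_smul hv).norm]
  refine integral_mono (hp.integrable_kernel_smul hv _).norm
    (((hp.integrable hv).norm.const_mul _).add (hp.integrable_sol_smul hv).norm) fun t => ?_
  simp only [norm_smul, Real.norm_eq_abs]
  rw [← add_mul]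
  gcongr
  exact abs_min_le_add _ _

lemma jacobiInv_hasDerivAt (hp : AdmissibleParams α β) (hv : MemLp v 2 (jacobiMeasure α β))
    {x : ℝ} (hx : x ∈ Ioo (-1 : ℝ) 1) :
    HasDerivAt (jacobiInv α β v)
      ((jacobiWeight (α + 1) (β + 1) x)⁻¹ • ∫ t in Ioi x, v t ∂(jacobiMeasure α β)) x := by
  have hsol : ContDiffAt ℝ 1 (jacobiSol α β) x :=
    ((jacobiSol_contDiffOn (α := α) (β := β)).contDiffAt (isOpen_Ioo.mem_nhds hx)).of_le (by simp)
  obtain ⟨K, s, hs, hK⟩ := hsol.exists_lipschitzOnWith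
  have hvol : ∀ᵐ t ∂(jacobiMeasure α β), t ≠ x := by
    refine (jacobiMeasure_ac α β).ae_le (ae_restrict_of_ae ?_)
    simp [ae_iff]
  have hlip : ∀ t, LipschitzOnWith (Real.nnabs (K * ‖v t‖))
      (fun x => min (jacobiSol α β x) (jacobiSol α β t) • v t) s := by
    refine fun t => LipschitzOnWith.of_dist_le_mul fun y hy z hz => ?_
    have h1 := hK.dist_le_mul y hy z hz
    rw [dist_eq_norm, ← sub_smul, norm_smul, Real.norm_eq_abs, Real.coe_nnabs,
      abs_of_nonneg (a := K * ‖v t‖) (by positivity), mul_right_comm]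
    gcongr
    exact (abs_min_sub_min_le _ _ _).trans h1
  have hdiff : ∀ᵐ t ∂(jacobiMeasure α β),
      HasDerivAt (fun x => min (jacobiSol α β x) (jacobiSol α β t) • v t)
        ((Ioi x).indicator (fun t => (jacobiWeight (α + 1) (β + 1) x)⁻¹ • v t) t) x := by
    filter_upwards [hvol, ae_mem_Ioo_jacobiMeasure] with t ht htI
    have hcont := (jacobiSol_hasDerivAt (α := α) (β := β) hx).continuousAt
    rcases lt_or_gt_of_ne ht with htx | htx
    · rw [indicator_of_notMem (by simpa using htx.le)]
      have h1 := jacobiSol_strictMonoOn (α := α) (β := β) htI hx htx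
      refine (hasDerivAt_const x (jacobiSol α β t • v t)).congr_of_eventuallyEq ?_
      filter_upwards [hcont.eventually (lt_mem_nhds h1)] with y hy
      rw [min_eq_right hy.le]
    · rw [indicator_of_mem (by simpa using htx)]
      have h1 := jacobiSol_strictMonoOn (α := α) (β := β) hx htI htx
      refine ((jacobiSol_hasDerivAt (α := α) (β := β) hx).smul_const (v t)).congr_of_eventuallyEq ?_
      filter_upwards [hcont.eventually (gt_mem_nhds h1)] with y hy
      rw [min_eq_left hy.le]
  have hint : Integrable (fun t => K * ‖v t‖) (jacobiMeasure α β) :=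
    (hp.integrable hv).norm.const_mul _
  have hmeas' : AEStronglyMeasurable (fun t => (jacobiWeight (α + 1) (β + 1) x)⁻¹ • v t)
      (jacobiMeasure α β) :=
    hv.1.const_smul (jacobiWeight (α + 1) (β + 1) x)⁻¹
  have hmeas := hmeas'.indicator (measurableSet_Ioi (a := x))
  have h := (hasDerivAt_integral_of_dominated_loc_of_lip hs
    (Eventually.of_forall fun y => (hp.integrable_kernel_smul hv (jacobiSol α β y)).1)
    (hp.integrable_kernel_smul hv (jacobiSol α β x)) hmeas (Eventually.of_forall hlip) hint hdiff).2
  rw [integral_indicator measurableSet_Ioi, integral_smul] at h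
  exact h

lemma jacobiInv_continuousOn (hp : AdmissibleParams α β) (hv : MemLp v 2 (jacobiMeasure α β)) :
    ContinuousOn (jacobiInv α β v) (Ioo (-1) 1) := fun _ hx =>
  (hp.jacobiInv_hasDerivAt hv hx).continuousAt.continuousWithinAt

lemma memLp_jacobiInv (hp : AdmissibleParams α β) (hv : MemLp v 2 (jacobiMeasure α β)) :
    MemLp (jacobiInv α β v) 2 (jacobiMeasure α β) := by
  have h1 := (hp.memLp_sol.norm.mul_const (∫ t, ‖v t‖ ∂(jacobiMeasure α β))).add
    (hp.memLp_const (∫ t, ‖jacobiSol α β t • v t‖ ∂(jacobiMeasure α β) : ℝ)).norm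
  refine h1.mono' (aestronglyMeasurable_of_continuousOn (hp.jacobiInv_continuousOn hv))
    (Eventually.of_forall fun x => (hp.norm_jacobiInv_le hv x).trans_eq ?_)
  simp only [Pi.add_apply, Complex.norm_real, Real.norm_eq_abs]
  congr 1
  exact (abs_of_nonneg (integral_nonneg fun _ => norm_nonneg _)).symm

lemma inner_jacobiInv (hp : AdmissibleParams α β) {u : ℝ → ℂ}
    (hu : MemLp u 2 (jacobiMeasure α β)) (hv : MemLp v 2 (jacobiMeasure α β)) :
    ∫ x, inner ℂ (jacobiInv α β u x) (v x) ∂(jacobiMeasure α β) =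
      ∫ x, inner ℂ (u x) (jacobiInv α β v x) ∂(jacobiMeasure α β) := by
  have := isFiniteMeasure_jacobiMeasure hp.1 hp.3
  have e1 : ∀ x, inner ℂ (jacobiInv α β u x) (v x) = ∫ t,
      min (jacobiSol α β x) (jacobiSol α β t) • inner ℂ (u t) (v x) ∂(jacobiMeasure α β) := by
    intro x
    rw [jacobiInv, ← inner_conj_symm, ← integral_inner (hp.integrable_kernel_smul hu _),
      ← integral_conj]
    refine integral_congr_ae (Eventually.of_forall fun t => ?_)
    simp only [inner_conj_symm]
    exact inner_smul_left_eq_smul _ _ _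
  have e2 : ∀ t, inner ℂ (u t) (jacobiInv α β v t) = ∫ x,
      min (jacobiSol α β x) (jacobiSol α β t) • inner ℂ (u t) (v x) ∂(jacobiMeasure α β) := by
    intro t
    rw [jacobiInv, ← integral_inner (hp.integrable_kernel_smul hv _)]
    refine integral_congr_ae (Eventually.of_forall fun x => ?_)
    simp only [min_comm (jacobiSol α β x)]
    exact inner_smul_right_eq_smul _ _ _
  simp_rw [e1, e2]
  refine integral_integral_swap ?_
  have hq := jacobiSol_aestronglyMeasurable (α := α) (β := β)
  refine (((hp.integrable hv).norm.mul_prod (hp.integrable_sol_smul hu).norm).add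
    ((hp.integrable_sol_smul hv).norm.mul_prod (hp.integrable hu).norm)).mono'
    ((hq.comp_fst.inf hq.comp_snd).smul (hu.1.comp_snd.inner hv.1.comp_fst))
    (Eventually.of_forall fun z => ?_)
  simp only [Function.uncurry, Pi.add_apply, norm_smul, Real.norm_eq_abs]
  calc _ ≤ (|jacobiSol α β z.1| + |jacobiSol α β z.2|) * (‖u z.2‖ * ‖v z.1‖) := by
        gcongr
        · exact abs_min_le_add _ _
        · exact norm_inner_le_norm _ _
    _ = _ := by ring

end AdmissibleParams

end

/-! ### The differential equation `ℓ[K v] = v` and uniqueness -/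

section

variable {α β : ℝ} {v : ℝ → ℂ}

/-- The quasi-derivative `(1 - x)^(α+1) (1 + x)^(β+1) (K v)'`. -/
def jacobiTail (α β : ℝ) (v : ℝ → ℂ) (x : ℝ) : ℂ := ∫ t in Ioi x, v t ∂(jacobiMeasure α β)

namespace AdmissibleParams

lemma integrableOn_weight_smul (hp : AdmissibleParams α β) (hv : MemLp v 2 (jacobiMeasure α β)) :
    IntegrableOn (fun t => jacobiWeight α β t • v t) (Ioo (-1) 1) :=
  integrable_jacobiMeasure_iff.1 (hp.integrable hv)

lemma jacobiTail_eq (hp : AdmissibleParams α β) (hv : MemLp v 2 (jacobiMeasure α β))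
    {x : ℝ} (hx : x ∈ Ioo (-1 : ℝ) 1) :
    jacobiTail α β v x = jacobiTail α β v 0 - ∫ t in (0 : ℝ)..x, jacobiWeight α β t • v t := by
  have h0 : (0 : ℝ) ∈ Ioo (-1 : ℝ) 1 := by norm_num
  have h1 : ∀ a ∈ Ioo (-1 : ℝ) 1, ∀ b ∈ Ioo (-1 : ℝ) 1,
      ∫ t in Ioc a b, v t ∂(jacobiMeasure α β) = ∫ t in Ioc a b, jacobiWeight α β t • v t :=
    fun a ha b hb => setIntegral_jacobiMeasure measurableSet_Ioc fun t ht =>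
      ⟨ha.1.trans ht.1, ht.2.trans_lt hb.2⟩
  have h2 := intervalIntegral.integral_interval_add_Ioi (a := 0) (b := x) (f := v)
    (μ := jacobiMeasure α β) (hp.integrable hv).integrableOn (hp.integrable hv).integrableOn
  rw [intervalIntegral, h1 0 h0 x hx, h1 x hx 0 h0] at h2
  rw [jacobiTail, jacobiTail, ← h2, intervalIntegral]
  ring

lemma jacobiTail_locAC (hp : AdmissibleParams α β) (hv : MemLp v 2 (jacobiMeasure α β)) :
    LocAC 0 (jacobiTail α β v) := by
  have h1 : LocAC 0 (fun x => ∫ t in (0 : ℝ)..x, jacobiWeight α β t • v t) := by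
    refine locAC_zero_integral (fun a ha b hb => ?_) (by norm_num)
    exact ((hp.integrableOn_weight_smul hv).mono_set
      (uIcc_subset_Ioo_jacobi ha hb)).intervalIntegrable
  refine ((locAC_of_contDiffOn (f := fun _ => jacobiTail α β v 0) contDiffOn_const).add
    (h1.const_smul (-1))).congr fun x hx => ?_
  rw [hp.jacobiTail_eq hv hx]
  simp [sub_eq_add_neg]

lemma jacobiTail_ae_hasDerivAt (hp : AdmissibleParams α β)
    (hv : MemLp v 2 (jacobiMeasure α β)) : ∀ᵐ x ∂volume.restrict (Ioo (-1 : ℝ) 1),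
      HasDerivAt (jacobiTail α β v) (-(jacobiWeight α β x • v x)) x := by
  have h1 : IntervalIntegrable (fun t => jacobiWeight α β t • v t) volume (-1) 1 :=
    (intervalIntegrable_iff_integrableOn_Ioo_of_le (by norm_num)).2 (hp.integrableOn_weight_smul hv)
  rw [ae_restrict_iff' measurableSet_Ioo]
  filter_upwards [h1.ae_hasDerivAt_integral] with x hx hxI
  have h2 := hx (by rw [uIcc_of_le (by norm_num)]; exact Ioo_subset_Icc_self hxI) 0
    (by rw [uIcc_of_le (by norm_num)]; norm_num)
  refine (h2.const_sub (jacobiTail α β v 0)).congr_of_eventuallyEq ?_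
  filter_upwards [isOpen_Ioo.mem_nhds hxI] with y hy using hp.jacobiTail_eq hv hy

lemma jacobiTail_hasDerivAt (hp : AdmissibleParams α β) (hv : MemLp v 2 (jacobiMeasure α β))
    (hvc : ContinuousOn v (Ioo (-1) 1)) {x : ℝ} (hx : x ∈ Ioo (-1 : ℝ) 1) :
    HasDerivAt (jacobiTail α β v) (-(jacobiWeight α β x • v x)) x := by
  have h0 : (0 : ℝ) ∈ Ioo (-1 : ℝ) 1 := by norm_num
  have hc : ContinuousOn (fun t => jacobiWeight α β t • v t) (Ioo (-1) 1) :=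
    (jacobiWeight_contDiffOn α β).continuousOn.smul hvc
  have h1 : HasDerivAt (fun x => ∫ t in (0 : ℝ)..x, jacobiWeight α β t • v t)
      (jacobiWeight α β x • v x) x := by
    refine intervalIntegral.integral_hasDerivAt_right ?_ ?_ ?_
    · exact (hc.mono (uIcc_subset_Ioo_jacobi h0 hx)).intervalIntegrable
    · exact hc.stronglyMeasurableAtFilter isOpen_Ioo x hx
    · exact hc.continuousAt (isOpen_Ioo.mem_nhds hx)
  refine (h1.const_sub (jacobiTail α β v 0)).congr_of_eventuallyEq ?_
  filter_upwards [isOpen_Ioo.mem_nhds hx] with y hy using hp.jacobiTail_eq hv hy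

lemma deriv_jacobiInv (hp : AdmissibleParams α β) (hv : MemLp v 2 (jacobiMeasure α β)) :
    EqOn (deriv (jacobiInv α β v))
      (fun x => (jacobiWeight (α + 1) (β + 1) x)⁻¹ • jacobiTail α β v x) (Ioo (-1) 1) :=
  fun _ hx => (hp.jacobiInv_hasDerivAt hv hx).deriv

lemma jacobiInv_locAC_of_tail (hp : AdmissibleParams α β) (hv : MemLp v 2 (jacobiMeasure α β))
    {k : ℕ} (h : LocAC k (jacobiTail α β v)) : LocAC (k + 1) (jacobiInv α β v) := by
  refine locAC_succ_iff.2 ⟨fun x hx =>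
    (hp.jacobiInv_hasDerivAt hv hx).differentiableAt.differentiableWithinAt, ?_⟩
  exact (LocAC.smul (jacobiWeight_inv_contDiffOn _ _) h).congr (hp.deriv_jacobiInv hv).symm

lemma jacobiInv_locAC_one (hp : AdmissibleParams α β) (hv : MemLp v 2 (jacobiMeasure α β)) :
    LocAC 1 (jacobiInv α β v) := hp.jacobiInv_locAC_of_tail hv (hp.jacobiTail_locAC hv)

lemma jacobiInv_locAC (hp : AdmissibleParams α β) (hv : MemLp v 2 (jacobiMeasure α β))
    {k : ℕ} (h : LocAC k v) : LocAC (k + 2) (jacobiInv α β v) := by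
  refine hp.jacobiInv_locAC_of_tail hv (locAC_succ_iff.2 ⟨fun x hx =>
    (hp.jacobiTail_hasDerivAt hv h.continuousOn hx).differentiableAt.differentiableWithinAt, ?_⟩)
  refine (LocAC.smul (jacobiWeight_contDiffOn α β).neg h).congr fun x hx => ?_
  rw [(hp.jacobiTail_hasDerivAt hv h.continuousOn hx).deriv]
  simp

lemma jacobiExpr_jacobiInv_of_hasDerivAt (hp : AdmissibleParams α β)
    (hv : MemLp v 2 (jacobiMeasure α β)) {x : ℝ} (hx : x ∈ Ioo (-1 : ℝ) 1)
    (h : HasDerivAt (jacobiTail α β v) (-(jacobiWeight α β x • v x)) x) :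
    jacobiExpr α β (jacobiInv α β v) x = v x := by
  have h1 : (fun y => jacobiWeight (α + 1) (β + 1) y • deriv (jacobiInv α β v) y) =ᶠ[𝓝 x]
      jacobiTail α β v := by
    filter_upwards [isOpen_Ioo.mem_nhds hx] with y hy
    rw [hp.deriv_jacobiInv hv hy, smul_smul, mul_inv_cancel₀ (jacobiWeight_pos _ _ hy).ne', one_smul]
  rw [jacobiExpr, h1.deriv_eq, h.deriv, smul_neg, neg_neg, smul_smul,
    inv_mul_cancel₀ (jacobiWeight_pos _ _ hx).ne', one_smul]

lemma jacobiExpr_jacobiInv_ae (hp : AdmissibleParams α β) (hv : MemLp v 2 (jacobiMeasure α β)) :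
    jacobiExpr α β (jacobiInv α β v) =ᵐ[volume.restrict (Ioo (-1 : ℝ) 1)] v := by
  filter_upwards [hp.jacobiTail_ae_hasDerivAt hv, ae_restrict_mem measurableSet_Ioo] with x h hx
  exact hp.jacobiExpr_jacobiInv_of_hasDerivAt hv hx h

lemma jacobiExpr_jacobiInv (hp : AdmissibleParams α β) (hv : MemLp v 2 (jacobiMeasure α β))
    (hvc : ContinuousOn v (Ioo (-1) 1)) :
    EqOn (jacobiExpr α β (jacobiInv α β v)) v (Ioo (-1) 1) := fun _ hx =>
  hp.jacobiExpr_jacobiInv_of_hasDerivAt hv hx (hp.jacobiTail_hasDerivAt hv hvc hx)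

end AdmissibleParams

lemma LocAC.ae_diffOrd {f : ℝ → ℂ} (hf : LocAC 1 f) :
    ∀ᵐ x ∂(volume.restrict (Ioo (-1 : ℝ) 1)), DiffOrd x 1 f :=
  JacobiRegular.ae_diffOrd (n := 1) hf

/-- Two functions with the same `ℓ[f]` differ by a solution of `ℓ[f] = 0`. -/
lemma exists_eq_add_sol {f u : ℝ → ℂ} (hf : LocAC 1 f) (hu : LocAC 1 u)
    (h : jacobiExpr α β f =ᵐ[volume.restrict (Ioo (-1 : ℝ) 1)] jacobiExpr α β u) :
    ∃ c d : ℂ, ∀ x ∈ Ioo (-1 : ℝ) 1, f x = u x + (c + d * jacobiSol α β x) := by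
  have h0 : (0 : ℝ) ∈ Ioo (-1 : ℝ) 1 := by norm_num
  have hf' := locAC_succ_iff.1 hf
  have hu' := locAC_succ_iff.1 hu
  have hw := jacobiWeight_contDiffOn (α + 1) (β + 1)
  have hP : LocAC 0 (fun x => jacobiWeight (α + 1) (β + 1) x • (deriv f + (-1 : ℂ) • deriv u) x) :=
    LocAC.smul hw (hf'.2.add (hu'.2.const_smul (-1)))
  have hP0 := hP.eqOn_const (by
    filter_upwards [hf.ae_diffOrd, hu.ae_diffOrd, h, ae_restrict_mem measurableSet_Ioo]
      with x h1 h2 h3 hx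
    have hwx := jacobiWeight_contDiffAt (α + 1) (β + 1) hx
    have d1 := DiffOrd.smul hwx h1.2
    have d2 := DiffOrd.smul hwx h2.2
    have h4 : deriv (fun y => jacobiWeight (α + 1) (β + 1) y • deriv f y) x =
        deriv (fun y => jacobiWeight (α + 1) (β + 1) y • deriv u y) x := by
      simp only [jacobiExpr, neg_inj] at h3
      exact smul_right_injective ℂ (inv_pos.2 (jacobiWeight_pos α β hx)).ne' h3
    have h5 := d1.hasDerivAt.sub d2.hasDerivAt
    rw [h4, sub_self] at h5
    refine h5.congr_of_eventuallyEq (Eventually.of_forall fun y => ?_)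
    simp [sub_eq_add_neg])
  set d : ℂ := jacobiWeight (α + 1) (β + 1) 0 • (deriv f + (-1 : ℂ) • deriv u) 0 with hd
  have hder : ∀ x ∈ Ioo (-1 : ℝ) 1,
      HasDerivAt (fun x => f x - u x - d * jacobiSol α β x) 0 x := by
    intro x hx
    have hn := isOpen_Ioo.mem_nhds hx
    have h1 := ((hf'.1.differentiableAt hn).hasDerivAt.sub (hu'.1.differentiableAt hn).hasDerivAt).sub
      ((jacobiSol_hasDerivAt (α := α) (β := β) hx).ofReal_comp.const_mul d)
    have h2 : jacobiWeight (α + 1) (β + 1) x • (deriv f + (-1 : ℂ) • deriv u) x = d := hP0 x hx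
    have hne : (jacobiWeight (α + 1) (β + 1) x : ℂ) ≠ 0 :=
      Complex.ofReal_ne_zero.2 (jacobiWeight_pos _ _ hx).ne'
    have h3 : deriv f x - deriv u x - d * ((jacobiWeight (α + 1) (β + 1) x)⁻¹ : ℝ) = 0 := by
      rw [← h2]
      simp only [Pi.add_apply, Pi.smul_apply, Complex.real_smul, smul_eq_mul, Complex.ofReal_inv]
      field_simp
      ring
    rw [h3] at h1
    exact h1
  refine ⟨f 0 - u 0, d, fun x hx => ?_⟩
  have h1 := (convex_Ioo (-1 : ℝ) 1).is_const_of_fderivWithin_eq_zero (𝕜 := ℝ)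
    (f := fun x => f x - u x - d * jacobiSol α β x)
    (fun y hy => (hder y hy).differentiableAt.differentiableWithinAt) (fun y hy => ?_) hx h0
  · simp only [jacobiSol_zero, Complex.ofReal_zero, mul_zero, sub_zero] at h1
    linear_combination h1
  · have := (hder y hy).hasFDerivAt.hasFDerivWithinAt (s := Ioo (-1 : ℝ) 1)
    rw [this.fderivWithin (isOpen_Ioo.uniqueDiffWithinAt hy)]
    ext
    simp

end

/-! ### The graph of the maximal operator -/

section

variable {α β : ℝ}

namespace AdmissibleParams

/-- The integral operator with the Green function as kernel, on `L²`. -/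
def invLinear (hp : AdmissibleParams α β) : JacobiL2 α β →ₗ[ℂ] JacobiL2 α β where
  toFun F := (hp.memLp_jacobiInv (Lp.memLp F)).toLp _
  map_add' F G := by
    rw [← MemLp.toLp_add]
    refine MemLp.toLp_congr _ _ (Eventually.of_forall fun x => ?_)
    simp only [jacobiInv, Pi.add_apply]
    rw [← integral_add (hp.integrable_kernel_smul (Lp.memLp F) _)
      (hp.integrable_kernel_smul (Lp.memLp G) _)]
    refine integral_congr_ae ?_
    filter_upwards [Lp.coeFn_add F G] with t ht
    rw [ht, Pi.add_apply, smul_add]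
  map_smul' c F := by
    rw [RingHom.id_apply, ← MemLp.toLp_const_smul]
    refine MemLp.toLp_congr _ _ (Eventually.of_forall fun x => ?_)
    simp only [jacobiInv, Pi.smul_apply]
    rw [← integral_smul]
    refine integral_congr_ae ?_
    filter_upwards [Lp.coeFn_smul c F] with t ht
    rw [ht, Pi.smul_apply, smul_comm]

lemma invLinear_isSymmetric (hp : AdmissibleParams α β) : hp.invLinear.IsSymmetric := by
  intro F G
  rw [L2.inner_def, L2.inner_def]
  refine (integral_congr_ae ?_).trans ((hp.inner_jacobiInv (Lp.memLp F) (Lp.memLp G)).trans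
    (integral_congr_ae ?_))
  · filter_upwards [(hp.memLp_jacobiInv (Lp.memLp F)).coeFn_toLp] with x hx
    rw [← hx]
    rfl
  · filter_upwards [(hp.memLp_jacobiInv (Lp.memLp G)).coeFn_toLp] with x hx
    rw [← hx]
    rfl

/-- The bounded self-adjoint inverse of a realization of `ℓ`. -/
def inv (hp : AdmissibleParams α β) : JacobiL2 α β →L[ℂ] JacobiL2 α β :=
  ⟨hp.invLinear, hp.invLinear_isSymmetric.continuous⟩

lemma inv_isSymmetric (hp : AdmissibleParams α β) : (hp.inv : JacobiL2 α β →ₗ[ℂ] JacobiL2 α β).IsSymmetric :=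
  hp.invLinear_isSymmetric

lemma inv_pow_isSymmetric (hp : AdmissibleParams α β) (n : ℕ) :
    ((hp.inv ^ n : JacobiL2 α β →L[ℂ] JacobiL2 α β) : JacobiL2 α β →ₗ[ℂ] JacobiL2 α β).IsSymmetric :=
  ContinuousLinearMap.isSelfAdjoint_iff_isSymmetric.1
    ((ContinuousLinearMap.isSelfAdjoint_iff_isSymmetric.2 hp.inv_isSymmetric).pow n)

lemma inv_toLp (hp : AdmissibleParams α β) {v : ℝ → ℂ} (hv : MemLp v 2 (jacobiMeasure α β)) :
    hp.inv (hv.toLp v) = (hp.memLp_jacobiInv hv).toLp _ := by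
  refine MemLp.toLp_congr (hp.memLp_jacobiInv (Lp.memLp _)) _ (Eventually.of_forall fun x => ?_)
  refine integral_congr_ae ?_
  filter_upwards [hv.coeFn_toLp] with t ht
  rw [ht]

lemma inv_coeFn (hp : AdmissibleParams α β) (F : JacobiL2 α β) :
    hp.inv F =ᵐ[jacobiMeasure α β] jacobiInv α β F :=
  (hp.memLp_jacobiInv (Lp.memLp F)).coeFn_toLp

/-- The constant function `1` in `L²`. -/
def one (hp : AdmissibleParams α β) : JacobiL2 α β := (hp.memLp_const 1).toLp _

/-- The second solution of `ℓ[f] = 0` in `L²`. -/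
def sol (hp : AdmissibleParams α β) : JacobiL2 α β := hp.memLp_sol_ofReal.toLp _

/-- The solutions of `ℓⁿ[f] = 0`. -/
def solSpace (hp : AdmissibleParams α β) : ℕ → Submodule ℂ (JacobiL2 α β)
  | 0 => ⊥
  | n + 1 => (hp.solSpace n).map (hp.inv : JacobiL2 α β →ₗ[ℂ] JacobiL2 α β) ⊔ Submodule.span ℂ {hp.one, hp.sol}

lemma finiteDimensional_solSpace (hp : AdmissibleParams α β) :
    ∀ n, FiniteDimensional ℂ (hp.solSpace n) ∧ Module.finrank ℂ (hp.solSpace n) ≤ 2 * n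
  | 0 => ⟨inferInstanceAs (FiniteDimensional ℂ (⊥ : Submodule ℂ (JacobiL2 α β))), by
      rw [solSpace, finrank_bot]⟩
  | n + 1 => by
    obtain ⟨h1, h2⟩ := hp.finiteDimensional_solSpace n
    have h3 : FiniteDimensional ℂ (Submodule.span ℂ {hp.one, hp.sol}) :=
      FiniteDimensional.span_of_finite ℂ (Set.toFinite _)
    have h4 : Module.finrank ℂ (Submodule.span ℂ {hp.one, hp.sol}) ≤ 2 := by
      classical
      have := finrank_span_finset_le_card (R := ℂ) ({hp.one, hp.sol} : Finset (JacobiL2 α β))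
      rw [Finset.coe_pair] at this
      exact this.trans Finset.card_le_two
    refine ⟨Submodule.finiteDimensional_sup _ _, ?_⟩
    have h5 := Submodule.finrank_add_le_finrank_add_finrank
      ((hp.solSpace n).map (hp.inv : JacobiL2 α β →ₗ[ℂ] JacobiL2 α β)) (Submodule.span ℂ {hp.one, hp.sol})
    have h6 := Submodule.finrank_map_le (hp.inv : JacobiL2 α β →ₗ[ℂ] JacobiL2 α β) (hp.solSpace n)
    rw [solSpace]
    omega

lemma exists_of_mem_span (hp : AdmissibleParams α β) {z : JacobiL2 α β}
    (hz : z ∈ Submodule.span ℂ {hp.one, hp.sol}) : ∃ c d : ℂ,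
      z =ᵐ[jacobiMeasure α β] fun x => c + d * jacobiSol α β x := by
  obtain ⟨c, d, rfl⟩ := Submodule.mem_span_pair.1 hz
  refine ⟨c, d, ?_⟩
  filter_upwards [Lp.coeFn_add (c • hp.one) (d • hp.sol), Lp.coeFn_smul c hp.one,
    Lp.coeFn_smul d hp.sol, (hp.memLp_const 1).coeFn_toLp, hp.memLp_sol_ofReal.coeFn_toLp]
    with x h1 h2 h3 h4 h5
  rw [h1, Pi.add_apply, h2, h3, Pi.smul_apply, Pi.smul_apply, one, sol, h4, h5]
  simp

lemma mem_span_of_ae_eq (hp : AdmissibleParams α β) {z : JacobiL2 α β} {c d : ℂ}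
    (hz : z =ᵐ[jacobiMeasure α β] fun x => c + d * jacobiSol α β x) :
    z ∈ Submodule.span ℂ {hp.one, hp.sol} := by
  refine Submodule.mem_span_pair.2 ⟨c, d, Lp.ext ?_⟩
  filter_upwards [Lp.coeFn_add (c • hp.one) (d • hp.sol), Lp.coeFn_smul c hp.one,
    Lp.coeFn_smul d hp.sol, (hp.memLp_const 1).coeFn_toLp, hp.memLp_sol_ofReal.coeFn_toLp, hz]
    with x h1 h2 h3 h4 h5 h6
  rw [h1, Pi.add_apply, h2, h3, Pi.smul_apply, Pi.smul_apply, one, sol, h4, h5, h6]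
  simp

/-- The general solution of `ℓ[f] = v` in terms of the Green function. -/
lemma sub_inv_mem_span (hp : AdmissibleParams α β) {f : ℝ → ℂ} {V : JacobiL2 α β}
    (hf : LocAC 1 f) (h : jacobiExpr α β f =ᵐ[jacobiMeasure α β] V) :
    ∃ hm : MemLp f 2 (jacobiMeasure α β),
      hm.toLp f - hp.inv V ∈ Submodule.span ℂ {hp.one, hp.sol} := by
  have hV := Lp.memLp V
  obtain ⟨c, d, hcd⟩ := exists_eq_add_sol hf (hp.jacobiInv_locAC_one hV)
    (((jacobiMeasure_ac' α β).ae_eq h).trans (hp.jacobiExpr_jacobiInv_ae hV).symm)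
  have hcd' : f =ᵐ[jacobiMeasure α β]
      jacobiInv α β V + fun x => (c + d * jacobiSol α β x) := by
    filter_upwards [ae_mem_Ioo_jacobiMeasure] with x hx using hcd x hx
  have hm : MemLp f 2 (jacobiMeasure α β) := (memLp_congr_ae hcd').2 ((hp.memLp_jacobiInv hV).add
    ((hp.memLp_const c).add (hp.memLp_sol_ofReal.const_mul d)))
  refine ⟨hm, hp.mem_span_of_ae_eq (c := c) (d := d) ?_⟩
  filter_upwards [Lp.coeFn_sub (hm.toLp f) (hp.inv V), hm.coeFn_toLp, hp.inv_coeFn V, hcd']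
    with x h1 h2 h3 h4
  rw [h1, Pi.sub_apply, h2, h3, h4]
  simp

lemma sub_inv_pow_mem_solSpace (hp : AdmissibleParams α β) : ∀ {n : ℕ} {f : ℝ → ℂ}
    {G : JacobiL2 α β}, JacobiRegular (n + 1) f →
    jacobiPow α β (n + 1) f =ᵐ[jacobiMeasure α β] G → ∃ hm : MemLp f 2 (jacobiMeasure α β),
      hm.toLp f - (hp.inv ^ (n + 1)) G ∈ hp.solSpace (n + 1)
  | 0, f, G, hf, h => by
    obtain ⟨hm, h1⟩ := hp.sub_inv_mem_span (V := G) hf h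
    refine ⟨hm, Submodule.mem_sup_right ?_⟩
    rwa [zero_add, pow_one]
  | n + 1, f, G, hf, h => by
    have hf' : LocAC (2 * (n + 1) - 1 + 2) f := hf
    obtain ⟨hm1, h1⟩ := hp.sub_inv_pow_mem_solSpace (n := n) (f := jacobiExpr α β f)
      hf'.jacobiExpr h
    obtain ⟨hm, h2⟩ := hp.sub_inv_mem_span (hf'.of_le (by omega)) hm1.coeFn_toLp.symm
    refine ⟨hm, ?_⟩
    have h3 := Submodule.add_mem_sup (Submodule.mem_map_of_mem (f := (hp.inv : JacobiL2 α β →ₗ[ℂ] JacobiL2 α β)) h1) h2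
    have h4 : hm.toLp f - (hp.inv ^ (n + 1 + 1)) G = (hp.inv : JacobiL2 α β →ₗ[ℂ] JacobiL2 α β)
        (hm1.toLp _ - (hp.inv ^ (n + 1)) G) + (hm.toLp f - hp.inv (hm1.toLp _)) := by
      rw [pow_succ' _ (n + 1)]
      simp
    rw [h4]
    exact h3

end AdmissibleParams

lemma jacobiExpr_add_sol {u : ℝ → ℂ} {c d : ℂ} {x : ℝ} (hx : x ∈ Ioo (-1 : ℝ) 1)
    (hu : DiffOrd x 1 u) :
    jacobiExpr α β (u + fun x => (c + d * jacobiSol α β x)) x = jacobiExpr α β u x := by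
  have h1 : ∀ᶠ y in 𝓝 x, HasDerivAt (fun x => (c + d * jacobiSol α β x))
      (d * ((jacobiWeight (α + 1) (β + 1) y)⁻¹ : ℝ)) y := by
    filter_upwards [isOpen_Ioo.mem_nhds hx] with y hy
    exact ((jacobiSol_hasDerivAt hy).ofReal_comp.const_mul d).const_add c
  have h2 : (fun y => jacobiWeight (α + 1) (β + 1) y •
      deriv (fun x => (c + d * jacobiSol α β x)) y) =ᶠ[𝓝 x] fun _ => d := by
    filter_upwards [h1, isOpen_Ioo.mem_nhds hx] with y hy hyI
    have : (jacobiWeight (α + 1) (β + 1) y : ℂ) ≠ 0 :=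
      Complex.ofReal_ne_zero.2 (jacobiWeight_pos _ _ hyI).ne'
    rw [hy.deriv, Complex.real_smul, Complex.ofReal_inv]
    field_simp
  have h3 : DiffOrd x 1 (fun x => (c + d * jacobiSol α β x)) := by
    have hc : ContDiffOn ℝ ∞ (fun x => (c + d * jacobiSol α β x)) (Ioo (-1) 1) :=
      contDiffOn_const.add (contDiffOn_const.mul
        (Complex.ofRealCLM.contDiff.comp_contDiffOn jacobiSol_contDiffOn))
    refine diffOrd_of_contDiffOn hx 1 _ (hc.of_le (by simp)) ?_
    rw [iteratedDeriv_one]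
    have := (contDiffOn_infty_iff_deriv_of_isOpen isOpen_Ioo).1 hc
    exact (this.2.differentiableOn (by simp)).differentiableAt (isOpen_Ioo.mem_nhds hx)
  rw [jacobiExpr_add hx hu h3, add_eq_left, jacobiExpr, h2.deriv_eq]
  simp

lemma LocAC.diffOrd {f : ℝ → ℂ} (hf : LocAC 2 f) {x : ℝ} (hx : x ∈ Ioo (-1 : ℝ) 1) :
    DiffOrd x 1 f := by
  refine diffOrd_of_contDiffOn hx 1 _ hf.pred.1 ?_
  rw [iteratedDeriv_one]
  exact (locAC_succ_iff.1 (locAC_succ_iff.1 hf).2).1.differentiableAt (isOpen_Ioo.mem_nhds hx)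

namespace AdmissibleParams

lemma exists_regular_of_sub_mem_solSpace (hp : AdmissibleParams α β) : ∀ {n : ℕ}
    {F G : JacobiL2 α β}, F - (hp.inv ^ (n + 1)) G ∈ hp.solSpace (n + 1) →
    ∃ f, JacobiRegular (n + 1) f ∧ F =ᵐ[jacobiMeasure α β] f ∧
      jacobiPow α β (n + 1) f =ᵐ[jacobiMeasure α β] G := by
  have hsol : ∀ (k : ℕ) (c d : ℂ), LocAC k (fun x => (c + d * jacobiSol α β x)) := fun k c d =>
    locAC_of_contDiffOn (contDiffOn_const.add (contDiffOn_const.mul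
      (Complex.ofRealCLM.contDiff.comp_contDiffOn jacobiSol_contDiffOn)))
  intro n
  induction n with
  | zero =>
    intro F G h
    have h1 : F - hp.inv G ∈ Submodule.span ℂ {hp.one, hp.sol} := by
      simpa [solSpace] using h
    obtain ⟨c, d, hcd⟩ := hp.exists_of_mem_span h1
    have hG := hp.jacobiInv_locAC_one (Lp.memLp G)
    refine ⟨jacobiInv α β G + fun x => (c + d * jacobiSol α β x), hG.add (hsol 1 c d), ?_, ?_⟩
    · filter_upwards [hcd, hp.inv_coeFn G, Lp.coeFn_sub F (hp.inv G)] with x h2 h3 h4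
      rw [h4, Pi.sub_apply, h3] at h2
      rw [Pi.add_apply, ← h2]
      simp
    · refine (jacobiMeasure_ac α β).ae_le ?_
      filter_upwards [hG.ae_diffOrd, hp.jacobiExpr_jacobiInv_ae (Lp.memLp G),
        ae_restrict_mem measurableSet_Ioo] with x h2 h3 hx
      exact (jacobiExpr_add_sol hx h2).trans h3
  | succ n ih =>
    intro F G h
    obtain ⟨_, ⟨z, hz, rfl⟩, s, hs, hzs⟩ := Submodule.mem_sup.1 h
    obtain ⟨f1, hf1, hF1, hG1⟩ := ih (F := (hp.inv ^ (n + 1)) G + z) (G := G)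
      (by simpa using hz)
    have hm1 : MemLp f1 2 (jacobiMeasure α β) := (memLp_congr_ae hF1).1 (Lp.memLp _)
    obtain ⟨c, d, hcd⟩ := hp.exists_of_mem_span hs
    have hf1' : LocAC (2 * (n + 1) - 1) f1 := hf1
    have hu := hp.jacobiInv_locAC hm1 hf1'
    have hE : EqOn (jacobiExpr α β (jacobiInv α β f1 + fun x => (c + d * jacobiSol α β x))) f1
        (Ioo (-1) 1) := fun x hx =>
      (jacobiExpr_add_sol hx ((hu.of_le (by omega)).diffOrd hx)).trans
        (hp.jacobiExpr_jacobiInv hm1 hf1'.continuousOn hx)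
    refine ⟨jacobiInv α β f1 + fun x => (c + d * jacobiSol α β x), hu.add (hsol _ c d), ?_, ?_⟩
    · have h2 : F = hp.inv ((hp.inv ^ (n + 1)) G + z) + s := by
        rw [pow_succ' _ (n + 1), eq_comm, sub_eq_iff_eq_add] at hzs
        rw [hzs, map_add]
        simp only [ContinuousLinearMap.coe_coe, mul_apply_eq_comp]
        abel
      have h3 : (hp.inv ^ (n + 1)) G + z = hm1.toLp f1 := Lp.ext (hF1.trans hm1.coeFn_toLp.symm)
      rw [h2, h3, hp.inv_toLp]
      filter_upwards [Lp.coeFn_add ((hp.memLp_jacobiInv hm1).toLp _) s, hcd,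
        (hp.memLp_jacobiInv hm1).coeFn_toLp] with x h4 h5 h6
      rw [h4, Pi.add_apply, h5, h6, Pi.add_apply]
    · refine EventuallyEq.trans ?_ hG1
      filter_upwards [ae_mem_Ioo_jacobiMeasure] with x hx
      exact (jacobiPow_congr (n := n + 1)
        (hE.eventuallyEq_of_mem (isOpen_Ioo.mem_nhds hx))).self_of_nhds

theorem hasResolventGraph (hp : AdmissibleParams α β) {n : ℕ} (hn : 1 ≤ n) :
    HasResolventGraph (jacobiMax α β n) (hp.inv ^ n) (hp.solSpace n) := by
  obtain ⟨n, rfl⟩ := Nat.exists_eq_add_of_le' hn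
  intro F G
  rw [jacobiMax_graph]
  constructor
  · rintro ⟨f, hf, hF, hG⟩
    obtain ⟨hm, h⟩ := hp.sub_inv_pow_mem_solSpace hf hG.symm
    have : F = hm.toLp f := Lp.ext (hF.trans hm.coeFn_toLp.symm)
    rwa [this]
  · intro h
    obtain ⟨f, hf, hF, hG⟩ := hp.exists_regular_of_sub_mem_solSpace h
    exact ⟨f, hf, hF, hG.symm⟩

end AdmissibleParams

lemma isGreenKernel_jacobiMinDomain (α β : ℝ) (n : ℕ) :
    IsGreenKernel (jacobiMax α β n) (jacobiMinDomain α β n) := fun _ => Iff.rfl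

end

/-! ### Boundary behavior of functions in the minimal domain -/

section

variable {α β : ℝ}

lemma abs_min_sub_left_le {a b : ℝ} (ha : a ≤ 0) : |min a b - a| ≤ |b| := by
  rcases le_total a b with h | h
  · simp [min_eq_left h]
  · rw [min_eq_right h, abs_of_nonpos (sub_nonpos.2 h), abs_of_nonpos (h.trans ha)]
    linarith

lemma abs_min_sub_right_le {a b : ℝ} (ha : 0 ≤ a) : |min a b - b| ≤ |b| := by
  rcases le_total a b with h | h
  · rw [min_eq_left h, abs_of_nonpos (sub_nonpos.2 h), abs_of_nonneg (ha.trans h)]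
    linarith
  · simp [min_eq_right h]

namespace AdmissibleParams

lemma tendsto_jacobiInv_left (hp : AdmissibleParams α β) {v : ℝ → ℂ}
    (hv : MemLp v 2 (jacobiMeasure α β)) (h1 : ∫ t, v t ∂(jacobiMeasure α β) = 0) :
    Tendsto (jacobiInv α β v) (𝓝[>] (-1)) (𝓝 0) := by
  have e : ∀ x, jacobiInv α β v x = ∫ t, (min (jacobiSol α β x) (jacobiSol α β t) -
      jacobiSol α β x) • v t ∂(jacobiMeasure α β) := by
    intro x
    have h2 : Integrable (fun t => jacobiSol α β x • v t) (jacobiMeasure α β) :=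
      (hp.integrable hv).smul (jacobiSol α β x)
    simp only [sub_smul]
    rw [integral_sub (hp.integrable_kernel_smul hv _) h2, integral_smul, h1, smul_zero, sub_zero]
    rfl
  have hlim : Tendsto (fun x => ∫ t, (min (jacobiSol α β x) (jacobiSol α β t) -
      jacobiSol α β x) • v t ∂(jacobiMeasure α β)) (𝓝[>] (-1))
      (𝓝 (∫ _, (0 : ℂ) ∂(jacobiMeasure α β))) := by
    refine tendsto_integral_filter_of_dominated_convergence
      (fun t => ‖jacobiSol α β t • v t‖) ?_ ?_ (hp.integrable_sol_smul hv).norm ?_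
    · exact Eventually.of_forall fun x =>
        ((aestronglyMeasurable_min_jacobiSol _).sub aestronglyMeasurable_const).smul hv.1
    · filter_upwards [Ioo_mem_nhdsGT (show (-1 : ℝ) < 0 by norm_num)] with x hx
      have hx0 : jacobiSol α β x ≤ 0 := by
        rw [← jacobiSol_zero (α := α) (β := β)]
        exact jacobiSol_strictMonoOn.monotoneOn ⟨hx.1, by linarith [hx.2]⟩ (by norm_num) hx.2.le
      refine Eventually.of_forall fun t => ?_
      rw [norm_smul, norm_smul, Real.norm_eq_abs, Real.norm_eq_abs]
      exact mul_le_mul_of_nonneg_right (abs_min_sub_left_le hx0) (norm_nonneg _)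
    · filter_upwards [ae_mem_Ioo_jacobiMeasure] with t ht
      refine tendsto_const_nhds.congr' ?_
      filter_upwards [Ioo_mem_nhdsGT ht.1] with x hx
      rw [min_eq_left (jacobiSol_strictMonoOn.monotoneOn ⟨hx.1, hx.2.trans ht.2⟩ ht hx.2.le),
        sub_self, zero_smul]
  rw [integral_zero] at hlim
  exact hlim.congr fun x => (e x).symm

lemma tendsto_jacobiInv_right (hp : AdmissibleParams α β) {v : ℝ → ℂ}
    (hv : MemLp v 2 (jacobiMeasure α β))
    (h1 : ∫ t, jacobiSol α β t • v t ∂(jacobiMeasure α β) = 0) :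
    Tendsto (jacobiInv α β v) (𝓝[<] 1) (𝓝 0) := by
  have e : ∀ x, jacobiInv α β v x = ∫ t, (min (jacobiSol α β x) (jacobiSol α β t) -
      jacobiSol α β t) • v t ∂(jacobiMeasure α β) := by
    intro x
    simp only [sub_smul]
    rw [integral_sub (hp.integrable_kernel_smul hv _) (hp.integrable_sol_smul hv), h1, sub_zero]
    rfl
  have hlim : Tendsto (fun x => ∫ t, (min (jacobiSol α β x) (jacobiSol α β t) -
      jacobiSol α β t) • v t ∂(jacobiMeasure α β)) (𝓝[<] 1)
      (𝓝 (∫ _, (0 : ℂ) ∂(jacobiMeasure α β))) := by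
    refine tendsto_integral_filter_of_dominated_convergence
      (fun t => ‖jacobiSol α β t • v t‖) ?_ ?_ (hp.integrable_sol_smul hv).norm ?_
    · exact Eventually.of_forall fun x =>
        ((aestronglyMeasurable_min_jacobiSol _).sub jacobiSol_aestronglyMeasurable).smul hv.1
    · filter_upwards [Ioo_mem_nhdsLT (show (0 : ℝ) < 1 by norm_num)] with x hx
      have hx0 : 0 ≤ jacobiSol α β x := by
        rw [← jacobiSol_zero (α := α) (β := β)]
        exact jacobiSol_strictMonoOn.monotoneOn (by norm_num) ⟨by linarith [hx.1], hx.2⟩ hx.1.le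
      refine Eventually.of_forall fun t => ?_
      rw [norm_smul, norm_smul, Real.norm_eq_abs, Real.norm_eq_abs]
      exact mul_le_mul_of_nonneg_right (abs_min_sub_right_le hx0) (norm_nonneg _)
    · filter_upwards [ae_mem_Ioo_jacobiMeasure] with t ht
      refine tendsto_const_nhds.congr' ?_
      filter_upwards [Ioo_mem_nhdsLT ht.2] with x hx
      rw [min_eq_right (jacobiSol_strictMonoOn.monotoneOn ht ⟨ht.1.trans hx.1, hx.2⟩ hx.1.le),
        sub_self, zero_smul]
  rw [integral_zero] at hlim
  exact hlim.congr fun x => (e x).symm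

lemma inner_one (hp : AdmissibleParams α β) (V : JacobiL2 α β) :
    inner ℂ hp.one V = ∫ t, V t ∂(jacobiMeasure α β) := by
  rw [L2.inner_def]
  refine integral_congr_ae ?_
  filter_upwards [(hp.memLp_const 1).coeFn_toLp] with x hx
  rw [one, hx]
  simp

lemma inner_sol (hp : AdmissibleParams α β) (V : JacobiL2 α β) :
    inner ℂ hp.sol V = ∫ t, jacobiSol α β t • V t ∂(jacobiMeasure α β) := by
  rw [L2.inner_def]
  refine integral_congr_ae ?_
  filter_upwards [hp.memLp_sol_ofReal.coeFn_toLp] with x hx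
  rw [sol, hx]
  simp [mul_comm]

lemma solSpace_le_succ (hp : AdmissibleParams α β) : ∀ n, hp.solSpace n ≤ hp.solSpace (n + 1)
  | 0 => bot_le
  | n + 1 => sup_le_sup_right (Submodule.map_mono (hp.solSpace_le_succ n)) _

lemma inv_mem_orthogonal (hp : AdmissibleParams α β) {n : ℕ} {g : JacobiL2 α β}
    (hg : g ∈ (hp.solSpace (n + 1))ᗮ) : hp.inv g ∈ (hp.solSpace n)ᗮ := by
  rw [Submodule.mem_orthogonal] at hg ⊢
  intro z hz
  have h1 : inner ℂ (hp.inv z) g = inner ℂ z (hp.inv g) := hp.inv_isSymmetric z g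
  rw [← h1]
  exact hg _ (Submodule.mem_sup_left (Submodule.mem_map_of_mem hz))

lemma inv_pow_mem_orthogonal (hp : AdmissibleParams α β) : ∀ {n : ℕ} {g : JacobiL2 α β},
    g ∈ (hp.solSpace (n + 1))ᗮ → (hp.inv ^ n) g ∈ (hp.solSpace 1)ᗮ
  | 0, g, hg => by simpa using hg
  | n + 1, g, hg => by
    have := hp.inv_pow_mem_orthogonal (hp.inv_mem_orthogonal hg)
    rwa [pow_succ]

lemma eqOn_jacobiInv (hp : AdmissibleParams α β) {f : ℝ → ℂ} {V : JacobiL2 α β}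
    (hf : ContinuousOn f (Ioo (-1) 1)) (h : f =ᵐ[jacobiMeasure α β] hp.inv V) :
    EqOn f (jacobiInv α β V) (Ioo (-1) 1) :=
  Measure.eqOn_open_of_ae_eq ((jacobiMeasure_ac' α β).ae_eq (h.trans (hp.inv_coeFn V)))
    isOpen_Ioo hf (hp.jacobiInv_continuousOn (Lp.memLp V))

/-- All `ℓᵏ[f]` with `k < n` vanish at the endpoints for `f` in the minimal domain. -/
lemma tendsto_jacobiPow (hp : AdmissibleParams α β) : ∀ {n k : ℕ} {f : ℝ → ℂ} {g : JacobiL2 α β},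
    k ≤ n → JacobiRegular (n + 1) f → g ∈ (hp.solSpace (n + 1))ᗮ →
    f =ᵐ[jacobiMeasure α β] (hp.inv ^ (n + 1)) g →
    Tendsto (jacobiPow α β k f) (𝓝[>] (-1)) (𝓝 0) ∧
      Tendsto (jacobiPow α β k f) (𝓝[<] 1) (𝓝 0)
  | n, 0, f, g, _, hf, hg, h => by
    rw [pow_succ'] at h
    have hE := hp.eqOn_jacobiInv hf.1.continuousOn h
    have hV := (Submodule.mem_orthogonal _ _).1 (hp.inv_pow_mem_orthogonal hg)
    have hV1 := hV hp.one (Submodule.mem_sup_right (Submodule.subset_span (by simp)))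
    have hV2 := hV hp.sol (Submodule.mem_sup_right (Submodule.subset_span (by simp)))
    rw [hp.inner_one] at hV1
    rw [hp.inner_sol] at hV2
    refine ⟨(hp.tendsto_jacobiInv_left (Lp.memLp _) hV1).congr' ?_,
      (hp.tendsto_jacobiInv_right (Lp.memLp _) hV2).congr' ?_⟩
    · filter_upwards [Ioo_mem_nhdsGT (show (-1 : ℝ) < 1 by norm_num)] with x hx
      exact (hE hx).symm
    · filter_upwards [Ioo_mem_nhdsLT (show (-1 : ℝ) < 1 by norm_num)] with x hx
      exact (hE hx).symm
  | 0, k + 1, _, _, hk, _, _, _ => by omega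
  | n + 1, k + 1, f, g, hk, hf, hg, h => by
    have hf' : LocAC (2 * (n + 1) - 1 + 2) f := hf
    have hg' : g ∈ (hp.solSpace (n + 1))ᗮ :=
      Submodule.orthogonal_le (hp.solSpace_le_succ _) hg
    refine hp.tendsto_jacobiPow (f := jacobiExpr α β f) (Nat.le_of_succ_le_succ hk)
      hf'.jacobiExpr hg' ?_
    rw [pow_succ'] at h
    have hE := hp.eqOn_jacobiInv hf.1.continuousOn h
    refine (jacobiMeasure_ac α β).ae_eq ?_
    filter_upwards [hp.jacobiExpr_jacobiInv_ae (Lp.memLp ((hp.inv ^ (n + 1)) g)),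
      ae_restrict_mem measurableSet_Ioo] with x h1 hx
    rw [← h1]
    exact (jacobiExpr_congr (hE.eventuallyEq_of_mem (isOpen_Ioo.mem_nhds hx))).self_of_nhds

lemma tendsto_of_mem_minDomain (hp : AdmissibleParams α β) {n k : ℕ} {f : ℝ → ℂ}
    (hf : IsJacobiMaxFun α β n f) (hk : k < n) (h : hf.toL2 ∈ jacobiMinDomain α β n) :
    Tendsto (jacobiPow α β k f) (𝓝[>] (-1)) (𝓝 0) ∧
      Tendsto (jacobiPow α β k f) (𝓝[<] 1) (𝓝 0) := by
  obtain ⟨n, rfl⟩ := Nat.exists_eq_add_of_le' (show 1 ≤ n by omega)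
  obtain ⟨g, hg, hgf⟩ := ((hp.hasResolventGraph (by omega)).mem_kernel_iff
    (hp.inv_pow_isSymmetric _) (isGreenKernel_jacobiMinDomain α β _) _).1 h
  refine hp.tendsto_jacobiPow (by omega) hf.regular hg ?_
  rw [hgf]
  exact hf.memLp.coeFn_toLp.symm

end AdmissibleParams

end

/-! ### The Jacobi expression on functions of the distance to the left endpoint -/

section

variable {α β : ℝ}

/-- In terms of the distance `t` to the left endpoint, `ℓ` maps `b` to `e`. -/
def HasEndpointExpr (α β : ℝ) (b e : ℝ → ℝ) : Prop :=
  ∃ b1 b2 : ℝ → ℝ, ∀ t, 0 < t → HasDerivAt b (b1 t) t ∧ HasDerivAt b1 (b2 t) t ∧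
    -(t * (2 - t) * b2 t + ((β + 1) * (2 - t) - (α + 1) * t) * b1 t) = e t

lemma HasEndpointExpr.congr {b e b' e' : ℝ → ℝ} (h : HasEndpointExpr α β b e)
    (hb : ∀ t, 0 < t → b' t = b t) (he : ∀ t, 0 < t → e' t = e t) :
    HasEndpointExpr α β b' e' := by
  obtain ⟨b1, b2, H⟩ := h
  refine ⟨b1, b2, fun t ht => ⟨?_, (H t ht).2.1, (H t ht).2.2.trans (he t ht).symm⟩⟩
  refine (H t ht).1.congr_of_eventuallyEq ?_
  filter_upwards [lt_mem_nhds ht] with s hs using hb s hs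

lemma hasEndpointExpr_rpow (s : ℝ) : HasEndpointExpr α β (fun t => t ^ s)
    (fun t => -2 * s * (s + β) * t ^ (s - 1) + s * (s + α + β + 1) * t ^ s) := by
  refine ⟨fun t => s * t ^ (s - 1), fun t => s * ((s - 1) * t ^ (s - 1 - 1)), fun t ht =>
    ⟨Real.hasDerivAt_rpow_const (Or.inl ht.ne'),
      (Real.hasDerivAt_rpow_const (Or.inl ht.ne')).const_mul s, ?_⟩⟩
  have h1 : t ^ s = t ^ (s - 1) * t := by rw [Real.rpow_sub_one ht.ne']; field_simp
  beta_reduce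
  rw [Real.rpow_sub_one ht.ne' (s - 1), h1]
  field_simp
  ring

lemma hasEndpointExpr_rpow_mul_log (s : ℝ) :
    HasEndpointExpr α β (fun t => t ^ s * Real.log t)
      (fun t => -2 * s * (s + β) * (t ^ (s - 1) * Real.log t) +
        s * (s + α + β + 1) * (t ^ s * Real.log t) +
        (-2 * (2 * s + β) * t ^ (s - 1) + (2 * s + α + β + 1) * t ^ s)) := by
  have hd : ∀ (r t : ℝ), 0 < t → HasDerivAt (fun t => t ^ r * Real.log t)
      (r * (t ^ (r - 1) * Real.log t) + t ^ (r - 1)) t := by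
    intro r t ht
    have h := (Real.hasDerivAt_rpow_const (p := r) (Or.inl ht.ne')).mul
      (Real.hasDerivAt_log ht.ne')
    have e : r * t ^ (r - 1) * Real.log t + t ^ r * t⁻¹ =
        r * (t ^ (r - 1) * Real.log t) + t ^ (r - 1) := by
      rw [Real.rpow_sub_one ht.ne']
      field_simp
    rw [e] at h
    exact h
  refine ⟨fun t => s * (t ^ (s - 1) * Real.log t) + t ^ (s - 1),
    fun t => s * ((s - 1) * (t ^ (s - 1 - 1) * Real.log t) + t ^ (s - 1 - 1)) +
      (s - 1) * t ^ (s - 1 - 1), fun t ht => ⟨hd s t ht,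
        ((hd (s - 1) t ht).const_mul s).add (Real.hasDerivAt_rpow_const (Or.inl ht.ne')), ?_⟩⟩
  have h1 : t ^ s = t ^ (s - 1) * t := by rw [Real.rpow_sub_one ht.ne']; field_simp
  beta_reduce
  rw [Real.rpow_sub_one ht.ne' (s - 1), h1]
  field_simp
  ring

lemma hasEndpointExpr_firstKind (j : ℕ) : HasEndpointExpr α β (firstKind j)
    (fun t => -2 * j * (j + β) * firstKind (j - 1) t + j * (j + α + β + 1) * firstKind j t) := by
  refine (hasEndpointExpr_rpow (j : ℝ)).congr (fun t _ => (Real.rpow_natCast t j).symm)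
    fun t ht => ?_
  rcases j with _ | j
  · simp
  · simp only [firstKind, Real.rpow_natCast, Nat.add_sub_cancel, Nat.cast_add, Nat.cast_one,
      add_sub_cancel_right]
    rw [← Nat.cast_add_one, Real.rpow_natCast]

lemma hasEndpointExpr_secondKind (j : ℕ) : HasEndpointExpr α β (secondKind β j)
    (fun t => -2 * j * (j - β) * secondKind β (j - 1) t +
      (j - β) * (j + α + 1) * secondKind β j t +
      if β = 0 then -4 * j * firstKind (j - 1) t + (2 * j + α + 1) * firstKind j t else 0) := by
  by_cases hβ : β = 0
  · subst hβ
    refine (hasEndpointExpr_rpow_mul_log (j : ℝ)).congr (fun t _ => by simp [secondKind])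
      fun t ht => ?_
    rcases j with _ | j
    · simp [firstKind]
    · simp only [firstKind, secondKind, if_true, Nat.add_sub_cancel, Nat.cast_add, Nat.cast_one,
        add_sub_cancel_right]
      rw [← Nat.cast_add_one, Real.rpow_natCast, Real.rpow_natCast]
      push_cast
      ring
  · refine (hasEndpointExpr_rpow (-β + j)).congr (fun t _ => by simp [secondKind, hβ])
      fun t ht => ?_
    rcases j with _ | j
    · simp only [secondKind, hβ, if_false]
      push_cast
      ring
    · simp only [secondKind, hβ, if_false, Nat.add_sub_cancel]
      push_cast
      rw [show -β + ((j : ℝ) + 1) - 1 = -β + j by ring]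
      ring

lemma jacobiWeight_succ_hasDerivAt {x : ℝ} (hx : x ∈ Ioo (-1 : ℝ) 1) :
    HasDerivAt (jacobiWeight (α + 1) (β + 1))
      (jacobiWeight α β x * ((β + 1) * (1 - x) - (α + 1) * (1 + x))) x := by
  have p1 : (0 : ℝ) < 1 - x := by linarith [hx.2]
  have p2 : (0 : ℝ) < 1 + x := by linarith [hx.1]
  have h1 := ((hasDerivAt_id x).const_sub 1).rpow_const (p := α + 1) (Or.inl p1.ne')
  have h2 := ((hasDerivAt_id x).const_add 1).rpow_const (p := β + 1) (Or.inl p2.ne')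
  have h := h1.mul h2
  have e : -1 * (α + 1) * (1 - id x) ^ (α + 1 - 1) * (1 + id x) ^ (β + 1) +
      (1 - id x) ^ (α + 1) * (1 * (β + 1) * (1 + id x) ^ (β + 1 - 1)) =
      jacobiWeight α β x * ((β + 1) * (1 - x) - (α + 1) * (1 + x)) := by
    simp only [id, add_sub_cancel_right, jacobiWeight, Real.rpow_add_one p1.ne',
      Real.rpow_add_one p2.ne']
    ring
  rw [e] at h
  exact h

lemma jacobiExpr_eq_of_hasDerivAt {f f1 : ℝ → ℂ} {f2 : ℂ} {x : ℝ} (hx : x ∈ Ioo (-1 : ℝ) 1)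
    (h1 : ∀ᶠ y in 𝓝 x, HasDerivAt f (f1 y) y) (h2 : HasDerivAt f1 f2 x) :
    jacobiExpr α β f x = -(((1 + x) * (2 - (1 + x)) : ℝ) • f2 +
      ((β + 1) * (2 - (1 + x)) - (α + 1) * (1 + x) : ℝ) • f1 x) := by
  have p1 : (0 : ℝ) < 1 - x := by linarith [hx.2]
  have p2 : (0 : ℝ) < 1 + x := by linarith [hx.1]
  have h3 : (fun y => jacobiWeight (α + 1) (β + 1) y • deriv f y) =ᶠ[𝓝 x]
      fun y => jacobiWeight (α + 1) (β + 1) y • f1 y := by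
    filter_upwards [h1] with y hy
    rw [hy.deriv]
  have hw := (jacobiWeight_pos α β hx).ne'
  have h4 : jacobiWeight (α + 1) (β + 1) x = jacobiWeight α β x * ((1 - x) * (1 + x)) := by
    simp only [jacobiWeight, Real.rpow_add_one p1.ne', Real.rpow_add_one p2.ne']
    ring
  rw [jacobiExpr, h3.deriv_eq, ((jacobiWeight_succ_hasDerivAt hx).fun_smul h2).deriv, smul_add, h4,
    smul_smul, smul_smul, inv_mul_cancel_left₀ hw, inv_mul_cancel_left₀ hw]
  congr 3 <;> ring

lemma HasEndpointExpr.jacobiExpr {b e : ℝ → ℝ} (h : HasEndpointExpr α β b e) {x : ℝ}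
    (hx : x ∈ Ioo (-1 : ℝ) 1) : DiffOrd x 1 (fun x => (b (1 + x) : ℂ)) ∧
      jacobiExpr α β (fun x => (b (1 + x) : ℂ)) x = e (1 + x) := by
  obtain ⟨b1, b2, H⟩ := h
  have shift : ∀ {g : ℝ → ℝ} {g' y : ℝ}, HasDerivAt g g' (1 + y) →
      HasDerivAt (fun x => (g (1 + x) : ℂ)) g' y := fun hg =>
    (HasDerivAt.comp_const_add 1 _ hg).ofReal_comp
  have h1 : ∀ᶠ y in 𝓝 x, HasDerivAt (fun x => (b (1 + x) : ℂ)) (b1 (1 + y)) y := by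
    filter_upwards [isOpen_Ioo.mem_nhds hx] with y hy
    exact shift (H _ (by linarith [hy.1])).1
  obtain ⟨-, h2, h3⟩ := H (1 + x) (by linarith [hx.1])
  refine ⟨⟨h1.mono fun y hy => hy.differentiableAt, ?_⟩, ?_⟩
  · refine DiffOrd.congr (k := 0) (shift h2).differentiableAt ?_
    exact h1.mono fun y hy => hy.deriv.symm
  · rw [jacobiExpr_eq_of_hasDerivAt hx h1 (shift h2), ← h3]
    simp

lemma DiffOrd.zero_fun (x : ℝ) (k : ℕ) : DiffOrd x k (0 : ℝ → ℂ) := by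
  induction k with
  | zero => exact differentiableAt_const _
  | succ k ih =>
    refine ⟨Eventually.of_forall fun _ => differentiableAt_const _, ?_⟩
    have : deriv (0 : ℝ → ℂ) = 0 := by ext; simp
    rwa [this]

lemma DiffOrd.const_smul {x : ℝ} {k : ℕ} {f : ℝ → ℂ} (c : ℂ) (hf : DiffOrd x k f) :
    DiffOrd x k (c • f) := by
  induction k generalizing f with
  | zero => exact DifferentiableAt.const_smul hf c
  | succ k ih =>
    refine ⟨hf.1.mono fun y hy => hy.const_smul c, (ih hf.2).congr ?_⟩
    exact Eventually.of_forall fun y => (deriv_const_smul_field c f).symm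

lemma jacobiExpr_sum {ι : Type*} (s : Finset ι) {f : ι → ℝ → ℂ} {x : ℝ} (hx : x ∈ Ioo (-1 : ℝ) 1)
    (hf : ∀ i ∈ s, DiffOrd x 1 (f i)) :
    DiffOrd x 1 (∑ i ∈ s, f i) ∧
      jacobiExpr α β (∑ i ∈ s, f i) x = ∑ i ∈ s, jacobiExpr α β (f i) x := by
  classical
  induction s using Finset.induction_on with
  | empty =>
    refine ⟨DiffOrd.zero_fun x 1, ?_⟩
    have := congrFun (jacobiExpr_smul α β 0 0) x
    simpa using this
  | insert i s hi ih =>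
    obtain ⟨h1, h2⟩ := ih fun j hj => hf j (Finset.mem_insert_of_mem hj)
    have h3 := hf i (Finset.mem_insert_self _ _)
    rw [Finset.sum_insert hi, Finset.sum_insert hi, jacobiExpr_add hx h3 h1, h2]
    exact ⟨h3.add h1, rfl⟩

/-! ### Expansions at the left endpoint -/

/-- The finite sum `∑ⱼ (cⱼ firstKindⱼ + dⱼ secondKindⱼ)`. -/
def endpointSum (β : ℝ) (N : ℕ) (c d : ℕ → ℂ) (t : ℝ) : ℂ :=
  ∑ j ∈ Finset.range N, (c j * (firstKind j t : ℂ) + d j * (secondKind β j t : ℂ))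

/-- `f` is a finite sum of endpoint functions near `-1`. -/
structure HasLeftExpansion (β : ℝ) (N : ℕ) (c d : ℕ → ℂ) (f : ℝ → ℂ) : Prop where
  first_eq_zero : ∀ j, N ≤ j → c j = 0
  second_eq_zero : ∀ j, N ≤ j → d j = 0
  eventually_eq : ∀ᶠ x in 𝓝[>] (-1 : ℝ), f x = endpointSum β N c d (1 + x)

/-- The coefficients of the second kind of `ℓ[f]`. -/
def nextSecond (α β : ℝ) (d : ℕ → ℂ) (j : ℕ) : ℂ :=
  -2 * (j + 1) * (j + 1 - β) * d (j + 1) + (j - β) * (j + α + 1) * d j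

/-- The coefficients of the first kind of `ℓ[f]`. -/
def nextFirst (α β : ℝ) (c d : ℕ → ℂ) (j : ℕ) : ℂ :=
  -2 * (j + 1) * (j + 1 + β) * c (j + 1) + j * (j + α + β + 1) * c j +
    if β = 0 then -4 * (j + 1) * d (j + 1) + (2 * j + α + 1) * d j else 0

lemma sum_range_shift {N : ℕ} {A : ℕ → ℂ} {b : ℕ → ℂ} (h0 : A 0 = 0) (hN : A N = 0) :
    ∑ j ∈ Finset.range N, A j * b (j - 1) = ∑ j ∈ Finset.range N, A (j + 1) * b j := by
  have h1 := Finset.sum_range_succ (fun j => A j * b (j - 1)) N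
  have h2 := Finset.sum_range_succ' (fun j => A j * b (j - 1)) N
  rw [h1] at h2
  simpa [h0, hN] using h2

lemma jacobiExpr_endpointSum {N : ℕ} {c d : ℕ → ℂ} (hc : c N = 0) (hd : d N = 0) {x : ℝ}
    (hx : x ∈ Ioo (-1 : ℝ) 1) : jacobiExpr α β (fun x => endpointSum β N c d (1 + x)) x =
      endpointSum β N (nextFirst α β c d) (nextSecond α β d) (1 + x) := by
  have h1 := fun j => (hasEndpointExpr_firstKind (α := α) (β := β) j).jacobiExpr hx
  have h2 := fun j => (hasEndpointExpr_secondKind (α := α) (β := β) j).jacobiExpr hx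
  have e : (fun x => endpointSum β N c d (1 + x)) = ∑ j ∈ Finset.range N,
      (c j • (fun x : ℝ => (firstKind j (1 + x) : ℂ)) +
        d j • (fun x : ℝ => (secondKind β j (1 + x) : ℂ))) := by
    ext x
    simp [endpointSum]
  rw [e, (jacobiExpr_sum _ hx fun j _ => ((h1 j).1.const_smul _).add ((h2 j).1.const_smul _)).2]
  have e2 : ∀ j, jacobiExpr α β (c j • (fun x : ℝ => (firstKind j (1 + x) : ℂ)) +
      d j • (fun x : ℝ => (secondKind β j (1 + x) : ℂ))) x =
      (-2 * j * (j + β) * c j + if β = 0 then -4 * j * d j else 0) *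
        (firstKind (j - 1) (1 + x) : ℂ) +
      (-2 * j * (j - β) * d j) * (secondKind β (j - 1) (1 + x) : ℂ) +
      ((j * (j + α + β + 1) * c j + if β = 0 then (2 * j + α + 1) * d j else 0) *
        (firstKind j (1 + x) : ℂ) +
      ((j - β) * (j + α + 1) * d j) * (secondKind β j (1 + x) : ℂ)) := by
    intro j
    rw [jacobiExpr_add hx ((h1 j).1.const_smul _) ((h2 j).1.const_smul _), jacobiExpr_smul,
      jacobiExpr_smul, Pi.smul_apply, Pi.smul_apply, (h1 j).2, (h2 j).2]
    split_ifs
    · push_cast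
      simp only [smul_eq_mul]
      ring
    · push_cast
      simp only [smul_eq_mul]
      ring
  rw [Finset.sum_congr rfl fun j _ => e2 j, Finset.sum_add_distrib, Finset.sum_add_distrib,
    sum_range_shift (A := fun j : ℕ => -2 * (j : ℂ) * (j + β) * c j +
      if β = 0 then -4 * (j : ℂ) * d j else 0) (b := fun j => (firstKind j (1 + x) : ℂ))
      (by simp) (by simp [hc, hd]),
    sum_range_shift (A := fun j : ℕ => -2 * (j : ℂ) * (j - β) * d j)
      (b := fun j => (secondKind β j (1 + x) : ℂ)) (by simp) (by simp [hd]),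
    ← Finset.sum_add_distrib, ← Finset.sum_add_distrib, endpointSum]
  refine Finset.sum_congr rfl fun j _ => ?_
  rw [nextFirst, nextSecond]
  split_ifs
  · push_cast
    ring
  · push_cast
    ring

lemma HasLeftExpansion.jacobiExpr {N : ℕ} {c d : ℕ → ℂ} {f : ℝ → ℂ}
    (h : HasLeftExpansion β N c d f) :
    HasLeftExpansion β N (nextFirst α β c d) (nextSecond α β d) (jacobiExpr α β f) := by
  obtain ⟨h1, h2, h3⟩ := h
  refine ⟨fun j hj => ?_, fun j hj => ?_, ?_⟩
  · simp [nextFirst, h1 j hj, h2 j hj, h1 (j + 1) (by omega), h2 (j + 1) (by omega)]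
  · simp [nextSecond, h2 j hj, h2 (j + 1) (by omega)]
  · rw [← eventually_eventually_nhdsWithin] at h3
    filter_upwards [h3, Ioo_mem_nhdsGT (show (-1 : ℝ) < 1 by norm_num)] with x hx hxI
    rw [(isOpen_Ioi (a := (-1 : ℝ))).nhdsWithin_eq hxI.1] at hx
    rw [(jacobiExpr_congr (α := α) (β := β) hx).self_of_nhds,
      jacobiExpr_endpointSum (h1 N le_rfl) (h2 N le_rfl) hxI]

end

/-! ### Limits of expansions -/

section

variable {α β : ℝ}

lemma tendsto_firstKind_zero {j : ℕ} (hj : j ≠ 0) :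
    Tendsto (firstKind j) (𝓝[>] 0) (𝓝 0) := by
  have h := (continuous_pow (M := ℝ) j).tendsto 0
  rw [zero_pow hj] at h
  exact h.mono_left nhdsWithin_le_nhds

lemma tendsto_secondKind_zero (hβ1 : β < 1) {j : ℕ} (hj : j ≠ 0) :
    Tendsto (secondKind β j) (𝓝[>] 0) (𝓝 0) := by
  have hj1 : (1 : ℝ) ≤ j := by exact_mod_cast Nat.one_le_iff_ne_zero.2 hj
  by_cases hβ : β = 0
  · have h := tendsto_log_mul_rpow_nhdsGT_zero (r := j) (by linarith)
    refine h.congr fun t => ?_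
    rw [secondKind, if_pos hβ, Real.rpow_natCast, mul_comm]
  · have h := (Real.continuousAt_rpow_const 0 (-β + j) (Or.inr (by linarith))).tendsto
    rw [Real.zero_rpow (by linarith)] at h
    refine (h.mono_left nhdsWithin_le_nhds).congr fun t => ?_
    rw [secondKind, if_neg hβ]

lemma tendsto_abs_secondKind_atTop (hβ : 0 ≤ β) :
    Tendsto (fun t => |secondKind β 0 t|) (𝓝[>] 0) atTop := by
  by_cases h0 : β = 0
  · refine (tendsto_abs_atBot_atTop.comp Real.tendsto_log_nhdsGT_zero).congr fun t => ?_
    simp [secondKind, h0]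
  · have hneg : -β < 0 := by
      have := lt_of_le_of_ne hβ (Ne.symm h0)
      linarith
    refine (tendsto_abs_atTop_atTop.comp (tendsto_rpow_neg_nhdsGT_zero hneg)).congr fun t => ?_
    simp [secondKind, h0]

lemma eq_zero_of_tendsto_endpointSum (hβ : 0 ≤ β) (hβ1 : β < 1) {N : ℕ} {c d : ℕ → ℂ}
    (h : Tendsto (endpointSum β (N + 1) c d) (𝓝[>] 0) (𝓝 0)) : c 0 = 0 ∧ d 0 = 0 := by
  have h1 : Tendsto (fun t => ∑ j ∈ Finset.range N,
      (c (j + 1) * (firstKind (j + 1) t : ℂ) + d (j + 1) * (secondKind β (j + 1) t : ℂ)))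
      (𝓝[>] 0) (𝓝 0) := by
    rw [show (0 : ℂ) = ∑ _j ∈ Finset.range N, 0 by simp]
    refine tendsto_finsetSum _ fun j _ => ?_
    have e1 : Tendsto (fun t => (firstKind (j + 1) t : ℂ)) (𝓝[>] 0) (𝓝 (0 : ℝ)) :=
      (Complex.continuous_ofReal.tendsto 0).comp (tendsto_firstKind_zero j.succ_ne_zero)
    have e2 : Tendsto (fun t => (secondKind β (j + 1) t : ℂ)) (𝓝[>] 0) (𝓝 (0 : ℝ)) :=
      (Complex.continuous_ofReal.tendsto 0).comp (tendsto_secondKind_zero hβ1 j.succ_ne_zero)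
    simpa using (e1.const_mul (c (j + 1))).add (e2.const_mul (d (j + 1)))
  have h2 : Tendsto (fun t => d 0 * (secondKind β 0 t : ℂ)) (𝓝[>] 0) (𝓝 (-c 0)) := by
    have h3 := (h.sub h1).sub_const (c 0)
    rw [sub_zero, zero_sub] at h3
    refine h3.congr fun t => ?_
    rw [endpointSum, Finset.sum_range_succ']
    simp [firstKind]
  have hd : d 0 = 0 := by
    by_contra hd
    refine not_tendsto_nhds_of_tendsto_atTop ?_ _ h2.norm
    simp only [norm_mul, Complex.norm_real, Real.norm_eq_abs]
    exact (tendsto_abs_secondKind_atTop hβ).const_mul_atTop (norm_pos_iff.2 hd)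
  refine ⟨?_, hd⟩
  simp only [hd, zero_mul] at h2
  simpa using (tendsto_nhds_unique h2 tendsto_const_nhds)

lemma tendsto_add_one_nhdsGT : Tendsto (fun t : ℝ => t - 1) (𝓝[>] 0) (𝓝[>] (-1)) := by
  refine tendsto_nhdsWithin_iff.2 ⟨?_, ?_⟩
  · have h : Tendsto (fun t : ℝ => t - 1) (𝓝 0) (𝓝 (0 - 1)) :=
      (continuous_sub_right (1 : ℝ)).tendsto 0
    rw [zero_sub] at h
    exact h.mono_left nhdsWithin_le_nhds
  · filter_upwards [self_mem_nhdsWithin] with t ht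
    have : (0 : ℝ) < t := ht
    exact show (-1 : ℝ) < t - 1 by linarith

lemma HasLeftExpansion.zero_coeff (hβ : 0 ≤ β) (hβ1 : β < 1) {N : ℕ} {c d : ℕ → ℂ} {f : ℝ → ℂ}
    (hf : HasLeftExpansion β N c d f) (h : Tendsto f (𝓝[>] (-1)) (𝓝 0)) : c 0 = 0 ∧ d 0 = 0 := by
  rcases N with _ | N
  · exact ⟨hf.first_eq_zero 0 le_rfl, hf.second_eq_zero 0 le_rfl⟩
  · refine eq_zero_of_tendsto_endpointSum hβ hβ1 (N := N) ?_
    have h1 := (h.congr' hf.eventually_eq).comp tendsto_add_one_nhdsGT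
    simpa [Function.comp_def] using h1

/-- An expansion is trivial up to order `m` if `f, ℓ[f], …, ℓᵐ[f]` vanish at the endpoint. -/
lemma HasLeftExpansion.coeff_eq_zero (hβ : 0 ≤ β) (hβ1 : β < 1) {N : ℕ} : ∀ {m : ℕ} {c d : ℕ → ℂ}
    {f : ℝ → ℂ}, HasLeftExpansion β N c d f →
    (∀ k ≤ m, Tendsto (jacobiPow α β k f) (𝓝[>] (-1)) (𝓝 0)) → ∀ k ≤ m, c k = 0 ∧ d k = 0
  | 0, _, _, _, hf, h, k, hk => by
    obtain rfl : k = 0 := by omega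
    exact hf.zero_coeff hβ hβ1 (h 0 le_rfl)
  | m + 1, c, d, f, hf, h, k, hk => by
    have ih := HasLeftExpansion.coeff_eq_zero hβ hβ1 (m := m)
      (hf.jacobiExpr (α := α)) fun k hk => h (k + 1) (by omega)
    induction k with
    | zero => exact hf.zero_coeff hβ hβ1 (h 0 (by omega))
    | succ k ihk =>
      obtain ⟨h1, h2⟩ := ihk (by omega)
      obtain ⟨h3, h4⟩ := ih k (by omega)
      have p0 : ((k : ℂ) + 1) ≠ 0 := Nat.cast_add_one_ne_zero k
      have hk0 : (0 : ℝ) ≤ k := k.cast_nonneg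
      have p1 : ((k : ℂ) + 1 - β) ≠ 0 := by
        have : ((k : ℝ) + 1 - β) ≠ 0 := by linarith
        exact_mod_cast this
      have p2 : ((k : ℂ) + 1 + β) ≠ 0 := by
        have : ((k : ℝ) + 1 + β) ≠ 0 := by linarith
        exact_mod_cast this
      have hd : d (k + 1) = 0 := by
        rw [nextSecond, h2, mul_zero, add_zero] at h4
        simpa [p0, p1] using h4
      refine ⟨?_, hd⟩
      rw [nextFirst, h1, h2, hd] at h3
      simpa [p0, p2] using h3

/-! ### Square integrability of functions with expansions -/

lemma abs_secondKind_le (hβ1 : β < 1) (j : ℕ) {t : ℝ} (ht : 0 < t) (ht1 : t ≤ 1) :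
    |secondKind β j t| ≤ 4 * t ^ (-midExp β) := by
  have hp : 0 < t ^ (-midExp β) := Real.rpow_pos_of_pos ht _
  by_cases h0 : β = 0
  · have h1 := Real.abs_log_mul_self_rpow_lt t (1 / 4) ht ht1 (by norm_num)
    have hq : 0 < t ^ (1 / 4 : ℝ) := Real.rpow_pos_of_pos ht _
    have e : t ^ (-midExp β) = (t ^ (1 / 4 : ℝ))⁻¹ := by
      rw [← Real.rpow_neg ht.le, midExp, h0]
      norm_num
    have h2 : |t ^ j| ≤ 1 := by
      rw [abs_of_nonneg (pow_nonneg ht.le j)]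
      exact pow_le_one₀ ht.le ht1
    rw [secondKind, if_pos h0, e, abs_mul, ← div_eq_mul_inv, le_div_iff₀ hq]
    rw [abs_mul, abs_of_pos hq] at h1
    calc |t ^ j| * |Real.log t| * t ^ (1 / 4 : ℝ)
        ≤ 1 * |Real.log t| * t ^ (1 / 4 : ℝ) := by gcongr
      _ ≤ 4 := by
        norm_num at h1 ⊢
        exact h1.le
  · rw [secondKind, if_neg h0, abs_of_pos (Real.rpow_pos_of_pos ht _)]
    have hj : (0 : ℝ) ≤ j := j.cast_nonneg
    have h1 : t ^ (-β + j) ≤ t ^ (-midExp β) :=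
      Real.rpow_le_rpow_of_exponent_ge ht ht1 (by rw [midExp]; linarith)
    linarith

lemma abs_firstKind_le (hβ : 0 ≤ β) (j : ℕ) {t : ℝ} (ht : 0 < t) (ht1 : t ≤ 1) :
    |firstKind j t| ≤ t ^ (-midExp β) := by
  rw [firstKind, abs_of_nonneg (pow_nonneg ht.le j)]
  exact (pow_le_one₀ ht.le ht1).trans
    (Real.one_le_rpow_of_pos_of_le_one_of_nonpos ht ht1 (by rw [midExp]; linarith))

lemma HasLeftExpansion.exists_norm_le (hβ : 0 ≤ β) (hβ1 : β < 1) {N : ℕ} {c d : ℕ → ℂ}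
    {f : ℝ → ℂ} (hf : HasLeftExpansion β N c d f) :
    ∃ C : ℝ, 0 ≤ C ∧ ∀ᶠ x in 𝓝[>] (-1 : ℝ), ‖f x‖ ≤ C * (1 + x) ^ (-midExp β) := by
  refine ⟨∑ j ∈ Finset.range N, (‖c j‖ + ‖d j‖ * 4),
    Finset.sum_nonneg fun j _ => by positivity, ?_⟩
  filter_upwards [hf.eventually_eq, Ioo_mem_nhdsGT (show (-1 : ℝ) < 0 by norm_num)] with x hx hxI
  have p0 : 0 < 1 + x := by linarith [hxI.1]
  have p1 : 1 + x ≤ 1 := by linarith [hxI.2]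
  rw [hx, endpointSum, Finset.sum_mul]
  refine (norm_sum_le _ _).trans (Finset.sum_le_sum fun j _ => ?_)
  refine (norm_add_le _ _).trans ?_
  rw [norm_mul, norm_mul, Complex.norm_real, Complex.norm_real, Real.norm_eq_abs,
    Real.norm_eq_abs, add_mul, mul_assoc ‖d j‖]
  gcongr
  · exact abs_firstKind_le hβ j p0 p1
  · exact abs_secondKind_le hβ1 j p0 p1

/-- `f` has expansions at both endpoints. -/
structure HasExpansions (α β : ℝ) (N : ℕ) (cl dl cr dr : ℕ → ℂ) (f : ℝ → ℂ) : Prop where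
  smooth : ContDiffOn ℝ ∞ f (Ioo (-1) 1)
  left : HasLeftExpansion β N cl dl f
  right : HasLeftExpansion α N cr dr fun x => f (-x)

lemma tendsto_neg_nhdsLT_one : Tendsto (fun x : ℝ => -x) (𝓝[<] 1) (𝓝[>] (-1)) :=
  tendsto_neg_nhdsLT

lemma tendsto_neg_nhdsGT_neg_one : Tendsto (fun x : ℝ => -x) (𝓝[>] (-1)) (𝓝[<] 1) := by
  have := tendsto_neg_nhdsGT (a := (-1 : ℝ))
  rwa [neg_neg] at this

lemma HasExpansions.memLp (hp : AdmissibleParams α β) {N : ℕ} {cl dl cr dr : ℕ → ℂ} {f : ℝ → ℂ}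
    (hf : HasExpansions α β N cl dl cr dr f) : MemLp f 2 (jacobiMeasure α β) := by
  obtain ⟨C1, hC1, h1⟩ := hf.left.exists_norm_le hp.right_nonneg hp.right_lt
  obtain ⟨C2, hC2, h2⟩ := hf.right.exists_norm_le hp.left_nonneg hp.left_lt
  replace h2 := tendsto_neg_nhdsLT_one.eventually h2
  simp only [neg_neg, ← sub_eq_add_neg] at h2
  obtain ⟨a, ha, h1⟩ := (mem_nhdsGT_iff_exists_Ioo_subset' (show (-1 : ℝ) < 0 by norm_num)).1 h1
  obtain ⟨b, hb, h2⟩ := (mem_nhdsLT_iff_exists_Ioo_subset' (show (0 : ℝ) < 1 by norm_num)).1 h2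
  have ha' : (-1 : ℝ) < a := ha
  have hb' : b < (1 : ℝ) := hb
  obtain ⟨C3, h3⟩ := isCompact_Icc.exists_bound_of_continuousOn
    (hf.smooth.continuousOn.mono (Icc_subset_Ioo ha' hb'))
  refine (memLp_endpointBound hp.left_nonneg hp.left_lt hp.right_nonneg hp.right_lt).of_le_mul
    (c := C1 + C2 + |C3|) (aestronglyMeasurable_of_continuousOn hf.smooth.continuousOn) ?_
  filter_upwards [ae_mem_Ioo_jacobiMeasure] with x hx
  have q1 : 0 < 1 - x := by linarith [hx.2]
  have q2 : 0 < 1 + x := by linarith [hx.1]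
  have p1 : 0 < (1 - x) ^ (-(midExp α)) := Real.rpow_pos_of_pos q1 _
  have p2 : 0 < (1 + x) ^ (-(midExp β)) := Real.rpow_pos_of_pos q2 _
  have p3 := abs_nonneg C3
  have p4 : 1 ≤ endpointBound (midExp α) (midExp β) x := by
    rw [endpointBound]
    rcases le_total 0 x with h | h
    · have := Real.one_le_rpow_of_pos_of_le_one_of_nonpos q1 (by linarith)
        (show -midExp α ≤ 0 by rw [midExp]; linarith [hp.left_nonneg])
      linarith
    · have := Real.one_le_rpow_of_pos_of_le_one_of_nonpos q2 (by linarith)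
        (show -midExp β ≤ 0 by rw [midExp]; linarith [hp.right_nonneg])
      linarith
  have p5 : (1 + x) ^ (-(midExp β)) ≤ endpointBound (midExp α) (midExp β) x := by
    rw [endpointBound]
    linarith
  have p6 : (1 - x) ^ (-(midExp α)) ≤ endpointBound (midExp α) (midExp β) x := by
    rw [endpointBound]
    linarith
  rw [Real.norm_of_nonneg (by linarith : 0 ≤ endpointBound (midExp α) (midExp β) x), add_mul,
    add_mul]
  have r1 : 0 ≤ C1 * endpointBound (midExp α) (midExp β) x := mul_nonneg hC1 (by linarith)
  have r2 : 0 ≤ C2 * endpointBound (midExp α) (midExp β) x := mul_nonneg hC2 (by linarith)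
  have r3 : 0 ≤ |C3| * endpointBound (midExp α) (midExp β) x := mul_nonneg p3 (by linarith)
  rcases lt_or_ge x a with h | h
  · have h4 : ‖f x‖ ≤ C1 * (1 + x) ^ (-midExp β) := h1 ⟨hx.1, h⟩
    linarith [mul_le_mul_of_nonneg_left p5 hC1]
  rcases lt_or_ge b x with h' | h'
  · have h4 : ‖f x‖ ≤ C2 * (1 - x) ^ (-midExp α) := h2 ⟨h', hx.2⟩
    linarith [mul_le_mul_of_nonneg_left p6 hC2]
  · have h4 := h3 x ⟨h, h'⟩
    linarith [le_abs_self C3, mul_le_mul_of_nonneg_left p4 p3]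

/-! ### Reflection and the maximal domain -/

lemma jacobiExpr_comp_neg (α β : ℝ) (f : ℝ → ℂ) :
    jacobiExpr β α (fun x => f (-x)) = fun x => jacobiExpr α β f (-x) := by
  have hw : ∀ a b x : ℝ, jacobiWeight b a x = jacobiWeight a b (-x) := fun a b x => by
    simp [jacobiWeight, mul_comm, sub_eq_add_neg]
  have h1 : (fun y => jacobiWeight (β + 1) (α + 1) y • deriv (fun x => f (-x)) y) =
      fun y => (fun z => -(jacobiWeight (α + 1) (β + 1) z • deriv f z)) (-y) := by
    ext y
    rw [deriv_comp_neg, hw (α + 1), smul_neg]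
  ext x
  rw [jacobiExpr, h1, deriv_comp_neg (fun z => -(jacobiWeight (α + 1) (β + 1) z • deriv f z)),
    deriv.fun_neg, neg_neg, hw α, jacobiExpr]

lemma jacobiPow_comp_neg (α β : ℝ) : ∀ (k : ℕ) (f : ℝ → ℂ),
    jacobiPow β α k (fun x => f (-x)) = fun x => jacobiPow α β k f (-x)
  | 0, _ => rfl
  | k + 1, f => by
    have h := jacobiPow_comp_neg α β k (jacobiExpr α β f)
    rw [← jacobiExpr_comp_neg] at h
    exact h

lemma jacobiExpr_contDiffOn {f : ℝ → ℂ} (hf : ContDiffOn ℝ ∞ f (Ioo (-1) 1)) :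
    ContDiffOn ℝ ∞ (jacobiExpr α β f) (Ioo (-1) 1) := by
  have hd : ∀ {g : ℝ → ℂ}, ContDiffOn ℝ ∞ g (Ioo (-1) 1) →
      ContDiffOn ℝ ∞ (deriv g) (Ioo (-1) 1) := fun hg =>
    ((contDiffOn_infty_iff_deriv_of_isOpen isOpen_Ioo).1 hg).2
  exact ((jacobiWeight_inv_contDiffOn α β).smul
    (hd ((jacobiWeight_contDiffOn (α + 1) (β + 1)).smul (hd hf)))).neg

lemma HasExpansions.jacobiExpr {N : ℕ} {cl dl cr dr : ℕ → ℂ} {f : ℝ → ℂ}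
    (hf : HasExpansions α β N cl dl cr dr f) :
    HasExpansions α β N (nextFirst α β cl dl) (nextSecond α β dl) (nextFirst β α cr dr)
      (nextSecond β α dr) (jacobiExpr α β f) := by
  refine ⟨jacobiExpr_contDiffOn hf.smooth, hf.left.jacobiExpr, ?_⟩
  rw [← jacobiExpr_comp_neg]
  exact hf.right.jacobiExpr

lemma HasExpansions.memLp_jacobiPow (hp : AdmissibleParams α β) {N : ℕ} : ∀ {k : ℕ}
    {cl dl cr dr : ℕ → ℂ} {f : ℝ → ℂ}, HasExpansions α β N cl dl cr dr f →
    MemLp (jacobiPow α β k f) 2 (jacobiMeasure α β)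
  | 0, _, _, _, _, _, hf => hf.memLp hp
  | _ + 1, _, _, _, _, _, hf => hf.jacobiExpr.memLp_jacobiPow hp

lemma HasExpansions.isJacobiMaxFun (hp : AdmissibleParams α β) {N : ℕ} {cl dl cr dr : ℕ → ℂ}
    {f : ℝ → ℂ} (hf : HasExpansions α β N cl dl cr dr f) (n : ℕ) : IsJacobiMaxFun α β n f :=
  ⟨locAC_of_contDiffOn (k := 2 * n - 1) hf.smooth, hf.memLp hp, hf.memLp_jacobiPow hp⟩

lemma HasExpansions.coeff_eq_zero (hp : AdmissibleParams α β) {N n : ℕ} {cl dl cr dr : ℕ → ℂ}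
    {f : ℝ → ℂ} (hf : HasExpansions α β N cl dl cr dr f)
    (h : (hf.isJacobiMaxFun hp n).toL2 ∈ jacobiMinDomain α β n) {k : ℕ} (hk : k < n) :
    (cl k = 0 ∧ dl k = 0) ∧ cr k = 0 ∧ dr k = 0 := by
  refine ⟨hf.left.coeff_eq_zero hp.right_nonneg hp.right_lt (α := α) (m := n - 1)
    (fun l hl => (hp.tendsto_of_mem_minDomain _ (by omega) h).1) k (by omega),
    hf.right.coeff_eq_zero hp.left_nonneg hp.left_lt (α := β) (m := n - 1)
    (fun l hl => ?_) k (by omega)⟩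
  rw [jacobiPow_comp_neg]
  exact (hp.tendsto_of_mem_minDomain (hf.isJacobiMaxFun hp n) (by omega) h).2.comp
    tendsto_neg_nhdsGT_neg_one

/-! ### Linear combinations of endpoint functions -/

lemma hasLeftExpansion_zero {N : ℕ} {f : ℝ → ℂ} (h : ∀ᶠ x in 𝓝[>] (-1 : ℝ), f x = 0) :
    HasLeftExpansion β N 0 0 f :=
  ⟨fun _ _ => rfl, fun _ _ => rfl, h.mono fun x hx => by simp [hx, endpointSum]⟩

lemma hasLeftExpansion_firstKind {N j : ℕ} (hj : j < N) {f : ℝ → ℂ}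
    (h : ∀ᶠ x in 𝓝[>] (-1 : ℝ), f x = firstKind j (1 + x)) :
    HasLeftExpansion β N (Pi.single j 1) 0 f := by
  refine ⟨fun i hi => Pi.single_eq_of_ne (by omega) _, fun _ _ => rfl, h.mono fun x hx => ?_⟩
  simp [hx, endpointSum, Pi.single_apply, hj]

lemma hasLeftExpansion_secondKind {N j : ℕ} (hj : j < N) {f : ℝ → ℂ}
    (h : ∀ᶠ x in 𝓝[>] (-1 : ℝ), f x = secondKind β j (1 + x)) :
    HasLeftExpansion β N 0 (Pi.single j 1) f := by
  refine ⟨fun _ _ => rfl, fun i hi => Pi.single_eq_of_ne (by omega) _, h.mono fun x hx => ?_⟩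
  simp [hx, endpointSum, Pi.single_apply, hj]

lemma HasLeftExpansion.sum {ι : Type*} [Fintype ι] {N : ℕ} {c d : ι → ℕ → ℂ} {f : ι → ℝ → ℂ}
    (a : ι → ℂ) (h : ∀ i, HasLeftExpansion β N (c i) (d i) (f i)) :
    HasLeftExpansion β N (∑ i, a i • c i) (∑ i, a i • d i) (∑ i, a i • f i) := by
  refine ⟨fun j hj => ?_, fun j hj => ?_, ?_⟩
  · simp [fun i => (h i).first_eq_zero j hj]
  · simp [fun i => (h i).second_eq_zero j hj]
  · filter_upwards [eventually_all.2 fun i => (h i).eventually_eq] with x hx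
    simp only [Finset.sum_apply, Pi.smul_apply, smul_eq_mul, hx, endpointSum, Finset.mul_sum,
      Finset.sum_mul]
    rw [Finset.sum_comm]
    refine Finset.sum_congr rfl fun j _ => ?_
    rw [← Finset.sum_add_distrib]
    refine Finset.sum_congr rfl fun i _ => ?_
    ring

lemma HasExpansions.sum {ι : Type*} [Fintype ι] {N : ℕ} {cl dl cr dr : ι → ℕ → ℂ}
    {f : ι → ℝ → ℂ} (a : ι → ℂ)
    (h : ∀ i, HasExpansions α β N (cl i) (dl i) (cr i) (dr i) (f i)) :
    HasExpansions α β N (∑ i, a i • cl i) (∑ i, a i • dl i) (∑ i, a i • cr i) (∑ i, a i • dr i)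
      (∑ i, a i • f i) := by
  refine ⟨?_, HasLeftExpansion.sum a fun i => (h i).left, ?_⟩
  · have e : (∑ i, a i • f i) = fun x => ∑ i, a i • f i x := by
      ext x
      simp
    rw [e]
    exact ContDiffOn.sum fun i _ => contDiffOn_const.fun_smul (h i).smooth
  · convert HasLeftExpansion.sum a fun i => (h i).right using 1
    ext x
    simp

lemma IsLeftEndpointFun.hasExpansions_firstKind {N j : ℕ} (hj : j < N) {f : ℝ → ℂ}
    (h : IsLeftEndpointFun (firstKind j) f) : HasExpansions α β N (Pi.single j 1) 0 0 0 f :=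
  ⟨h.smooth, hasLeftExpansion_firstKind hj h.near_left,
    hasLeftExpansion_zero (tendsto_neg_nhdsGT_neg_one.eventually h.near_right)⟩

lemma IsLeftEndpointFun.hasExpansions_secondKind {N j : ℕ} (hj : j < N) {f : ℝ → ℂ}
    (h : IsLeftEndpointFun (secondKind β j) f) : HasExpansions α β N 0 (Pi.single j 1) 0 0 f :=
  ⟨h.smooth, hasLeftExpansion_secondKind hj h.near_left,
    hasLeftExpansion_zero (tendsto_neg_nhdsGT_neg_one.eventually h.near_right)⟩

lemma IsRightEndpointFun.hasExpansions_firstKind {N j : ℕ} (hj : j < N) {f : ℝ → ℂ}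
    (h : IsRightEndpointFun (firstKind j) f) : HasExpansions α β N 0 0 (Pi.single j 1) 0 f :=
  ⟨h.smooth, hasLeftExpansion_zero h.near_left, hasLeftExpansion_firstKind hj <|
    (tendsto_neg_nhdsGT_neg_one.eventually h.near_right).mono fun x hx => by
      rw [hx, sub_neg_eq_add]⟩

lemma IsRightEndpointFun.hasExpansions_secondKind {N j : ℕ} (hj : j < N) {f : ℝ → ℂ}
    (h : IsRightEndpointFun (secondKind α j) f) : HasExpansions α β N 0 0 0 (Pi.single j 1) f :=
  ⟨h.smooth, hasLeftExpansion_zero h.near_left, hasLeftExpansion_secondKind hj <|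
    (tendsto_neg_nhdsGT_neg_one.eventually h.near_right).mono fun x hx => by
      rw [hx, sub_neg_eq_add]⟩

lemma coeFn_sum_smul_toLp {ι : Type*} (s : Finset ι) {f : ι → ℝ → ℂ} (a : ι → ℂ)
    (h : ∀ i, MemLp (f i) 2 (jacobiMeasure α β)) :
    (∑ i ∈ s, a i • (h i).toLp (f i) : JacobiL2 α β) =ᵐ[jacobiMeasure α β]
      ∑ i ∈ s, a i • f i := by
  classical
  induction s using Finset.induction_on with
  | empty => exact Lp.coeFn_zero _ _ _
  | insert i s hi ih =>
    rw [Finset.sum_insert hi, Finset.sum_insert hi]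
    exact (Lp.coeFn_add _ _).trans
      (((Lp.coeFn_smul _ _).trans ((h i).coeFn_toLp.const_smul (a i))).add ih)

/-- The `4n` endpoint functions are linearly independent modulo the minimal domain. -/
lemma linearIndependent_mkQ_toL2 (hp : AdmissibleParams α β) {n : ℕ}
    {φp ψp φm ψm : Fin n → ℝ → ℂ}
    (hφp : ∀ j : Fin n, IsRightEndpointFun (firstKind j) (φp j))
    (hψp : ∀ j : Fin n, IsRightEndpointFun (secondKind α j) (ψp j))
    (hφm : ∀ j : Fin n, IsLeftEndpointFun (firstKind j) (φm j))
    (hψm : ∀ j : Fin n, IsLeftEndpointFun (secondKind β j) (ψm j))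
    (h : ∀ i, IsJacobiMaxFun α β n (Sum.elim (Sum.elim φp ψp) (Sum.elim φm ψm) i)) :
    LinearIndependent ℂ ((jacobiMinDomain α β n).mkQ ∘ fun i => (h i).toL2) := by
  have H : ∀ i, HasExpansions α β n
      (Sum.elim 0 (Sum.elim (fun j : Fin n => Pi.single (j : ℕ) 1) 0) i)
      (Sum.elim 0 (Sum.elim 0 fun j : Fin n => Pi.single (j : ℕ) 1) i)
      (Sum.elim (Sum.elim (fun j : Fin n => Pi.single (j : ℕ) 1) 0) 0 i)
      (Sum.elim (Sum.elim 0 fun j : Fin n => Pi.single (j : ℕ) 1) 0 i)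
      (Sum.elim (Sum.elim φp ψp) (Sum.elim φm ψm) i) := by
    rintro ((j | j) | (j | j))
    · exact (hφp j).hasExpansions_firstKind j.2
    · exact (hψp j).hasExpansions_secondKind j.2
    · exact (hφm j).hasExpansions_firstKind j.2
    · exact (hψm j).hasExpansions_secondKind j.2
  rw [Fintype.linearIndependent_iff]
  intro a ha
  have hsum := HasExpansions.sum a H
  have e : (hsum.isJacobiMaxFun hp n).toL2 = ∑ i, a i • (h i).toL2 :=
    Lp.ext ((hsum.memLp hp).coeFn_toLp.trans
      (coeFn_sum_smul_toLp _ a fun i => (h i).memLp).symm)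
  have hmem : (hsum.isJacobiMaxFun hp n).toL2 ∈ jacobiMinDomain α β n := by
    rw [e, ← Submodule.Quotient.mk_eq_zero, ← Submodule.mkQ_apply, map_sum]
    simpa using ha
  have hz := fun j : Fin n => hsum.coeff_eq_zero hp hmem j.2
  simp only [Fintype.sum_sum_type, Sum.elim_inl, Sum.elim_inr, Pi.zero_apply,
    Finset.sum_const_zero, zero_add, add_zero, Finset.sum_apply, Pi.smul_apply, Pi.single_apply,
    smul_eq_mul, mul_ite, mul_one, mul_zero, Fin.val_inj, Finset.sum_ite_eq, Finset.mem_univ,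
    if_true] at hz
  rintro ((j | j) | (j | j))
  · exact (hz j).2.1
  · exact (hz j).2.2
  · exact (hz j).1.1
  · exact (hz j).1.2

end

end

theorem corollary4p10 (α β : ℝ) (hα : 0 ≤ α) (hα1 : α < 1) (hβ : 0 ≤ β) (hβ1 : β < 1)
    (n : ℕ) (hn : 1 ≤ n) (φp ψp φm ψm : Fin n → ℝ → ℂ)
    (hφp : ∀ j : Fin n, IsRightEndpointFun (firstKind j) (φp j))
    (hψp : ∀ j : Fin n, IsRightEndpointFun (secondKind α j) (ψp j))
    (hφm : ∀ j : Fin n, IsLeftEndpointFun (firstKind j) (φm j))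
    (hψm : ∀ j : Fin n, IsLeftEndpointFun (secondKind β j) (ψm j)) :
    -- all the endpoint functions lie in the maximal domain
    ∃ (hp : ∀ i : Fin n ⊕ Fin n, IsJacobiMaxFun α β n (Sum.elim φp ψp i))
      (hm : ∀ i : Fin n ⊕ Fin n, IsJacobiMaxFun α β n (Sum.elim φm ψm i)),
      let bp : Fin n ⊕ Fin n → JacobiL2 α β := fun i => (hp i).toL2
      let bm : Fin n ⊕ Fin n → JacobiL2 α β := fun i => (hm i).toL2
      let Dp : Submodule ℂ (JacobiL2 α β) := Submodule.span ℂ (Set.range bp)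
      let Dm : Submodule ℂ (JacobiL2 α β) := Submodule.span ℂ (Set.range bm)
      let Dmin : Submodule ℂ (JacobiL2 α β) := (jacobiMin α β n).domain
      let Np : Submodule ℂ (JacobiL2 α β) := defectSpace (jacobiMin α β n) Complex.I
      let Nm : Submodule ℂ (JacobiL2 α β) := defectSpace (jacobiMin α β n) (-Complex.I)
      -- the `4n` endpoint functions are a basis of the maximal domain modulo the minimal domain
      LinearIndependent ℂ (Dmin.mkQ ∘ Sum.elim bp bm) ∧
      Dmin ⊔ (Dm ⊔ Dp) = (jacobiMax α β n).domain ∧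
      -- the deficiency indices are `(2n, 2n)`
      Module.finrank ℂ Np = 2 * n ∧ Module.finrank ℂ Nm = 2 * n ∧
      -- the endpoint functions are bases of the `2n`-dimensional spaces `Dp` and `Dm`
      ∃ (Bp : Module.Basis (Fin n ⊕ Fin n) ℂ Dp) (Bm : Module.Basis (Fin n ⊕ Fin n) ℂ Dm),
        (∀ i, (Bp i : JacobiL2 α β) = bp i) ∧ (∀ i, (Bm i : JacobiL2 α β) = bm i) ∧
        ∀ (ep : OrthonormalBasis (Fin n ⊕ Fin n) ℂ Np)
          (em : OrthonormalBasis (Fin n ⊕ Fin n) ℂ Nm),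
          let Up : Np ≃ₗ[ℂ] Dp := ep.toBasis.equiv Bp (Equiv.refl _)
          let Um : Nm ≃ₗ[ℂ] Dm := em.toBasis.equiv Bm (Equiv.refl _)
          let ext : Matrix (Fin n ⊕ Fin n) (Fin n ⊕ Fin n) ℂ → (JacobiL2 α β →ₗ.[ℂ] JacobiL2 α β) :=
            fun u => jacobiExtension α β n
              (Um.symm.toLinearMap ∘ₗ Matrix.toLin Bp Bm u ∘ₗ Up.toLinearMap)
          -- unitary matrices `u : Dp → Dm` correspond one-to-one to the self-adjoint extensions
          Set.BijOn ext (Matrix.unitaryGroup (Fin n ⊕ Fin n) ℂ)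
            {A | jacobiMin α β n ≤ A ∧ IsSelfAdjoint A} ∧
          -- the domain of each of them in terms of the endpoint functions
          ∃ Cp Cm : Matrix ((Fin n ⊕ Fin n) ⊕ (Fin n ⊕ Fin n)) (Fin n ⊕ Fin n) ℂ,
            IsUnit (Matrix.fromCols Cp Cm).det ∧
            ∀ u ∈ Matrix.unitaryGroup (Fin n ⊕ Fin n) ℂ, (ext u).domain =
              Dmin ⊔ Submodule.span ℂ (Set.range fun j : Fin n ⊕ Fin n =>
                ∑ i, (Cp + Cm * u) i j • Sum.elim bp bm i) := by
  have hp : AdmissibleParams α β := ⟨hα, hα1, hβ, hβ1⟩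
  have h1 : ∀ i : Fin n ⊕ Fin n, IsJacobiMaxFun α β n (Sum.elim φp ψp i) := by
    rintro (j | j)
    · exact ((hφp j).hasExpansions_firstKind j.2).isJacobiMaxFun hp n
    · exact ((hψp j).hasExpansions_secondKind j.2).isJacobiMaxFun hp n
  have h2 : ∀ i : Fin n ⊕ Fin n, IsJacobiMaxFun α β n (Sum.elim φm ψm i) := by
    rintro (j | j)
    · exact ((hφm j).hasExpansions_firstKind j.2).isJacobiMaxFun hp n
    · exact ((hψm j).hasExpansions_secondKind j.2).isJacobiMaxFun hp n
  refine ⟨h1, h2, ?_⟩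
  intro bp bm Dp Dm Dmin Np Nm
  have hmin : Dmin = jacobiMinDomain α β n := jacobiMin_domain α β n
  have hG := hp.hasResolventGraph hn
  have hT := hp.inv_pow_isSymmetric n
  have hD := isGreenKernel_jacobiMinDomain α β n
  obtain ⟨hfin, hle⟩ := hp.finiteDimensional_solSpace n
  have hli : LinearIndependent ℂ ((jacobiMinDomain α β n).mkQ ∘ Sum.elim bp bm) := by
    have h := linearIndependent_mkQ_toL2 hp hφp hψp hφm hψm (by rintro (i | i); exacts [h1 i, h2 i])
    convert h using 2
    ext1 i
    rcases i with i | i <;> rfl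
  have hb : ∀ i, Sum.elim bp bm i ∈ (jacobiMax α β n).domain := by
    rintro (i | i)
    · exact mem_jacobiMax_domain.2 ⟨_, h1 i, rfl⟩
    · exact mem_jacobiMax_domain.2 ⟨_, h2 i, rfl⟩
  obtain ⟨hrank, hspan, hsup⟩ := hG.decomposition hT hD hle (by simp; ring) hb hli
  have hli' : LinearIndependent ℂ (Sum.elim bp bm) := hli.of_comp _
  have hlip : LinearIndependent ℂ bp := hli'.comp Sum.inl Sum.inl_injective
  have hlim : LinearIndependent ℂ bm := hli'.comp Sum.inr Sum.inr_injective
  refine ⟨by rwa [hmin], ?_, ?_, ?_, Module.Basis.span hlip, Module.Basis.span hlim,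
    fun i => congrArg Subtype.val (Module.Basis.span_apply hlip i),
    fun i => congrArg Subtype.val (Module.Basis.span_apply hlim i), ?_⟩
  · rw [hmin, ← hspan, Set.Sum.elim_range, Submodule.span_union, sup_comm Dm Dp]
  · exact (hG.finrank_defect hT hD (by simp)).2.trans hrank
  · exact (hG.finrank_defect hT hD (by simp)).2.trans hrank
  intro ep em Up Um ext
  have hext : ext = fun u => (jacobiMax α β n).domRestrict (naimarkDomain (jacobiMinDomain α β n)
      _ _ (Matrix.toLin ep.toBasis em.toBasis u)) := by
    funext u
    simp only [ext, Up, Um, jacobiExtension]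
    rw [equiv_symm_comp_toLin_comp_equiv, jacobiMin_domain]
  rw [hext, hmin]
  refine ⟨hG.bijOn_unitaryGroup hT hD hsup ep em, ?_⟩
  obtain ⟨Cp, Cm, hC, hu⟩ := hG.exists_extension_domain hT hD hli hspan ep em
  exact ⟨Cp, Cm, hC, fun u _ => hu u⟩
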